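/- All vector spaces and subalgebras are $\mathbb Z/2$-graded. Let $\mathfrak g=\mathfrak g_{\bar 0}\oplus\mathfrak g_{\bar 1}$ be a finite-dimensional complex Lie superalgebra, $\tau:\mathfrak g\to\mathfrak g$ an antilinear (parity-preserving, bracket-preserving) involution, and $\mathfrak g^{\mathbb R}$ the real form of its fixed points. A triangular decomposition is a vector space decomposition $\mathfrak g=\bar{\mathfrak u}\oplus\mathfrak l\oplus\mathfrak u$ into subalgebras with $[\mathfrak l,\mathfrak u]\subseteq\mathfrak u$ and $[\mathfrak l,\bar{\mathfrak u}]\subseteq\bar{\mathfrak u}$; it is $\tau$-stable if $\tau$ maps each of $\bar{\mathfrak u},\mathfrak l,\mathfrak u$ onto itself. For a $\mathfrak g$-module $W$ let $W^{\mathfrak u}=\{w\in W: x\cdot w=0\text{ for all }x\in\mathfrak u\}$, an $\mathfrak l$-module. For an $\mathfrak l$-module $N$ let $\mathrm{Ind}_{\mathfrak q}^{\mathfrak g}N=U(\mathfrak g)\otimes_{U(\mathfrak q)}N$, where $\mathfrak q=\mathfrak l\oplus\mathfrak u$ and $\mathfrak u$ acts on $N$ by zero. Endotype. Let $W$ be an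 irreducible finite-dimensional $\mathfrak g$-module. There is an irreducible real $\mathfrak g^{\mathbb R}$-module $V$, unique up to isomorphism, such that $W$ with scalars restricted to $\mathbb R$ is isomorphic, as a $\mathfrak g^{\mathbb R}$-module, to $V$ or to $V\oplus V$. With $\Pi$ the parity change functor (same space and action, opposite parity), $\mathrm{Hom}_{\mathfrak g^{\mathbb R}}(V,V)\oplus\mathrm{Hom}_{\mathfrak g^{\mathbb R}}(V,\Pi V)$ (parity-preserving homomorphisms) is a division superalgebra over $\mathbb R$ under composition; its isomorphism class is the endotype $\mathrm{EType}_{\mathfrak g,\tau}(W)$, an element of the Brauer--Wall monoid of $\mathbb R$. The triangular decomposition is of *hyperbolic type* if there is $x_\circ\in\mathfrak g^{\mathbb R}_{\bar 0}$ such that $\mathrm{ad}_{x_\circ}$ on $\mathfrak g^{\mathbb R}$ is diagonalizable with real eigenvalues and $\bar{\mathfrak u},\mathfrak l,\mathfrak u$ are the complexifications of the sums of the eigenspaces of $\mathrm{ad}_{x_\circ}$ for negative, zero and positive eigenvalues, respectively. It is of *graded type* if there is a $\mathbb Z$-grading $\mathfrak g=\bigoplus_{i\in\mathbb Z}\mathfrak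 g^{(i)}$ by $\mathbb Z/2$-graded subspaces, with $[\mathfrak g^{(i)},\mathfrak g^{(j)}]\subseteq\mathfrak g^{(i+j)}$, such that $\mathfrak l=\mathfrak g^{(0)}$, $\mathfrak u=\bigoplus_{i\ge1}\mathfrak g^{(i)}$, $\bar{\mathfrak u}=\bigoplus_{i\le-1}\mathfrak g^{(i)}$; for some Borel (i.e. maximal solvable) subalgebra $\mathfrak b^{(0)}\subseteq(\mathfrak g^{(0)})_{\bar0}$ and $\mathfrak b=\mathfrak b^{(0)}\oplus\mathfrak u$ one has $[\mathfrak b_{\bar1},\mathfrak b_{\bar1}]\subseteq[\mathfrak b_{\bar0},\mathfrak b_{\bar0}]$ and $[\mathfrak b^{(0)},(\mathfrak g^{(1)})_{\bar0}]=(\mathfrak g^{(1)})_{\bar0}$; and $\mathfrak g^{(1)}$ generates $\mathfrak u$ and $\mathfrak g^{(-1)}$ generates $\bar{\mathfrak u}$. **Statement.** Suppose $\mathfrak g=\bar{\mathfrak u}\oplus\mathfrak l\oplus\mathfrak u$ is a $\tau$-stable triangular decomposition. 1. If for every irreducible finite-dimensional $\mathfrak g$-module $W$ the $\mathfrak l$-module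 $W^{\mathfrak u}$ is irreducible and $\mathrm{Ind}_{\mathfrak q}^{\mathfrak g}(W^{\mathfrak u})$ has a unique maximal proper submodule, then $\mathrm{EType}_{\mathfrak g,\tau}(W)=\mathrm{EType}_{\mathfrak l,\tau|_{\mathfrak l}}(W^{\mathfrak u})$ for every irreducible finite-dimensional $\mathfrak g$-module $W$. 2. If the decomposition is of hyperbolic type, or of graded type with $\bar{\mathfrak u}\subseteq\mathfrak g_{\bar1}$, then for every irreducible finite-dimensional $\mathfrak g$-module $W$ the $\mathfrak l$-module $W^{\mathfrak u}$ is irreducible and $\mathrm{EType}_{\mathfrak g,\tau}(W)=\mathrm{EType}_{\mathfrak l,\tau|_{\mathfrak l}}(W^{\mathfrak u})$. -/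

import Mathlib

universe u v w

/-! Superspaces: a vector space `V` with a family `p : ZMod 2 → Submodule K V` such that
`V` is the direct sum of `p 0` (even part) and `p 1` (odd part). -/

namespace SuperSpace

section

variable {K : Type*} {V : Type*} [Field K] [AddCommGroup V] [Module K V]

/-- The sign `(-1)^i`; the Koszul sign `(-1)^{ij}` is `sgn (i * j)`. -/
def sgn (i : ZMod 2) : ℤ := if i = 0 then 1 else -1

theorem sgn_zero : sgn 0 = 1 := rfl

theorem sgn_one : sgn 1 = -1 := rfl

theorem sgn_add (i j : ZMod 2) : sgn (i + j) = sgn i * sgn j := by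
  revert i j; decide

theorem zmod_two_cases (i : ZMod 2) : i = 0 ∨ i = 1 := by
  revert i; decide

/-- A graded subspace: every element of `S` is a sum of an even and an odd element of `S`. -/
def IsGradedSubspace (p : ZMod 2 → Submodule K V) (S : Submodule K V) : Prop :=
  S ≤ (S ⊓ p 0) ⊔ (S ⊓ p 1)

theorem hom_induction {p : ZMod 2 → Submodule K V} (h : IsCompl (p 0) (p 1)) {P : V → Prop}
    (hom : ∀ i x, x ∈ p i → P x) (add : ∀ x y, P x → P y → P (x + y)) (x : V) : P x := by
  have hx : x ∈ p 0 ⊔ p 1 := by rw [h.sup_eq_top]; trivial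
  obtain ⟨a, ha, b, hb, rfl⟩ := Submodule.mem_sup.1 hx
  exact add _ _ (hom 0 a ha) (hom 1 b hb)

theorem eq_zero_of_mem {p : ZMod 2 → Submodule K V} (h : IsCompl (p 0) (p 1)) {i : ZMod 2} {x : V}
    (h1 : x ∈ p i) (h2 : x ∈ p (i + 1)) : x = 0 := by
  rcases zmod_two_cases i with rfl | rfl
  · exact Submodule.disjoint_def.1 h.disjoint x h1 (by simpa using h2)
  · exact Submodule.disjoint_def.1 h.disjoint x (by simpa [show (1 + 1 : ZMod 2) = 0 from rfl] using h2) h1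

theorem IsGradedSubspace.isCompl {p : ZMod 2 → Submodule K V} (h : IsCompl (p 0) (p 1))
    {S : Submodule K V} (hS : IsGradedSubspace p S) :
    IsCompl ((p 0).comap S.subtype) ((p 1).comap S.subtype) := by
  constructor
  · rw [Submodule.disjoint_def]
    intro x h0 h1
    exact Subtype.ext (Submodule.disjoint_def.1 h.disjoint _ h0 h1)
  · rw [codisjoint_iff_le_sup]
    intro x _
    obtain ⟨a, ha, b, hb, hab⟩ := Submodule.mem_sup.1 (hS x.2)
    exact Submodule.mem_sup.2 ⟨⟨a, ha.1⟩, ha.2, ⟨b, hb.1⟩, hb.2, Subtype.ext hab⟩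

/-- The parity involution, which is `(-1)^i` on `p i`. -/
noncomputable def parity (p : ZMod 2 → Submodule K V) (h : IsCompl (p 0) (p 1)) : V →ₗ[K] V :=
  (p 0).projection (p 1) h - (p 1).projection (p 0) h.symm

theorem parity_of_mem {p : ZMod 2 → Submodule K V} (h : IsCompl (p 0) (p 1)) {i : ZMod 2} {x : V}
    (hx : x ∈ p i) : parity p h x = sgn i • x := by
  rcases zmod_two_cases i with rfl | rfl
  · simp [parity, sgn_zero, Submodule.projection_apply_left _ ⟨x, hx⟩,
      Submodule.projection_apply_of_mem_right, hx]
  · simp [parity, sgn_one, Submodule.projection_apply_of_mem_left,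
      Submodule.projection_apply_of_mem_right, hx]

theorem parity_parity {p : ZMod 2 → Submodule K V} (h : IsCompl (p 0) (p 1)) (x : V) :
    parity p h (parity p h x) = x := by
  refine hom_induction h (P := fun x => parity p h (parity p h x) = x) ?_ ?_ x
  · intro i x hx
    rcases zmod_two_cases i with rfl | rfl <;> simp [parity_of_mem h hx, sgn_zero, sgn_one]
  · intro x y hx hy
    rw [map_add, map_add, hx, hy]

theorem mem_of_parity [CharZero K] {p : ZMod 2 → Submodule K V} (h : IsCompl (p 0) (p 1))
    {i : ZMod 2} {x : V} (hx : parity p h x = sgn i • x) : x ∈ p i := by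
  have hx' : x ∈ p 0 ⊔ p 1 := by rw [h.sup_eq_top]; trivial
  obtain ⟨a, ha, b, hb, rfl⟩ := Submodule.mem_sup.1 hx'
  have h2 : (2 : K) ≠ 0 := two_ne_zero
  rw [map_add, parity_of_mem h ha, parity_of_mem h hb] at hx
  rcases zmod_two_cases i with rfl | rfl
  · have : (2 : K) • b = 0 := by
      rw [two_smul]
      simp [sgn_zero, sgn_one] at hx
      exact neg_eq_iff_add_eq_zero.1 hx
    rw [(smul_eq_zero.1 this).resolve_left h2, add_zero]; exact ha
  · have : (2 : K) • a = 0 := by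
      rw [two_smul]
      simp [sgn_zero, sgn_one] at hx
      exact add_eq_zero_iff_eq_neg.2 hx
    rw [(smul_eq_zero.1 this).resolve_left h2, zero_add]; exact hb

/-- The eigenspace of an endomorphism `s` for the eigenvalue `(-1)^i`. -/
def signPart (s : V →ₗ[K] V) (i : ZMod 2) : Submodule K V where
  carrier := {x | s x = sgn i • x}
  zero_mem' := by simp
  add_mem' := by
    intro x y hx hy
    change s _ = _
    change s x = _ at hx
    change s y = _ at hy
    rw [map_add, hx, hy, smul_add]
  smul_mem' := by
    intro c x hx
    change s _ = _
    change s x = _ at hx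
    rw [map_smul, hx, smul_comm]

theorem isCompl_signPart [CharZero K] (s : V →ₗ[K] V) (hs : ∀ x, s (s x) = x) :
    IsCompl (signPart s 0) (signPart s 1) := by
  have h2 : (2 : K) ≠ 0 := two_ne_zero
  constructor
  · rw [Submodule.disjoint_def]
    intro x h0 h1
    have h0' : s x = sgn 0 • x := h0
    have h1' : s x = sgn 1 • x := h1
    rw [h0', sgn_zero, sgn_one] at h1'
    have : (2 : K) • x = 0 := by
      rw [two_smul]; simp at h1'; exact add_eq_zero_iff_eq_neg.2 h1'
    exact (smul_eq_zero.1 this).resolve_left h2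
  · rw [codisjoint_iff_le_sup]
    intro x _
    refine Submodule.mem_sup.2 ⟨(2 : K)⁻¹ • (x + s x), ?_, (2 : K)⁻¹ • (x - s x), ?_, ?_⟩
    · change s _ = sgn 0 • _
      rw [map_smul, map_add, hs, sgn_zero, one_smul, add_comm]
    · change s _ = sgn 1 • _
      rw [map_smul, map_sub, hs, sgn_one, neg_smul, one_smul, ← smul_neg, neg_sub]
    · rw [← smul_add, add_add_sub_cancel, ← two_smul K x, smul_smul, inv_mul_cancel₀ h2, one_smul]

end

end SuperSpace

open SuperSpace

/-- A Lie superalgebra structure on the vector space `𝔤` over the field `K` (of characteristic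
zero in all uses). -/
structure LieSuperalgebra (K : Type*) (𝔤 : Type*) [Field K] [AddCommGroup 𝔤] [Module K 𝔤] where
  part : ZMod 2 → Submodule K 𝔤
  isCompl : IsCompl (part 0) (part 1)
  bracket : 𝔤 →ₗ[K] 𝔤 →ₗ[K] 𝔤
  bracket_mem : ∀ (i j : ZMod 2) (x y : 𝔤), x ∈ part i → y ∈ part j → bracket x y ∈ part (i + j)
  skew : ∀ (i j : ZMod 2) (x y : 𝔤), x ∈ part i → y ∈ part j →
    bracket x y = -(sgn (i * j) • bracket y x)
  jacobi : ∀ (i j : ZMod 2) (x y z : 𝔤), x ∈ part i → y ∈ part j →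
    bracket x (bracket y z) = bracket (bracket x y) z + sgn (i * j) • bracket y (bracket x z)

namespace LieSuperalgebra

section

variable {K : Type*} {𝔤 : Type*} [Field K] [AddCommGroup 𝔤] [Module K 𝔤]

/-- The even part of a Lie superalgebra is a Lie algebra. -/
noncomputable instance evenLieRing [CharZero K] (L : LieSuperalgebra K 𝔤) : LieRing (L.part 0) where
  bracket x y := ⟨L.bracket x y, L.bracket_mem 0 0 x y x.2 y.2⟩
  add_lie x y z := Subtype.ext (by simp)
  lie_add x y z := Subtype.ext (by simp)
  lie_self x := Subtype.ext (by
    have h := L.skew 0 0 (x : 𝔤) x x.2 x.2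
    rw [mul_zero, sgn_zero, one_smul, eq_neg_iff_add_eq_zero, ← two_smul K] at h
    exact (smul_eq_zero.1 h).resolve_left two_ne_zero)
  leibniz_lie x y z := Subtype.ext (by
    have h := L.jacobi 0 0 (x : 𝔤) y z x.2 y.2
    simpa [Bracket.bracket, sgn_zero] using h)

noncomputable instance evenLieAlgebra [CharZero K] (L : LieSuperalgebra K 𝔤) : LieAlgebra K (L.part 0) where
  lie_smul c x y := Subtype.ext (by simp [Bracket.bracket])


/-- A Lie subsuperalgebra: a graded subspace closed under the superbracket. -/
structure Subsuperalgebra (L : LieSuperalgebra K 𝔤) where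
  carrier : Submodule K 𝔤
  graded : IsGradedSubspace L.part carrier
  bracket_mem : ∀ x y : 𝔤, x ∈ carrier → y ∈ carrier → L.bracket x y ∈ carrier

/-- A Lie subsuperalgebra is a Lie superalgebra. -/
noncomputable abbrev Subsuperalgebra.toLie {L : LieSuperalgebra K 𝔤} (S : L.Subsuperalgebra) :
    LieSuperalgebra K S.carrier where
  part i := (L.part i).comap S.carrier.subtype
  isCompl := S.graded.isCompl L.isCompl
  bracket := LinearMap.mk₂ K (fun x y => ⟨L.bracket x y, S.bracket_mem x y x.2 y.2⟩)
    (fun x y z => Subtype.ext (by simp)) (fun c x y => Subtype.ext (by simp))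
    (fun x y z => Subtype.ext (by simp)) (fun c x y => Subtype.ext (by simp))
  bracket_mem i j x y hx hy := L.bracket_mem i j x y hx hy
  skew i j x y hx hy := Subtype.ext (by simpa using L.skew i j x y hx hy)
  jacobi i j x y z hx hy := Subtype.ext (by simpa using L.jacobi i j x y z hx hy)

/-- A module over the Lie superalgebra `L`: a `ℤ/2`-graded vector space with a graded action
satisfying `[x,y]·w = x·(y·w) - (-1)^{|x||y|} y·(x·w)`. -/
structure SuperRep (L : LieSuperalgebra K 𝔤) where
  carrier : Type v
  [addCommGroup : AddCommGroup carrier]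
  [module : Module K carrier]
  part : ZMod 2 → Submodule K carrier
  isCompl : IsCompl (part 0) (part 1)
  act : 𝔤 →ₗ[K] carrier →ₗ[K] carrier
  act_mem : ∀ (i j : ZMod 2) (x : 𝔤) (w : carrier), x ∈ L.part i → w ∈ part j →
    act x w ∈ part (i + j)
  act_bracket : ∀ (i j : ZMod 2) (x y : 𝔤) (w : carrier), x ∈ L.part i → y ∈ L.part j →
    act (L.bracket x y) w = act x (act y w) - sgn (i * j) • act y (act x w)

attribute [instance] SuperRep.addCommGroup SuperRep.module

namespace SuperRep

variable {L : LieSuperalgebra K 𝔤}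

/-- Submodules of a module over a Lie superalgebra: graded subspaces stable under the action. -/
structure IsSubrep (V : SuperRep.{v} L) (S : Submodule K V.carrier) : Prop where
  graded : IsGradedSubspace V.part S
  act_mem : ∀ (x : 𝔤) (w : V.carrier), w ∈ S → V.act x w ∈ S

/-- Simple objects. -/
structure IsSimple (V : SuperRep.{v} L) : Prop where
  nontrivial : Nontrivial V.carrier
  eq_bot_or_eq_top : ∀ S : Submodule K V.carrier, V.IsSubrep S → S = ⊥ ∨ S = ⊤

/-- Simple objects of the category of finite dimensional modules. -/
structure IsIrr (V : SuperRep.{v} L) : Prop where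
  finite : FiniteDimensional K V.carrier
  simple : V.IsSimple

/-- The module has a unique maximal proper submodule. -/
def HasUniqueMaximalSubrep (V : SuperRep.{v} L) : Prop :=
  ∃! M : Submodule K V.carrier, Maximal (fun S => V.IsSubrep S ∧ S ≠ ⊤) M

/-- Morphisms: parity preserving linear maps that commute with the action. -/
structure IsHom (V : SuperRep.{v} L) (V' : SuperRep.{w} L) (f : V.carrier →ₗ[K] V'.carrier) :
    Prop where
  map_part : ∀ (i : ZMod 2) (x : V.carrier), x ∈ V.part i → f x ∈ V'.part i
  map_act : ∀ (a : 𝔤) (x : V.carrier), f (V.act a x) = V'.act a (f x)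

/-- Isomorphic modules. -/
def Iso (V : SuperRep.{v} L) (V' : SuperRep.{w} L) : Prop :=
  ∃ e : V.carrier ≃ₗ[K] V'.carrier, V.IsHom V' e.toLinearMap

/-- The direct sum `V ⊕ V'`. -/
abbrev prod (V : SuperRep.{v} L) (V' : SuperRep.{w} L) : SuperRep.{max v w} L where
  carrier := V.carrier × V'.carrier
  part i := (V.part i).prod (V'.part i)
  isCompl := by
    constructor
    · rw [Submodule.disjoint_def]
      rintro ⟨x, y⟩ h0 h1
      exact Prod.ext (Submodule.disjoint_def.1 V.isCompl.disjoint x h0.1 h1.1)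
        (Submodule.disjoint_def.1 V'.isCompl.disjoint y h0.2 h1.2)
    · rw [codisjoint_iff, Submodule.prod_sup_prod, V.isCompl.sup_eq_top, V'.isCompl.sup_eq_top,
        Submodule.prod_top]
  act := LinearMap.mk₂ K (fun a x => (V.act a x.1, V'.act a x.2))
    (fun a b x => by simp) (fun c a x => by simp) (fun a x y => by simp) (fun c a x => by simp)
  act_mem i j a x ha hx := ⟨V.act_mem i j a x.1 ha hx.1, V'.act_mem i j a x.2 ha hx.2⟩
  act_bracket i j a b x ha hb := Prod.ext (V.act_bracket i j a b x.1 ha hb)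
    (V'.act_bracket i j a b x.2 ha hb)

/-- A submodule, considered as a module. -/
abbrev ofSubrep (V : SuperRep.{v} L) (S : Submodule K V.carrier) (hS : V.IsSubrep S) :
    SuperRep.{v} L where
  carrier := S
  part i := (V.part i).comap S.subtype
  isCompl := hS.graded.isCompl V.isCompl
  act := LinearMap.mk₂ K (fun a x => ⟨V.act a x, hS.act_mem a x x.2⟩)
    (fun a b x => Subtype.ext (by simp)) (fun c a x => Subtype.ext (by simp))
    (fun a x y => Subtype.ext (by simp)) (fun c a x => Subtype.ext (by simp))
  act_mem i j a x ha hx := V.act_mem i j a x ha hx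
  act_bracket i j a b x ha hb := Subtype.ext (by simpa using V.act_bracket i j a b x ha hb)

theorem IsHom.mem_of_map_mem {V : SuperRep.{v} L} {V' : SuperRep.{w} L}
    {f : V.carrier →ₗ[K] V'.carrier} (hf : V.IsHom V' f) (hi : Function.Injective f)
    {i : ZMod 2} {x : V.carrier} (hx : f x ∈ V'.part i) : x ∈ V.part i := by
  have hx' : x ∈ V.part 0 ⊔ V.part 1 := by rw [V.isCompl.sup_eq_top]; trivial
  obtain ⟨a, ha, b, hb, rfl⟩ := Submodule.mem_sup.1 hx'
  have h0 := hf.map_part 0 a ha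
  have h1 := hf.map_part 1 b hb
  rw [map_add] at hx
  rcases zmod_two_cases i with rfl | rfl
  · have h2 : f b ∈ V'.part 0 := (Submodule.add_mem_iff_right _ h0).1 hx
    have h3 : f b = 0 := Submodule.disjoint_def.1 V'.isCompl.disjoint _ h2 h1
    rw [(map_eq_zero_iff f hi).1 h3, add_zero]; exact ha
  · have h2 : f a ∈ V'.part 1 := (Submodule.add_mem_iff_left _ h1).1 hx
    have h3 : f a = 0 := Submodule.disjoint_def.1 V'.isCompl.disjoint _ h0 h2
    rw [(map_eq_zero_iff f hi).1 h3, zero_add]; exact hb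

theorem IsHom.comp {V : SuperRep.{u} L} {V' : SuperRep.{v} L} {V'' : SuperRep.{w} L}
    {f : V.carrier →ₗ[K] V'.carrier} {g : V'.carrier →ₗ[K] V''.carrier} (hg : V'.IsHom V'' g)
    (hf : V.IsHom V' f) : V.IsHom V'' (g ∘ₗ f) where
  map_part i x hx := hg.map_part i _ (hf.map_part i x hx)
  map_act a x := by simp [hf.map_act, hg.map_act]

theorem Iso.symm {V : SuperRep.{v} L} {V' : SuperRep.{w} L} (h : V.Iso V') : V'.Iso V := by
  obtain ⟨e, he⟩ := h
  refine ⟨e.symm, ⟨fun i x hx => he.mem_of_map_mem e.injective (by simpa using hx), fun a x => ?_⟩⟩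
  apply e.injective
  have := he.map_act a (e.symm x)
  simp at this
  simp [this]

theorem Iso.trans {V : SuperRep.{u} L} {V' : SuperRep.{v} L} {V'' : SuperRep.{w} L}
    (h : V.Iso V') (h' : V'.Iso V'') : V.Iso V'' := by
  obtain ⟨e, he⟩ := h
  obtain ⟨e', he'⟩ := h'
  exact ⟨e.trans e', he'.comp he⟩

theorem IsHom.isSubrep_ker {V : SuperRep.{v} L} {V' : SuperRep.{w} L}
    {f : V.carrier →ₗ[K] V'.carrier} (hf : V.IsHom V' f) : V.IsSubrep (LinearMap.ker f) where
  graded x hx := by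
    have hx' : x ∈ V.part 0 ⊔ V.part 1 := by rw [V.isCompl.sup_eq_top]; trivial
    obtain ⟨a, ha, b, hb, rfl⟩ := Submodule.mem_sup.1 hx'
    have h0 := hf.map_part 0 a ha
    have h1 := hf.map_part 1 b hb
    have hx2 : f a + f b = 0 := by simpa using hx
    have h2 : f a = 0 := by
      refine Submodule.disjoint_def.1 V'.isCompl.disjoint _ h0 ?_
      rw [eq_neg_of_add_eq_zero_left hx2]
      exact neg_mem h1
    have h3 : f b = 0 := by rwa [h2, zero_add] at hx2
    exact Submodule.add_mem_sup ⟨h2, ha⟩ ⟨h3, hb⟩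
  act_mem a x hx := by
    have : f x = 0 := hx
    change f _ = 0
    rw [hf.map_act, this, map_zero]

theorem IsHom.isSubrep_range {V : SuperRep.{v} L} {V' : SuperRep.{w} L}
    {f : V.carrier →ₗ[K] V'.carrier} (hf : V.IsHom V' f) : V'.IsSubrep (LinearMap.range f) where
  graded := by
    rintro _ ⟨x, rfl⟩
    have hx' : x ∈ V.part 0 ⊔ V.part 1 := by rw [V.isCompl.sup_eq_top]; trivial
    obtain ⟨a, ha, b, hb, rfl⟩ := Submodule.mem_sup.1 hx'
    rw [map_add]
    exact Submodule.add_mem_sup ⟨⟨a, rfl⟩, hf.map_part 0 a ha⟩ ⟨⟨b, rfl⟩, hf.map_part 1 b hb⟩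
  act_mem := by
    rintro a _ ⟨x, rfl⟩
    exact ⟨V.act a x, hf.map_act a x⟩

/-- Schur's Lemma for simple modules. -/
theorem IsHom.bijective {V : SuperRep.{v} L} {V' : SuperRep.{w} L}
    {f : V.carrier →ₗ[K] V'.carrier} (hf : V.IsHom V' f) (hV : V.IsSimple) (hV' : V'.IsSimple)
    (h : f ≠ 0) : Function.Bijective f := by
  constructor
  · rw [← LinearMap.ker_eq_bot]
    refine (hV.eq_bot_or_eq_top _ hf.isSubrep_ker).resolve_right fun h' => h ?_
    exact LinearMap.ker_eq_top.1 h'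
  · rw [← LinearMap.range_eq_top]
    refine (hV'.eq_bot_or_eq_top _ hf.isSubrep_range).resolve_left fun h' => h ?_
    exact LinearMap.range_eq_bot.1 h'

/-- The parity change `Π`: the same space and action, with the parities exchanged. -/
abbrev parityChange (V : SuperRep.{v} L) : SuperRep.{v} L where
  carrier := V.carrier
  part i := V.part (i + 1)
  isCompl := V.isCompl.symm
  act := V.act
  act_mem i j a x ha hx := by
    have := V.act_mem i (j + 1) a x ha hx
    rwa [← add_assoc] at this
  act_bracket := V.act_bracket

theorem isSimple_parityChange {V : SuperRep.{v} L} (h : V.IsSimple) :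
    V.parityChange.IsSimple where
  nontrivial := h.nontrivial
  eq_bot_or_eq_top S hS := h.eq_bot_or_eq_top S ⟨by
    intro x hx
    have h1 := hS.graded hx
    rwa [sup_comm] at h1, hS.act_mem⟩

/-- The homogeneous parts of the enriched endomorphism superalgebra: `Hom(V, V)` in even degree,
and `Hom(V, ΠV)` in odd degree. -/
def homPart (V : SuperRep.{v} L) (i : ZMod 2) : Submodule K (Module.End K V.carrier) where
  carrier := {T | (∀ (j : ZMod 2) (x : V.carrier), x ∈ V.part j → T x ∈ V.part (j + i)) ∧
    ∀ (a : 𝔤) (x : V.carrier), T (V.act a x) = V.act a (T x)}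
  zero_mem' := ⟨fun j x _ => zero_mem _, fun a x => by simp⟩
  add_mem' hS hT := ⟨fun j x hx => add_mem (hS.1 j x hx) (hT.1 j x hx),
    fun a x => by simp [hS.2, hT.2]⟩
  smul_mem' c T hT := ⟨fun j x hx => Submodule.smul_mem _ c (hT.1 j x hx),
    fun a x => by simp [hT.2]⟩

theorem mem_homPart_zero {V : SuperRep.{v} L} {T : Module.End K V.carrier} :
    T ∈ V.homPart 0 ↔ V.IsHom V T :=
  ⟨fun h => ⟨fun i x hx => by simpa using h.1 i x hx, h.2⟩,
    fun h => ⟨fun i x hx => by simpa using h.1 i x hx, h.2⟩⟩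

theorem mem_homPart_one {V : SuperRep.{v} L} {T : Module.End K V.carrier} :
    T ∈ V.homPart 1 ↔ V.IsHom V.parityChange T :=
  ⟨fun h => ⟨fun i x hx => h.1 i x hx, h.2⟩, fun h => ⟨fun i x hx => h.1 i x hx, h.2⟩⟩

theorem mul_mem_homPart {V : SuperRep.{v} L} {i j : ZMod 2} {S T : Module.End K V.carrier}
    (hS : S ∈ V.homPart i) (hT : T ∈ V.homPart j) : S * T ∈ V.homPart (i + j) :=
  ⟨fun k x hx => by
    have := hS.1 _ _ (hT.1 k x hx)
    rwa [add_assoc, add_comm j i] at this, fun a x => by simp [hS.2, hT.2]⟩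

theorem one_mem_homPart (V : SuperRep.{v} L) : (1 : Module.End K V.carrier) ∈ V.homPart 0 :=
  mem_homPart_zero.2 ⟨fun _ _ h => h, fun _ _ => rfl⟩

theorem mul_mem_homPart_sup {V : SuperRep.{v} L} {S T : Module.End K V.carrier}
    (hS : S ∈ V.homPart 0 ⊔ V.homPart 1) (hT : T ∈ V.homPart 0 ⊔ V.homPart 1) :
    S * T ∈ V.homPart 0 ⊔ V.homPart 1 := by
  obtain ⟨S0, hS0, S1, hS1, rfl⟩ := Submodule.mem_sup.1 hS
  obtain ⟨T0, hT0, T1, hT1, rfl⟩ := Submodule.mem_sup.1 hT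
  have : (S0 + S1) * (T0 + T1) = (S0 * T0 + S1 * T1) + (S0 * T1 + S1 * T0) := by
    rw [add_mul, mul_add, mul_add]; abel
  have h00 := mul_mem_homPart hS0 hT0
  have h11 := mul_mem_homPart hS1 hT1
  have h01 := mul_mem_homPart hS0 hT1
  have h10 := mul_mem_homPart hS1 hT0
  rw [add_zero] at h00 h10
  rw [zero_add] at h01
  rw [show (1 + 1 : ZMod 2) = 0 from rfl] at h11
  rw [this]
  exact Submodule.add_mem_sup (add_mem h00 h11) (add_mem h01 h10)

/-- The enriched endomorphism algebra `Hom(V, V) ⊕ Hom(V, ΠV)`, with composition as its product. -/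
def enrichedEnd (V : SuperRep.{v} L) : Subalgebra K (Module.End K V.carrier) :=
  (V.homPart 0 ⊔ V.homPart 1).toSubalgebra (Submodule.mem_sup_left V.one_mem_homPart)
    (fun _ _ hS hT => mul_mem_homPart_sup hS hT)

theorem enrichedEnd_isCompl (V : SuperRep.{v} L) :
    IsCompl ((V.homPart 0).comap V.enrichedEnd.val.toLinearMap)
      ((V.homPart 1).comap V.enrichedEnd.val.toLinearMap) := by
  constructor
  · rw [Submodule.disjoint_def]
    intro T h0 h1
    apply Subtype.ext
    ext x
    refine hom_induction V.isCompl (P := fun x => (T : Module.End K V.carrier) x = 0) ?_ ?_ x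
    · intro i x hx
      have h2 : (T : Module.End K V.carrier) x ∈ V.part i := by simpa using h0.1 i x hx
      exact eq_zero_of_mem V.isCompl h2 (h1.1 i x hx)
    · intro x y hx hy
      rw [map_add, hx, hy, add_zero]
  · rw [codisjoint_iff_le_sup]
    intro T _
    obtain ⟨a, ha, b, hb, hab⟩ := Submodule.mem_sup.1 (show (T : Module.End K V.carrier) ∈ V.homPart 0 ⊔ V.homPart 1 from T.2)
    exact Submodule.mem_sup.2 ⟨⟨a, Submodule.mem_sup_left ha⟩, ha,
      ⟨b, Submodule.mem_sup_right hb⟩, hb, Subtype.ext hab⟩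

end SuperRep

end

end LieSuperalgebra
/-- Finite dimensional division superalgebras over `ℝ`: nonzero homogeneous elements are
invertible. -/
structure DivisionSuperalgebra where
  carrier : Type v
  [ring : Ring carrier]
  [algebra : Algebra ℝ carrier]
  finite : FiniteDimensional ℝ carrier
  nontrivial : Nontrivial carrier
  part : ZMod 2 → Submodule ℝ carrier
  isCompl : IsCompl (part 0) (part 1)
  one_mem : 1 ∈ part 0
  mul_mem : ∀ (i j : ZMod 2) (x y : carrier), x ∈ part i → y ∈ part j → x * y ∈ part (i + j)
  isUnit : ∀ (i : ZMod 2) (x : carrier), x ∈ part i → x ≠ 0 → IsUnit x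

attribute [instance] DivisionSuperalgebra.ring DivisionSuperalgebra.algebra

namespace DivisionSuperalgebra

/-- Isomorphism of superalgebras over `ℝ`. -/
def Iso (A B : DivisionSuperalgebra.{v}) : Prop :=
  ∃ e : A.carrier ≃ₐ[ℝ] B.carrier, ∀ (i : ZMod 2) (x : A.carrier), x ∈ A.part i ↔ e x ∈ B.part i

/-- Isomorphism of division superalgebras is an equivalence relation. -/
instance setoid : Setoid DivisionSuperalgebra.{v} where
  r := Iso
  iseqv :=
    { refl := fun A => ⟨AlgEquiv.refl, fun _ _ => Iff.rfl⟩
      symm := fun ⟨e, he⟩ => ⟨e.symm, fun i x => by rw [he, e.apply_symm_apply]⟩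
      trans := fun ⟨e, he⟩ ⟨f, hf⟩ => ⟨e.trans f, fun i x => by rw [he, hf]; rfl⟩ }

end DivisionSuperalgebra

/-- The underlying set of the Brauer-Wall monoid of `ℝ`: the isomorphism classes of finite
dimensional real division superalgebras (their supercenter is `ℝ` or `ℂ`). -/
def BrauerWall : Type (v + 1) := Quotient DivisionSuperalgebra.setoid.{v}

namespace LieSuperalgebra

namespace SuperRep

section

variable {𝔤 : Type*} [AddCommGroup 𝔤] [Module ℝ 𝔤] {L : LieSuperalgebra ℝ 𝔤}

theorem isUnit_of_bijective {V : SuperRep.{v} L} {i : ZMod 2} {T : V.enrichedEnd}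
    (hT : (T : Module.End ℝ V.carrier) ∈ V.homPart i)
    (hb : Function.Bijective (T : Module.End ℝ V.carrier)) : IsUnit T := by
  let e : V.carrier ≃ₗ[ℝ] V.carrier := LinearEquiv.ofBijective _ hb
  have he : ∀ x, e x = (T : Module.End ℝ V.carrier) x := fun x => rfl
  have key : (e.symm : Module.End ℝ V.carrier) ∈ V.homPart i := by
    rcases zmod_two_cases i with rfl | rfl
    · have h : V.Iso V := ⟨e, mem_homPart_zero.1 hT⟩
      refine ⟨fun j x hx => ?_, fun a x => ?_⟩
      · rw [add_zero]
        exact (mem_homPart_zero.1 hT).mem_of_map_mem hb.1 (x := e.symm x)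
          (by rw [← he]; simpa using hx)
      · apply e.injective
        have := (mem_homPart_zero.1 hT).map_act a (e.symm x)
        rw [← he, ← he] at this
        simp at this
        simp [this]
    · refine ⟨fun j x hx => ?_, fun a x => ?_⟩
      · refine (mem_homPart_one.1 hT).mem_of_map_mem hb.1 (x := e.symm x) ?_
        change e (e.symm x) ∈ V.part (j + 1 + 1)
        rw [add_assoc, show (1 + 1 : ZMod 2) = 0 from rfl, add_zero]
        simpa using hx
      · apply e.injective
        have : e (V.act a (e.symm x)) = V.act a (e (e.symm x)) :=
          (mem_homPart_one.1 hT).map_act a (e.symm x)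
        simp at this
        simp [this]
  have hmem : (e.symm : Module.End ℝ V.carrier) ∈ V.homPart 0 ⊔ V.homPart 1 := by
    rcases zmod_two_cases i with rfl | rfl
    · exact Submodule.mem_sup_left key
    · exact Submodule.mem_sup_right key
  refine ⟨⟨T, ⟨e.symm, hmem⟩, ?_, ?_⟩, rfl⟩
  · apply Subtype.ext
    ext x
    exact e.apply_symm_apply x
  · apply Subtype.ext
    ext x
    exact e.symm_apply_apply x

/-- By Schur's Lemma the enriched endomorphism algebra of a simple module is a division
superalgebra. -/
noncomputable abbrev endDivisionSuperalgebra (V : SuperRep.{v} L) (hV : V.IsIrr) :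
    DivisionSuperalgebra.{v} where
  carrier := V.enrichedEnd
  finite := by
    have := hV.finite
    exact FiniteDimensional.finiteDimensional_submodule (Subalgebra.toSubmodule V.enrichedEnd)
  nontrivial := by
    have := hV.simple.nontrivial
    infer_instance
  part i := (V.homPart i).comap V.enrichedEnd.val.toLinearMap
  isCompl := V.enrichedEnd_isCompl
  one_mem := V.one_mem_homPart
  mul_mem i j S T hS hT := mul_mem_homPart hS hT
  isUnit i T hT h0 := by
    refine isUnit_of_bijective (i := i) hT ?_
    have h0' : (T : Module.End ℝ V.carrier) ≠ 0 := fun h => h0 (Subtype.ext h)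
    rcases zmod_two_cases i with rfl | rfl
    · exact (mem_homPart_zero.1 hT).bijective hV.simple hV.simple h0'
    · exact (mem_homPart_one.1 hT).bijective hV.simple (isSimple_parityChange hV.simple) h0'

/-- The endotype of a simple finite dimensional module over a real Lie superalgebra: the class
of its enriched endomorphism algebra. -/
noncomputable def realEType (V : SuperRep.{v} L) (hV : V.IsIrr) : BrauerWall.{v} :=
  Quotient.mk _ (V.endDivisionSuperalgebra hV)

end

end SuperRep

/-! ### Complex Lie superalgebras with a real form -/

section

variable {𝔤 : Type*} [AddCommGroup 𝔤] [Module ℂ 𝔤]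

/-- An antilinear involution of a complex Lie superalgebra. -/
structure AntilinearInvolution (L : LieSuperalgebra ℂ 𝔤) where
  toMap : 𝔤 →ₛₗ[starRingEnd ℂ] 𝔤
  involutive : ∀ x : 𝔤, toMap (toMap x) = x
  map_part : ∀ (i : ZMod 2) (x : 𝔤), x ∈ L.part i → toMap x ∈ L.part i
  map_bracket : ∀ x y : 𝔤, toMap (L.bracket x y) = L.bracket (toMap x) (toMap y)

namespace AntilinearInvolution

variable {L : LieSuperalgebra ℂ 𝔤}

/-- The fixed points of `τ`. -/
def fixed (τ : L.AntilinearInvolution) : Submodule ℝ 𝔤 where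
  carrier := {x | τ.toMap x = x}
  zero_mem' := map_zero _
  add_mem' := by
    intro x y hx hy
    change τ.toMap (x + y) = x + y
    rw [map_add, show τ.toMap x = x from hx, show τ.toMap y = y from hy]
  smul_mem' := by
    intro c x hx
    change τ.toMap ((c : ℂ) • x) = (c : ℂ) • x
    rw [map_smulₛₗ, show τ.toMap x = x from hx, Complex.conj_ofReal]

/-- The real form `𝔤^ℝ` of `𝔤`: the real Lie superalgebra of fixed points of `τ`. -/
noncomputable abbrev realForm (τ : L.AntilinearInvolution) : LieSuperalgebra ℝ τ.fixed where
  part i := ((L.part i).restrictScalars ℝ).comap τ.fixed.subtype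
  isCompl := by
    constructor
    · rw [Submodule.disjoint_def]
      intro x h0 h1
      exact Subtype.ext (Submodule.disjoint_def.1 L.isCompl.disjoint _ h0 h1)
    · rw [codisjoint_iff_le_sup]
      intro x _
      have hx' : (x : 𝔤) ∈ L.part 0 ⊔ L.part 1 := by rw [L.isCompl.sup_eq_top]; trivial
      obtain ⟨a, ha, b, hb, hab⟩ := Submodule.mem_sup.1 hx'
      have h : τ.toMap a + τ.toMap b = a + b := by
        rw [← map_add, hab]; exact x.2
      have h' : τ.toMap a - a = b - τ.toMap b := by
        rw [sub_eq_sub_iff_add_eq_add, h, add_comm]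
      have h0 : τ.toMap a - a = 0 := by
        refine Submodule.disjoint_def.1 L.isCompl.disjoint _ (sub_mem (τ.map_part 0 a ha) ha) ?_
        rw [h']
        exact sub_mem hb (τ.map_part 1 b hb)
      have h1 : b - τ.toMap b = 0 := by rw [← h', h0]
      exact Submodule.mem_sup.2 ⟨⟨a, sub_eq_zero.1 h0⟩, ha, ⟨b, (sub_eq_zero.1 h1).symm⟩, hb,
        Subtype.ext hab⟩
  bracket := LinearMap.mk₂ ℝ
    (fun x y => ⟨L.bracket x y, by
      change τ.toMap _ = _
      rw [τ.map_bracket, show τ.toMap x = x from x.2, show τ.toMap y = y from y.2]⟩)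
    (fun x y z => Subtype.ext (by simp)) (fun c x y => Subtype.ext (by simp))
    (fun x y z => Subtype.ext (by simp)) (fun c x y => Subtype.ext (by simp))
  bracket_mem i j x y hx hy := L.bracket_mem i j x y hx hy
  skew i j x y hx hy := Subtype.ext (by simpa using L.skew i j x y hx hy)
  jacobi i j x y z hx hy := Subtype.ext (by simpa using L.jacobi i j x y z hx hy)

/-- The functor `F`: restriction of scalars from `𝔤`-modules over `ℂ` to `𝔤^ℝ`-modules
over `ℝ`. -/
noncomputable abbrev realify (τ : L.AntilinearInvolution) (W : SuperRep.{v} L) :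
    SuperRep.{v} τ.realForm where
  carrier := W.carrier
  part i := (W.part i).restrictScalars ℝ
  isCompl := by
    constructor
    · rw [Submodule.disjoint_def]
      intro x h0 h1
      exact Submodule.disjoint_def.1 W.isCompl.disjoint x h0 h1
    · rw [codisjoint_iff_le_sup]
      intro x _
      have hx' : x ∈ W.part 0 ⊔ W.part 1 := by rw [W.isCompl.sup_eq_top]; trivial
      obtain ⟨a, ha, b, hb, hab⟩ := Submodule.mem_sup.1 hx'
      exact Submodule.mem_sup.2 ⟨a, ha, b, hb, hab⟩
  act := LinearMap.mk₂ ℝ (fun a x => W.act a x)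
    (fun a b x => by simp) (fun c a x => by simp) (fun a x y => by simp)
    (fun c a x => by simp)
  act_mem i j a x ha hx := W.act_mem i j a x ha hx
  act_bracket i j a b x ha hb := W.act_bracket i j a b x ha hb

/-- The relation `Φ([W]) = [V]`: the simple module `V` is `F(W)` if `F(W)` is simple, and
`F(W) ≅ V ⊕ V` otherwise. -/
def IsPhi (τ : L.AntilinearInvolution) (W : SuperRep.{v} L) (V : SuperRep.{v} τ.realForm) : Prop :=
  V.IsIrr ∧ ((τ.realify W).Iso V ∨ (τ.realify W).Iso (V.prod V))

end AntilinearInvolution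

end

end LieSuperalgebra
namespace LieSuperalgebra

namespace SuperRep

section

variable {K : Type*} {𝔤 : Type*} [Field K] [AddCommGroup 𝔤] [Module K 𝔤] {L : LieSuperalgebra K 𝔤}

theorem IsSubrep.mem_of_add_mem {V : SuperRep.{v} L} {S : Submodule K V.carrier}
    (hS : V.IsSubrep S) {a b : V.carrier} (ha : a ∈ V.part 0) (hb : b ∈ V.part 1)
    (h : a + b ∈ S) : a ∈ S ∧ b ∈ S := by
  obtain ⟨a', ha', b', hb', hab⟩ := Submodule.mem_sup.1 (hS.graded h)
  have h1 : a' - a = b - b' := by rw [sub_eq_sub_iff_add_eq_add, hab, add_comm]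
  have h2 : a' - a = 0 := Submodule.disjoint_def.1 V.isCompl.disjoint _ (sub_mem ha'.2 ha)
    (h1 ▸ sub_mem hb hb'.2)
  have h3 : b - b' = 0 := h1 ▸ h2
  exact ⟨sub_eq_zero.1 h2 ▸ ha'.1, (sub_eq_zero.1 h3).symm ▸ hb'.1⟩

theorem ofSubrep_isHom {V : SuperRep.{v} L} {S : Submodule K V.carrier} (hS : V.IsSubrep S) :
    (V.ofSubrep S hS).IsHom V S.subtype :=
  ⟨fun _ _ h => h, fun _ _ => rfl⟩

theorem exists_simple_subrep (V : SuperRep.{v} L) [FiniteDimensional K V.carrier]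
    [Nontrivial V.carrier] :
    ∃ (S : Submodule K V.carrier) (hS : V.IsSubrep S), S ≠ ⊥ ∧ (V.ofSubrep S hS).IsIrr := by
  have htop : V.IsSubrep ⊤ := ⟨fun x _ => by
    have hx' : x ∈ V.part 0 ⊔ V.part 1 := by rw [V.isCompl.sup_eq_top]; trivial
    simpa using hx', fun _ _ _ => trivial⟩
  obtain ⟨S, ⟨hS, hS0⟩, hmin⟩ := wellFounded_lt.has_min
    {S : Submodule K V.carrier | V.IsSubrep S ∧ S ≠ ⊥} ⟨⊤, htop, top_ne_bot⟩
  refine ⟨S, hS, hS0, FiniteDimensional.finiteDimensional_submodule S, ?_, ?_⟩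
  · exact Submodule.nontrivial_iff_ne_bot.2 hS0
  · intro T hT
    by_cases h0 : T = ⊥
    · exact Or.inl h0
    right
    have hT' : V.IsSubrep (T.map S.subtype) := by
      constructor
      · rintro _ ⟨x, hx, rfl⟩
        obtain ⟨a, ha, b, hb, rfl⟩ := Submodule.mem_sup.1 (hT.graded hx)
        rw [map_add]
        exact Submodule.add_mem_sup ⟨⟨a, ha.1, rfl⟩, ha.2⟩ ⟨⟨b, hb.1, rfl⟩, hb.2⟩
      · rintro g _ ⟨x, hx, rfl⟩
        exact ⟨_, hT.act_mem g x hx, rfl⟩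
    have hle : T.map S.subtype ≤ S := Submodule.map_subtype_le S T
    have hne : T.map S.subtype ≠ ⊥ := fun h => h0 (by
      rw [eq_bot_iff]
      intro x hx
      have h1 : (x : V.carrier) ∈ T.map S.subtype := ⟨x, hx, rfl⟩
      rw [h] at h1
      exact Subtype.ext h1)
    have heq : T.map S.subtype = S := by
      by_contra hne'
      exact hmin _ ⟨hT', hne⟩ (lt_of_le_of_ne hle hne')
    rw [eq_top_iff]
    intro x _
    have hx : (x : V.carrier) ∈ T.map S.subtype := by rw [heq]; exact x.2
    obtain ⟨y, hy, hyx⟩ := hx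
    exact (Subtype.ext hyx : y = x) ▸ hy

end

section

variable {𝔤 : Type*} [AddCommGroup 𝔤] [Module ℝ 𝔤] {L : LieSuperalgebra ℝ 𝔤}

theorem conj_mem_homPart {V V' : SuperRep.{v} L} (e : V.carrier ≃ₗ[ℝ] V'.carrier)
    (he : V.IsHom V' e.toLinearMap) {i : ZMod 2} {T : Module.End ℝ V.carrier} :
    T ∈ V.homPart i ↔ e.conj T ∈ V'.homPart i := by
  have hact : ∀ a x, e (V.act a x) = V'.act a (e x) := he.map_act
  have hpart : ∀ i x, x ∈ V.part i ↔ e x ∈ V'.part i :=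
    fun i x => ⟨he.map_part i x, he.mem_of_map_mem e.injective⟩
  constructor
  · rintro ⟨h1, h2⟩
    refine ⟨fun j x hx => ?_, fun a x => ?_⟩
    · obtain ⟨y, rfl⟩ := e.surjective x
      rw [LinearEquiv.conj_apply_apply, e.symm_apply_apply, ← hpart]
      exact h1 j y ((hpart j y).2 hx)
    · obtain ⟨y, rfl⟩ := e.surjective x
      rw [← hact, LinearEquiv.conj_apply_apply, e.symm_apply_apply, LinearEquiv.conj_apply_apply,
        e.symm_apply_apply, h2, hact]
  · rintro ⟨h1, h2⟩
    refine ⟨fun j x hx => ?_, fun a x => ?_⟩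
    · have := h1 j (e x) ((hpart j x).1 hx)
      rwa [LinearEquiv.conj_apply_apply, e.symm_apply_apply, ← hpart] at this
    · apply e.injective
      have := h2 a (e x)
      rwa [← hact, LinearEquiv.conj_apply_apply, e.symm_apply_apply, LinearEquiv.conj_apply_apply,
        e.symm_apply_apply, ← hact] at this

theorem conj_mem_enrichedEnd {V V' : SuperRep.{v} L} (e : V.carrier ≃ₗ[ℝ] V'.carrier)
    (he : V.IsHom V' e.toLinearMap) {T : Module.End ℝ V.carrier} (hT : T ∈ V.enrichedEnd) :
    e.conj T ∈ V'.enrichedEnd := by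
  obtain ⟨a, ha, b, hb, rfl⟩ := Submodule.mem_sup.1 (show T ∈ V.homPart 0 ⊔ V.homPart 1 from hT)
  rw [map_add]
  exact Submodule.add_mem_sup ((conj_mem_homPart e he).1 ha) ((conj_mem_homPart e he).1 hb)

/-- The endotype depends only on the isomorphism class. -/
theorem realEType_eq_of_iso {V V' : SuperRep.{v} L} (hV : V.IsIrr) (hV' : V'.IsIrr)
    (h : V.Iso V') : V.realEType hV = V'.realEType hV' := by
  obtain ⟨e, he⟩ := h
  have he' : V'.IsHom V e.symm.toLinearMap := by
    refine ⟨fun i x hx => he.mem_of_map_mem e.injective (by simpa using hx), fun a x => ?_⟩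
    apply e.injective
    have := he.map_act a (e.symm x)
    simp at this
    simp [this]
  refine Quotient.sound ⟨
    { toFun := fun T => ⟨e.conj T, conj_mem_enrichedEnd e he T.2⟩
      invFun := fun T => ⟨e.symm.conj T, conj_mem_enrichedEnd e.symm he' T.2⟩
      left_inv := fun T => Subtype.ext (by ext x; simp)
      right_inv := fun T => Subtype.ext (by ext x; simp)
      map_mul' := fun S T => Subtype.ext (by ext x; simp)
      map_add' := fun S T => Subtype.ext (by ext x; simp)
      commutes' := fun c => Subtype.ext (by
        ext x; simp [LinearEquiv.conj_apply_apply, Algebra.algebraMap_eq_smul_one]) }, ?_⟩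
  intro i T
  exact conj_mem_homPart e he

end

end SuperRep

section

variable {𝔤 : Type*} [AddCommGroup 𝔤] [Module ℂ 𝔤] {L : LieSuperalgebra ℂ 𝔤}

namespace AntilinearInvolution

theorem exists_re_im (τ : L.AntilinearInvolution) (y : 𝔤) :
    ∃ a b : τ.fixed, y = (a : 𝔤) + Complex.I • (b : 𝔤) := by
  have h2 : (starRingEnd ℂ) (2 : ℂ)⁻¹ = (2 : ℂ)⁻¹ := by
    rw [map_inv₀, Complex.conj_ofNat]
  refine ⟨⟨(2 : ℂ)⁻¹ • (y + τ.toMap y), ?_⟩, ⟨(-(2 : ℂ)⁻¹ * Complex.I) • (y - τ.toMap y), ?_⟩, ?_⟩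
  · change τ.toMap _ = _
    rw [map_smulₛₗ, map_add, τ.involutive, h2, add_comm]
  · change τ.toMap _ = _
    rw [map_smulₛₗ, map_sub, τ.involutive, map_mul, map_neg, h2, Complex.conj_I, ← neg_sub y,
      smul_neg, ← neg_smul]
    congr 1
    ring
  · change y = (2 : ℂ)⁻¹ • (y + τ.toMap y) + Complex.I • ((-(2 : ℂ)⁻¹ * Complex.I) • (y - τ.toMap y))
    rw [smul_smul, show Complex.I * (-(2 : ℂ)⁻¹ * Complex.I) = (2 : ℂ)⁻¹ by
      linear_combination (-(2 : ℂ)⁻¹) * Complex.I_mul_I, ← smul_add, add_add_sub_cancel,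
      ← two_smul ℂ y, smul_smul, inv_mul_cancel₀ two_ne_zero, one_smul]

/-- For simple `W`, the module `V` with `Φ([W]) = [V]` exists. -/
theorem exists_isPhi (τ : L.AntilinearInvolution) (W : SuperRep.{v} L) (hW : W.IsIrr) :
    ∃ V, τ.IsPhi W V := by
  have hfin : FiniteDimensional ℂ W.carrier := hW.finite
  have hfinR : FiniteDimensional ℝ W.carrier := FiniteDimensional.complexToReal _
  have hnt : Nontrivial W.carrier := hW.simple.nontrivial
  obtain ⟨S, hS, hS0, hirr⟩ : ∃ (S : Submodule ℝ W.carrier) (hS : (τ.realify W).IsSubrep S),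
      S ≠ ⊥ ∧ ((τ.realify W).ofSubrep S hS).IsIrr := (τ.realify W).exists_simple_subrep
  refine ⟨(τ.realify W).ofSubrep S hS, hirr, ?_⟩
  have hI : ∀ x : W.carrier, Complex.I • Complex.I • x = -x := fun x => by
    rw [smul_smul, Complex.I_mul_I, neg_one_smul]
  have hsm : ∀ (c : ℂ) (x : W.carrier), c • x = c.re • x + c.im • Complex.I • x := by
    intro c x
    rw [← Complex.coe_smul, ← Complex.coe_smul, smul_smul, ← add_smul, Complex.re_add_im]
  have hactS : ∀ (a : τ.fixed) (x : W.carrier), x ∈ S → W.act a x ∈ S :=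
    fun a x hx => hS.act_mem a x hx
  have hgr : ∀ x ∈ S, ∃ a b : W.carrier, a ∈ S ∧ b ∈ S ∧ a ∈ W.part 0 ∧ b ∈ W.part 1 ∧ a + b = x := by
    intro x hx
    obtain ⟨a, ha, b, hb, hab⟩ := Submodule.mem_sup.1 (hS.graded hx)
    exact ⟨a, b, ha.1, hb.1, ha.2, hb.2, hab⟩
  have hreal : ∀ (r : ℝ) (x : W.carrier), x ∈ S → r • x ∈ S := fun r x hx => S.smul_mem r hx
  have hadd : ∀ (x y : W.carrier), x ∈ S → y ∈ S → x + y ∈ S := fun x y hx hy => S.add_mem hx hy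
  have hneg : ∀ (x : W.carrier), x ∈ S → -x ∈ S := fun x hx => S.neg_mem hx
  have hzero : (0 : W.carrier) ∈ S := S.zero_mem
  have hIr : ∀ (r : ℝ) (x : W.carrier), Complex.I • r • x = r • Complex.I • x :=
    fun r x => smul_comm _ _ _
  -- the intersection of `S` and `iS`
  let C : Submodule ℂ W.carrier :=
    { carrier := {x | x ∈ S ∧ Complex.I • x ∈ S}
      zero_mem' := ⟨hzero, by rw [smul_zero]; exact hzero⟩
      add_mem' := fun {x y} hx hy =>
        ⟨hadd _ _ hx.1 hy.1, by rw [smul_add]; exact hadd _ _ hx.2 hy.2⟩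
      smul_mem' := fun c x hx => ⟨by
        rw [hsm]; exact hadd _ _ (hreal _ _ hx.1) (hreal _ _ hx.2), by
        rw [hsm c x, smul_add, hIr, hIr, hI]
        exact hadd _ _ (hreal _ _ hx.2) (hreal _ _ (hneg _ hx.1))⟩ }
  have hC : W.IsSubrep C := by
    constructor
    · intro x hx
      obtain ⟨a, b, haS, hbS, ha, hb, rfl⟩ := hgr x hx.1
      have h1 : Complex.I • a + Complex.I • b ∈ S := by rw [← smul_add]; exact hx.2
      have h2 := hS.mem_of_add_mem (a := Complex.I • a) (b := Complex.I • b)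
        ((W.part 0).smul_mem _ ha) ((W.part 1).smul_mem _ hb) h1
      exact Submodule.add_mem_sup ⟨⟨haS, h2.1⟩, ha⟩ ⟨⟨hbS, h2.2⟩, hb⟩
    · intro y x hx
      obtain ⟨a, b, rfl⟩ := τ.exists_re_im y
      constructor
      · rw [map_add, map_smul, LinearMap.add_apply, LinearMap.smul_apply, ← map_smul]
        exact hadd _ _ (hactS _ _ hx.1) (hactS _ _ hx.2)
      · rw [map_add, map_smul, LinearMap.add_apply, LinearMap.smul_apply, smul_add, hI, ← map_smul]
        exact hadd _ _ (hactS _ _ hx.2) (hneg _ (hactS _ _ hx.1))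
  rcases hW.simple.eq_bot_or_eq_top C hC with h | h
  · right
    refine SuperRep.Iso.symm ?_
    let f : (S × S) →ₗ[ℝ] W.carrier :=
      { toFun := fun p => (p.1 : W.carrier) + Complex.I • (p.2 : W.carrier)
        map_add' := fun p q => by
          change ((p.1 : W.carrier) + (q.1 : W.carrier)) + Complex.I • ((p.2 : W.carrier) + (q.2 : W.carrier)) = _
          rw [smul_add]; abel
        map_smul' := fun c p => by
          change c • (p.1 : W.carrier) + Complex.I • c • (p.2 : W.carrier) = _
          rw [hIr, ← smul_add]; rfl }
    have hfa : ∀ s t : S, f (s, t) = (s : W.carrier) + Complex.I • (t : W.carrier) := fun s t => rfl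
    let D : Submodule ℂ W.carrier :=
      { carrier := Set.range f
        zero_mem' := ⟨0, map_zero f⟩
        add_mem' := by
          rintro _ _ ⟨p, rfl⟩ ⟨q, rfl⟩
          exact ⟨p + q, map_add f p q⟩
        smul_mem' := by
          rintro c _ ⟨⟨s, t⟩, rfl⟩
          refine ⟨c.re • (s, t) + c.im • (-t, s), ?_⟩
          rw [map_add, map_smul, map_smul, hsm]
          congr 2
          rw [hfa, hfa, smul_add, hI]
          change -(t : W.carrier) + _ = _
          rw [add_comm] }
    have hD : W.IsSubrep D := by
      constructor
      · rintro _ ⟨⟨⟨s, hs⟩, ⟨t, ht⟩⟩, rfl⟩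
        obtain ⟨a, b, haS, hbS, ha, hb, rfl⟩ := hgr s hs
        obtain ⟨a', b', haS', hbS', ha', hb', rfl⟩ := hgr t ht
        have : f (⟨a + b, hs⟩, ⟨a' + b', ht⟩) = f (⟨a, haS⟩, ⟨a', haS'⟩) + f (⟨b, hbS⟩, ⟨b', hbS'⟩) := by
          rw [hfa, hfa, hfa, smul_add]; exact add_add_add_comm _ _ _ _
        rw [this]
        exact Submodule.add_mem_sup
          ⟨⟨_, rfl⟩, add_mem ha ((W.part 0).smul_mem _ ha')⟩
          ⟨⟨_, rfl⟩, add_mem hb ((W.part 1).smul_mem _ hb')⟩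
      · rintro y _ ⟨⟨⟨s, hs⟩, ⟨t, ht⟩⟩, rfl⟩
        obtain ⟨a, b, rfl⟩ := τ.exists_re_im y
        refine ⟨(⟨W.act a s + -(W.act b t), hadd _ _ (hactS _ _ hs) (hneg _ (hactS _ _ ht))⟩,
          ⟨W.act b s + W.act a t, hadd _ _ (hactS _ _ hs) (hactS _ _ ht)⟩), ?_⟩
        rw [hfa, hfa]
        simp only [map_add, map_smul, LinearMap.add_apply, LinearMap.smul_apply, smul_add, hI]
        abel
    have hDtop : D = ⊤ := by
      refine (hW.simple.eq_bot_or_eq_top D hD).resolve_left fun hbot => hS0 ?_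
      rw [eq_bot_iff]
      intro s hs
      have : (s : W.carrier) ∈ D := ⟨(⟨s, hs⟩, 0), by
        rw [show (0 : S) = ⟨0, hzero⟩ from rfl, hfa]; simp⟩
      rw [hbot] at this
      exact this
    have hfbij : Function.Bijective f := by
      constructor
      · rw [← LinearMap.ker_eq_bot, LinearMap.ker_eq_bot']
        rintro ⟨⟨s, hs⟩, ⟨t, ht⟩⟩ hst
        rw [hfa] at hst
        have h1 : Complex.I • s = t := by
          have := congrArg (fun z => Complex.I • z) hst
          simp only [smul_add, hI, smul_zero] at this
          exact (add_neg_eq_zero.1 this)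
        have h2 : s ∈ C := ⟨hs, by rw [h1]; exact ht⟩
        rw [h] at h2
        have h3 : s = 0 := h2
        subst h3
        rw [smul_zero] at h1
        subst h1
        rfl
      · intro x
        have : x ∈ D := by rw [hDtop]; trivial
        exact this
    refine ⟨LinearEquiv.ofBijective f hfbij, ⟨?_, ?_⟩⟩
    · rintro i ⟨s, t⟩ ⟨hs, ht⟩
      exact add_mem (show (s : W.carrier) ∈ W.part i from hs) ((W.part i).smul_mem _ ht)
    · rintro a ⟨s, t⟩
      change W.act a s + Complex.I • W.act a t = W.act a (s + Complex.I • t)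
      rw [map_add, map_smul]
  · left
    refine SuperRep.Iso.symm ?_
    refine ⟨LinearEquiv.ofBijective S.subtype ⟨S.injective_subtype, fun x => ?_⟩,
      SuperRep.ofSubrep_isHom hS⟩
    have hx : (x : W.carrier) ∈ C := by rw [h]; trivial
    exact ⟨⟨x, hx.1⟩, rfl⟩

/-- The module `V` with `Φ([W]) = [V]` is unique up to isomorphism. -/
theorem IsPhi.iso {τ : L.AntilinearInvolution} {W : SuperRep.{v} L} {V V' : SuperRep.{v} τ.realForm}
    (h : τ.IsPhi W V) (h' : τ.IsPhi W V') : V.Iso V' := by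
  have fstHom : (V'.prod V').IsHom V' (LinearMap.fst ℝ _ _) := ⟨fun i x hx => hx.1, fun a x => rfl⟩
  have sndHom : (V'.prod V').IsHom V' (LinearMap.snd ℝ _ _) := ⟨fun i x hx => hx.2, fun a x => rfl⟩
  have inlHom : V.IsHom (V.prod V) (LinearMap.inl ℝ _ _) :=
    ⟨fun i x hx => ⟨hx, zero_mem _⟩, fun a x => Prod.ext rfl (map_zero _).symm⟩
  -- an injective homomorphism into the restriction of `W`
  obtain ⟨f, hf, hfi⟩ : ∃ f : V.carrier →ₗ[ℝ] (τ.realify W).carrier,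
      V.IsHom (τ.realify W) f ∧ Function.Injective f := by
    rcases h.2 with h | h
    · obtain ⟨e, he⟩ := h.symm
      exact ⟨e.toLinearMap, he, e.injective⟩
    · obtain ⟨e, he⟩ := h.symm
      exact ⟨_, he.comp inlHom, e.injective.comp LinearMap.inl_injective⟩
  have hnt := h.1.simple.nontrivial
  obtain ⟨x, hx⟩ := exists_ne (0 : V.carrier)
  have hfx : f x ≠ 0 := fun h0 => hx (hfi (by rw [h0, map_zero]))
  have key : ∃ g : V.carrier →ₗ[ℝ] V'.carrier, V.IsHom V' g ∧ g ≠ 0 := by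
    rcases h'.2 with h | h
    · obtain ⟨e, he⟩ := h
      refine ⟨_, he.comp hf, fun h0 => hfx ?_⟩
      have := LinearMap.congr_fun h0 x
      exact e.injective (by rw [map_zero]; exact this)
    · obtain ⟨e, he⟩ := h
      by_cases h1 : LinearMap.fst ℝ V'.carrier V'.carrier ∘ₗ (e.toLinearMap ∘ₗ f) = 0
      · refine ⟨_, sndHom.comp (he.comp hf), fun h0 => hfx ?_⟩
        have h2 := LinearMap.congr_fun h0 x
        have h3 := LinearMap.congr_fun h1 x
        exact e.injective (by rw [map_zero]; exact Prod.ext h3 h2)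
      · exact ⟨_, fstHom.comp (he.comp hf), h1⟩
  obtain ⟨g, hg, hg0⟩ := key
  exact ⟨LinearEquiv.ofBijective g (hg.bijective h.1.simple h'.1.simple hg0), hg⟩

/-- The endotype `EType_{𝔤,τ}(W)` of a simple finite dimensional `𝔤`-module `W`, namely the
endotype of the real module `V` with `Φ([W]) = [V]`. -/
noncomputable def EType (τ : L.AntilinearInvolution) (W : SuperRep.{v} L) (hW : W.IsIrr) :
    BrauerWall.{v} :=
  (τ.exists_isPhi W hW).choose.realEType (τ.exists_isPhi W hW).choose_spec.1

/-- The endotype does not depend on the choice of `V`. -/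
theorem EType_eq (τ : L.AntilinearInvolution) (W : SuperRep.{v} L) (hW : W.IsIrr)
    {V : SuperRep.{v} τ.realForm} (hV : τ.IsPhi W V) : τ.EType W hW = V.realEType hV.1 :=
  SuperRep.realEType_eq_of_iso _ _ ((τ.exists_isPhi W hW).choose_spec.iso hV)

end AntilinearInvolution

end

end LieSuperalgebra
namespace LieSuperalgebra

open scoped TensorProduct

section

variable {K : Type*} {𝔤 : Type*} [Field K] [AddCommGroup 𝔤] [Module K 𝔤]

/-- The relations `x y = (-1)^{|x||y|} y x + [x,y]` of the universal enveloping algebra. -/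
inductive EnvRel (L : LieSuperalgebra K 𝔤) : TensorAlgebra K 𝔤 → TensorAlgebra K 𝔤 → Prop
  | of (i j : ZMod 2) (x y : 𝔤) (hx : x ∈ L.part i) (hy : y ∈ L.part j) :
    EnvRel L (TensorAlgebra.ι K x * TensorAlgebra.ι K y)
      (sgn (i * j) • (TensorAlgebra.ι K y * TensorAlgebra.ι K x) +
        TensorAlgebra.ι K (L.bracket x y))

/-- The ring congruence generated by these relations. -/
def envCon (L : LieSuperalgebra K 𝔤) : RingCon (TensorAlgebra K 𝔤) := ringConGen (EnvRel L)

/-- The universal enveloping algebra `U(𝔤)` of a Lie superalgebra. -/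
def Env (L : LieSuperalgebra K 𝔤) := L.envCon.Quotient

noncomputable instance (L : LieSuperalgebra K 𝔤) : Ring L.Env :=
  inferInstanceAs (Ring L.envCon.Quotient)

noncomputable instance (L : LieSuperalgebra K 𝔤) : Algebra K L.Env :=
  inferInstanceAs (Algebra K L.envCon.Quotient)

/-- The projection of the tensor algebra onto `U(𝔤)`. -/
noncomputable def envMk (L : LieSuperalgebra K 𝔤) : TensorAlgebra K 𝔤 →ₐ[K] L.Env :=
  RingCon.mkₐ K L.envCon

/-- The canonical map `𝔤 → U(𝔤)`. -/
noncomputable def envι (L : LieSuperalgebra K 𝔤) : 𝔤 →ₗ[K] L.Env :=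
  L.envMk.toLinearMap ∘ₗ TensorAlgebra.ι K

theorem envι_mul (L : LieSuperalgebra K 𝔤) {i j : ZMod 2} {x y : 𝔤} (hx : x ∈ L.part i)
    (hy : y ∈ L.part j) :
    L.envι x * L.envι y = sgn (i * j) • (L.envι y * L.envι x) + L.envι (L.bracket x y) := by
  have h : L.envMk (TensorAlgebra.ι K x * TensorAlgebra.ι K y) =
      L.envMk (sgn (i * j) • (TensorAlgebra.ι K y * TensorAlgebra.ι K x) +
        TensorAlgebra.ι K (L.bracket x y)) :=
    Quotient.sound (RingCon.le_ringConGen _ _ (EnvRel.of i j x y hx hy))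
  simpa [envι] using h

/-- The extension to `U(𝔤)` of a linear map that satisfies the defining relations. -/
noncomputable def envLift (L : LieSuperalgebra K 𝔤) {A : Type*} [Ring A] [Algebra K A]
    (f : 𝔤 →ₗ[K] A) (hf : ∀ (i j : ZMod 2) (x y : 𝔤), x ∈ L.part i → y ∈ L.part j →
      f x * f y = sgn (i * j) • (f y * f x) + f (L.bracket x y)) : L.Env →ₐ[K] A :=
  RingCon.liftₐ L.envCon (TensorAlgebra.lift K f) (RingCon.ringConGen_le.2 fun s t h => by
    induction h with
    | of i j x y hx hy =>
      simpa using hf i j x y hx hy)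

theorem envLift_ι (L : LieSuperalgebra K 𝔤) {A : Type*} [Ring A] [Algebra K A]
    (f : 𝔤 →ₗ[K] A) (hf : ∀ (i j : ZMod 2) (x y : 𝔤), x ∈ L.part i → y ∈ L.part j →
      f x * f y = sgn (i * j) • (f y * f x) + f (L.bracket x y)) (x : 𝔤) :
    L.envLift f hf (L.envι x) = f x :=
  TensorAlgebra.lift_ι_apply f x

theorem env_hom_ext {L : LieSuperalgebra K 𝔤} {A : Type*} [Ring A] [Algebra K A]
    {f g : L.Env →ₐ[K] A} (h : ∀ x, f (L.envι x) = g (L.envι x)) : f = g := by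
  have h' : f.comp L.envMk = g.comp L.envMk := TensorAlgebra.hom_ext (LinearMap.ext h)
  ext a
  obtain ⟨t, rfl⟩ := Quotient.exists_rep a
  exact AlgHom.congr_fun h' t

/-- The parity automorphism of `U(𝔤)`, which extends the one of `𝔤`. -/
noncomputable def envParity (L : LieSuperalgebra K 𝔤) : L.Env →ₐ[K] L.Env :=
  L.envLift (L.envι ∘ₗ parity L.part L.isCompl) (by
    intro i j x y hx hy
    have hxy := L.bracket_mem i j x y hx hy
    simp only [LinearMap.comp_apply, parity_of_mem L.isCompl hx, parity_of_mem L.isCompl hy,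
      parity_of_mem L.isCompl hxy, map_zsmul]
    rw [smul_mul_smul_comm, smul_mul_smul_comm, L.envι_mul hx hy, sgn_add,
      smul_comm (sgn (i * j)), mul_comm (sgn j), ← smul_add])

theorem envParity_ι (L : LieSuperalgebra K 𝔤) (x : 𝔤) :
    L.envParity (L.envι x) = L.envι (parity L.part L.isCompl x) := by
  exact L.envLift_ι _ _ x

theorem envParity_envParity (L : LieSuperalgebra K 𝔤) (u : L.Env) :
    L.envParity (L.envParity u) = u := by
  have : L.envParity.comp L.envParity = AlgHom.id K L.Env := by
    refine env_hom_ext fun x => ?_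
    change L.envParity (L.envParity (L.envι x)) = L.envι x
    rw [envParity_ι, envParity_ι, parity_parity]
  exact AlgHom.congr_fun this u

end

section

variable {𝔤 : Type u} [AddCommGroup 𝔤] [Module ℂ 𝔤]

/-- A triangular decomposition `𝔤 = ū ⊕ 𝔩 ⊕ 𝔲`. -/
structure TriangularDecomposition (L : LieSuperalgebra ℂ 𝔤) where
  ubar : L.Subsuperalgebra
  l : L.Subsuperalgebra
  u : L.Subsuperalgebra
  isInternal : DirectSum.IsInternal ![ubar.carrier, l.carrier, u.carrier]
  bracket_l_u : ∀ x y : 𝔤, x ∈ l.carrier → y ∈ u.carrier → L.bracket x y ∈ u.carrier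
  bracket_l_ubar : ∀ x y : 𝔤, x ∈ l.carrier → y ∈ ubar.carrier → L.bracket x y ∈ ubar.carrier

namespace AntilinearInvolution

variable {L : LieSuperalgebra ℂ 𝔤}

/-- The condition `τ(S) = S`. -/
def Stabilizes (τ : L.AntilinearInvolution) (S : L.Subsuperalgebra) : Prop :=
  ∀ x : 𝔤, τ.toMap x ∈ S.carrier ↔ x ∈ S.carrier

/-- The restriction of `τ` to a `τ`-stable subalgebra. -/
def restrict (τ : L.AntilinearInvolution) (S : L.Subsuperalgebra) (hS : τ.Stabilizes S) :
    S.toLie.AntilinearInvolution where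
  toMap :=
    { toFun := fun x => ⟨τ.toMap x, (hS x).2 x.2⟩
      map_add' := fun x y => Subtype.ext (by simp)
      map_smul' := fun c x => Subtype.ext (by simp) }
  involutive x := Subtype.ext (τ.involutive x)
  map_part i x hx := τ.map_part i x hx
  map_bracket x y := Subtype.ext (τ.map_bracket x y)

/-- The complexification in `𝔤` of a subspace of the real form. -/
def complexify (τ : L.AntilinearInvolution) (S : Submodule ℝ τ.fixed) : Submodule ℂ 𝔤 :=
  Submodule.span ℂ {x : 𝔤 | ∃ y ∈ S, (y : 𝔤) = x}

end AntilinearInvolution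

namespace TriangularDecomposition

variable {L : LieSuperalgebra ℂ 𝔤}

/-- A triangular decomposition whose three summands are `τ`-stable. -/
structure IsStable (T : L.TriangularDecomposition) (τ : L.AntilinearInvolution) : Prop where
  ubar : τ.Stabilizes T.ubar
  l : τ.Stabilizes T.l
  u : τ.Stabilizes T.u

/-- Hyperbolic type: for some even `x` in the real form such that `ad x` is diagonalizable over
`ℝ`, the summands `ū`, `𝔩`, `𝔲` are the complexifications of the sums of the eigenspaces of
`ad x` on `𝔤^ℝ` for the negative eigenvalues, for the eigenvalue zero, and for the positive
eigenvalues. -/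
def IsHyperbolic (T : L.TriangularDecomposition) (τ : L.AntilinearInvolution) : Prop :=
  ∃ x ∈ τ.realForm.part 0,
    (⨆ c : ℝ, Module.End.eigenspace (τ.realForm.bracket x) c) = ⊤ ∧
    T.ubar.carrier =
      τ.complexify (⨆ c : ℝ, ⨆ _ : c < 0, Module.End.eigenspace (τ.realForm.bracket x) c) ∧
    T.l.carrier = τ.complexify (LinearMap.ker (τ.realForm.bracket x)) ∧
    T.u.carrier =
      τ.complexify (⨆ c : ℝ, ⨆ _ : 0 < c, Module.End.eigenspace (τ.realForm.bracket x) c)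

/-- Borel subalgebras of the even part of `S`, i.e. maximal solvable subalgebras, as
subalgebras of the Lie algebra `𝔤_0`. -/
def IsBorelOfEvenPart (S : Submodule ℂ 𝔤) (b : LieSubalgebra ℂ (L.part 0)) : Prop :=
  Maximal (fun b' : LieSubalgebra ℂ (L.part 0) =>
    (∀ x ∈ b', (x : 𝔤) ∈ S) ∧ LieAlgebra.IsSolvable b') b

/-- Graded type. Brackets `[A, B]` of subspaces, i.e. the spans of the brackets of their
elements, are written `Submodule.map₂ L.bracket A B`. -/
def IsGradedType (T : L.TriangularDecomposition) : Prop :=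
  ∃ G : ℤ → Submodule ℂ 𝔤,
    DirectSum.IsInternal G ∧ (∀ i, IsGradedSubspace L.part (G i)) ∧
    (∀ i j, Submodule.map₂ L.bracket (G i) (G j) ≤ G (i + j)) ∧
    T.l.carrier = G 0 ∧ T.u.carrier = (⨆ i : ℤ, ⨆ _ : 1 ≤ i, G i) ∧
    T.ubar.carrier = (⨆ i : ℤ, ⨆ _ : i ≤ -1, G i) ∧
    (∃ (b0 : LieSubalgebra ℂ (L.part 0)) (b0' b : Submodule ℂ 𝔤),
      IsBorelOfEvenPart (G 0) b0 ∧
      b0' = b0.toSubmodule.map (L.part 0).subtype ∧ b = b0' ⊔ T.u.carrier ∧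
      Submodule.map₂ L.bracket (b ⊓ L.part 1) (b ⊓ L.part 1) ≤
        Submodule.map₂ L.bracket (b ⊓ L.part 0) (b ⊓ L.part 0) ∧
      Submodule.map₂ L.bracket b0' (G 1 ⊓ L.part 0) = G 1 ⊓ L.part 0) ∧
    (∀ S : L.Subsuperalgebra, G 1 ≤ S.carrier → T.u.carrier ≤ S.carrier) ∧
    (∀ S : L.Subsuperalgebra, G (-1) ≤ S.carrier → T.ubar.carrier ≤ S.carrier)

/-- The subspace `W^𝔲` of vectors annihilated by `𝔲`. -/
def invariantsSubmodule (T : L.TriangularDecomposition) (W : SuperRep.{v} L) :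
    Submodule ℂ W.carrier where
  carrier := {w | ∀ x ∈ T.u.carrier, W.act x w = 0}
  zero_mem' := fun x _ => map_zero _
  add_mem' := fun hv hw x hx => by rw [map_add, hv x hx, hw x hx, add_zero]
  smul_mem' := fun c w hw x hx => by rw [map_smul, hw x hx, smul_zero]

theorem mem_invariantsSubmodule_of_hom {T : L.TriangularDecomposition} {W : SuperRep.{v} L}
    {w : W.carrier} (h : ∀ i, ∀ x ∈ T.u.carrier, x ∈ L.part i → W.act x w = 0) :
    w ∈ T.invariantsSubmodule W := by
  intro x hx
  obtain ⟨a, ha, b, hb, rfl⟩ := Submodule.mem_sup.1 (T.u.graded hx)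
  rw [map_add, LinearMap.add_apply, h 0 a ha.1 ha.2, h 1 b hb.1 hb.2, add_zero]

theorem invariantsSubmodule_graded (T : L.TriangularDecomposition) (W : SuperRep.{v} L) :
    IsGradedSubspace W.part (T.invariantsSubmodule W) := by
  intro w hw
  have hw' : w ∈ W.part 0 ⊔ W.part 1 := by rw [W.isCompl.sup_eq_top]; trivial
  obtain ⟨a, ha, b, hb, rfl⟩ := Submodule.mem_sup.1 hw'
  have key : ∀ i, ∀ x ∈ T.u.carrier, x ∈ L.part i → W.act x a = 0 ∧ W.act x b = 0 := by
    intro i x hx hxi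
    have h1 : W.act x a + W.act x b = 0 := by rw [← map_add]; exact hw x hx
    have h2 : W.act x a ∈ W.part i := by simpa using W.act_mem i 0 x a hxi ha
    have h3 : W.act x b ∈ W.part (i + 1) := W.act_mem i 1 x b hxi hb
    have h4 : W.act x a = 0 := by
      refine eq_zero_of_mem W.isCompl h2 ?_
      rw [eq_neg_of_add_eq_zero_left h1]
      exact neg_mem h3
    exact ⟨h4, by rwa [h4, zero_add] at h1⟩
  exact Submodule.add_mem_sup
    ⟨mem_invariantsSubmodule_of_hom fun i x hx hxi => (key i x hx hxi).1, ha⟩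
    ⟨mem_invariantsSubmodule_of_hom fun i x hx hxi => (key i x hx hxi).2, hb⟩

theorem invariantsSubmodule_act (T : L.TriangularDecomposition) (W : SuperRep.{v} L) (y : 𝔤)
    (hy : y ∈ T.l.carrier) (w : W.carrier) (hw : w ∈ T.invariantsSubmodule W) :
    W.act y w ∈ T.invariantsSubmodule W := by
  obtain ⟨a, ha, b, hb, rfl⟩ := Submodule.mem_sup.1 (T.l.graded hy)
  have key : ∀ j, ∀ y ∈ T.l.carrier, y ∈ L.part j → W.act y w ∈ T.invariantsSubmodule W := by
    intro j y hy hyj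
    refine mem_invariantsSubmodule_of_hom fun i x hx hxi => ?_
    have h1 := W.act_bracket j i y x w hyj hxi
    rw [hw x hx, hw _ (T.bracket_l_u y x hy hx), map_zero, zero_sub, eq_comm, neg_eq_zero] at h1
    unfold sgn at h1
    split_ifs at h1 <;> simpa using h1
  rw [map_add, LinearMap.add_apply]
  exact add_mem (key 0 a ha.1 ha.2) (key 1 b hb.1 hb.2)

/-- `W^𝔲`, as a module over `𝔩`. -/
noncomputable abbrev invariants (T : L.TriangularDecomposition) (W : SuperRep.{v} L) :
    SuperRep.{v} T.l.toLie where
  carrier := T.invariantsSubmodule W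
  part i := (W.part i).comap (T.invariantsSubmodule W).subtype
  isCompl := (T.invariantsSubmodule_graded W).isCompl W.isCompl
  act := LinearMap.mk₂ ℂ (fun a w => ⟨W.act a w, T.invariantsSubmodule_act W a a.2 w w.2⟩)
    (fun a b x => Subtype.ext (by simp)) (fun c a x => Subtype.ext (by simp))
    (fun a x y => Subtype.ext (by simp)) (fun c a x => Subtype.ext (by simp))
  act_mem i j a w ha hw := W.act_mem i j a w ha hw
  act_bracket i j a b w ha hb := Subtype.ext (by simpa using W.act_bracket i j a b w ha hb)

/-- The kernel of `U(𝔤) ⊗_ℂ N → U(𝔤) ⊗_{U(𝔮)} N`, for `𝔮 = 𝔩 ⊕ 𝔲` acting on the `𝔩`-module `N`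
with `𝔲` acting by zero. -/
noncomputable def indKer (T : L.TriangularDecomposition) (N : SuperRep.{v} T.l.toLie) :
    Submodule ℂ (L.Env ⊗[ℂ] N.carrier) :=
  Submodule.span ℂ
    ({t | ∃ (a : L.Env) (x : T.l.carrier) (n : N.carrier),
        t = (a * L.envι x) ⊗ₜ[ℂ] n - a ⊗ₜ[ℂ] N.act x n} ∪
      {t | ∃ (a : L.Env) (x : 𝔤) (n : N.carrier), x ∈ T.u.carrier ∧
        t = (a * L.envι x) ⊗ₜ[ℂ] n})

/-- Left multiplication by elements of `𝔤` on `U(𝔤) ⊗_{U(𝔮)} N`. -/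
noncomputable def indAct (T : L.TriangularDecomposition) (N : SuperRep.{v} T.l.toLie) (x : 𝔤) :
    ((L.Env ⊗[ℂ] N.carrier) ⧸ T.indKer N) →ₗ[ℂ] ((L.Env ⊗[ℂ] N.carrier) ⧸ T.indKer N) :=
  Submodule.mapQ _ _ (LinearMap.rTensor N.carrier (LinearMap.mulLeft ℂ (L.envι x))) (by
    rw [indKer, Submodule.span_le]
    rintro _ (⟨a, y, n, rfl⟩ | ⟨a, y, n, hy, rfl⟩)
    · refine Submodule.subset_span (Or.inl ⟨L.envι x * a, y, n, ?_⟩)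
      simp [mul_assoc]
    · refine Submodule.subset_span (Or.inr ⟨L.envι x * a, y, n, hy, ?_⟩)
      simp [mul_assoc])

theorem indAct_mk (T : L.TriangularDecomposition) (N : SuperRep.{v} T.l.toLie) (x : 𝔤)
    (a : L.Env) (n : N.carrier) :
    T.indAct N x ((T.indKer N).mkQ (a ⊗ₜ n)) = (T.indKer N).mkQ ((L.envι x * a) ⊗ₜ n) := rfl

/-- The parity involution of `U(𝔤) ⊗_{U(𝔮)} N`. -/
noncomputable def indParity (T : L.TriangularDecomposition) (N : SuperRep.{v} T.l.toLie) :
    ((L.Env ⊗[ℂ] N.carrier) ⧸ T.indKer N) →ₗ[ℂ] ((L.Env ⊗[ℂ] N.carrier) ⧸ T.indKer N) :=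
  Submodule.mapQ _ _ (TensorProduct.map L.envParity.toLinearMap (parity N.part N.isCompl)) (by
    rw [indKer, Submodule.span_le]
    rintro _ (⟨a, y, n, rfl⟩ | ⟨a, y, n, hy, rfl⟩)
    · obtain ⟨b, hb, c, hc, rfl⟩ : ∃ b ∈ T.l.toLie.part 0, ∃ c ∈ T.l.toLie.part 1, b + c = y :=
        Submodule.mem_sup.1 (by rw [T.l.toLie.isCompl.sup_eq_top]; trivial)
      have key : ∀ (i : ZMod 2) (y : T.l.carrier), y ∈ T.l.toLie.part i →
          TensorProduct.map L.envParity.toLinearMap (parity N.part N.isCompl)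
            ((a * L.envι y) ⊗ₜ[ℂ] n - a ⊗ₜ[ℂ] N.act y n) ∈ T.indKer N := by
        intro i y hy
        have h1 : parity N.part N.isCompl (N.act y n) =
            sgn i • N.act y (parity N.part N.isCompl n) := by
          refine hom_induction N.isCompl (P := fun n => parity N.part N.isCompl (N.act y n) =
            sgn i • N.act y (parity N.part N.isCompl n)) ?_ ?_ n
          · intro j n hn
            rw [parity_of_mem N.isCompl hn, parity_of_mem N.isCompl (N.act_mem i j y n hy hn),
              map_zsmul, smul_smul, sgn_add]
          · intro m n hm hn
            simp only [map_add, smul_add, hm, hn]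
        have h2 : L.envParity (L.envι y) = sgn i • L.envι y := by
          rw [envParity_ι, parity_of_mem L.isCompl (show (y : 𝔤) ∈ L.part i from hy), map_zsmul]
        have h3 : (L.envParity a * L.envι y) ⊗ₜ[ℂ] parity N.part N.isCompl n -
            L.envParity a ⊗ₜ[ℂ] N.act y (parity N.part N.isCompl n) ∈ T.indKer N :=
          Submodule.subset_span (Or.inl ⟨_, y, _, rfl⟩)
        rw [map_sub, TensorProduct.map_tmul, TensorProduct.map_tmul, h1, AlgHom.toLinearMap_apply,
          AlgHom.toLinearMap_apply, map_mul, h2]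
        rcases zmod_two_cases i with rfl | rfl
        · rw [sgn_zero, one_smul, one_smul]
          exact h3
        · rw [sgn_one, neg_one_smul, neg_one_smul, mul_neg, TensorProduct.neg_tmul,
            TensorProduct.tmul_neg, ← neg_sub', neg_mem_iff]
          exact h3
      have h3 : (a * L.envι ((b + c : T.l.carrier) : 𝔤)) ⊗ₜ[ℂ] n - a ⊗ₜ[ℂ] N.act (b + c) n =
          ((a * L.envι b) ⊗ₜ[ℂ] n - a ⊗ₜ[ℂ] N.act b n) +
            ((a * L.envι c) ⊗ₜ[ℂ] n - a ⊗ₜ[ℂ] N.act c n) := by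
        rw [Submodule.coe_add, map_add, map_add, mul_add, LinearMap.add_apply,
          TensorProduct.add_tmul, TensorProduct.tmul_add]
        abel
      rw [SetLike.mem_coe, Submodule.mem_comap, h3, map_add]
      exact add_mem (key 0 b hb) (key 1 c hc)
    · obtain ⟨b, hb, c, hc, rfl⟩ := Submodule.mem_sup.1 (T.u.graded hy)
      have key : ∀ (i : ZMod 2), ∀ y ∈ T.u.carrier, y ∈ L.part i →
          TensorProduct.map L.envParity.toLinearMap (parity N.part N.isCompl)
            ((a * L.envι y) ⊗ₜ[ℂ] n) ∈ T.indKer N := by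
        intro i y hy hyi
        have h2 : L.envParity (L.envι y) = sgn i • L.envι y := by
          rw [envParity_ι, parity_of_mem L.isCompl hyi, map_zsmul]
        have h3 : (L.envParity a * L.envι y) ⊗ₜ[ℂ] parity N.part N.isCompl n ∈ T.indKer N :=
          Submodule.subset_span (Or.inr ⟨_, y, _, hy, rfl⟩)
        rw [TensorProduct.map_tmul, AlgHom.toLinearMap_apply, map_mul, h2]
        rcases zmod_two_cases i with rfl | rfl
        · rw [sgn_zero, one_smul]
          exact h3
        · rw [sgn_one, neg_one_smul, mul_neg, TensorProduct.neg_tmul, neg_mem_iff]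
          exact h3
      rw [SetLike.mem_coe, Submodule.mem_comap, map_add, mul_add, TensorProduct.add_tmul, map_add]
      exact add_mem (key 0 b hb.1 hb.2) (key 1 c hc.1 hc.2))

theorem indParity_mk (T : L.TriangularDecomposition) (N : SuperRep.{v} T.l.toLie)
    (a : L.Env) (n : N.carrier) :
    T.indParity N ((T.indKer N).mkQ (a ⊗ₜ n)) =
      (T.indKer N).mkQ (L.envParity a ⊗ₜ parity N.part N.isCompl n) := rfl

theorem ind_induction (T : L.TriangularDecomposition) (N : SuperRep.{v} T.l.toLie)
    {P : ((L.Env ⊗[ℂ] N.carrier) ⧸ T.indKer N) → Prop}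
    (h : ∀ a n, P ((T.indKer N).mkQ (a ⊗ₜ n))) (hadd : ∀ x y, P x → P y → P (x + y)) (x) : P x := by
  obtain ⟨t, rfl⟩ := (T.indKer N).mkQ_surjective x
  induction t using TensorProduct.induction_on with
  | zero => simpa using h 0 0
  | tmul a n => exact h a n
  | add s t hs ht => rw [map_add]; exact hadd _ _ hs ht

/-- The induced module `Ind_𝔮^𝔤 N = U(𝔤) ⊗_{U(𝔮)} N`, where `𝔮 = 𝔩 ⊕ 𝔲`. -/
noncomputable def ind (T : L.TriangularDecomposition) (N : SuperRep.{v} T.l.toLie) :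
    SuperRep.{max u v} L where
  carrier := (L.Env ⊗[ℂ] N.carrier) ⧸ T.indKer N
  part := signPart (T.indParity N)
  isCompl := by
    refine isCompl_signPart _ fun x => ?_
    refine T.ind_induction N (P := fun x => T.indParity N (T.indParity N x) = x) ?_ ?_ x
    · intro a n
      rw [indParity_mk, indParity_mk, envParity_envParity, parity_parity]
    · intro x y hx hy
      rw [map_add, map_add, hx, hy]
  act :=
    { toFun := T.indAct N
      map_add' := fun x y => by
        apply LinearMap.ext
        refine T.ind_induction N ?_ ?_
        · intro a n
          rw [LinearMap.add_apply, indAct_mk, indAct_mk, indAct_mk, map_add, add_mul,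
            TensorProduct.add_tmul, map_add]
        · intro s t hs ht
          rw [map_add, map_add, hs, ht]
      map_smul' := fun c x => by
        apply LinearMap.ext
        refine T.ind_induction N ?_ ?_
        · intro a n
          rw [LinearMap.smul_apply, indAct_mk, indAct_mk, map_smul, smul_mul_assoc,
            ← TensorProduct.smul_tmul', map_smul, RingHom.id_apply]
        · intro s t hs ht
          rw [map_add, map_add, hs, ht] }
  act_mem i j x w hx hw := by
    have hw' : T.indParity N w = sgn j • w := hw
    change T.indParity N (T.indAct N x w) = sgn (i + j) • T.indAct N x w
    have key : ∀ w, T.indParity N (T.indAct N x w) = sgn i • T.indAct N x (T.indParity N w) := by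
      refine T.ind_induction N ?_ ?_
      · intro a n
        rw [indAct_mk, indParity_mk, indParity_mk, indAct_mk, map_mul, envParity_ι,
          parity_of_mem L.isCompl hx, map_zsmul, smul_mul_assoc, ← TensorProduct.smul_tmul',
          map_zsmul]
      · intro s t hs ht
        simp only [map_add, smul_add, hs, ht]
    rw [key, hw', map_zsmul, smul_smul, sgn_add]
  act_bracket i j x y w hx hy := by
    change T.indAct N _ w = T.indAct N x (T.indAct N y w) - sgn (i * j) • T.indAct N y (T.indAct N x w)
    refine T.ind_induction N (P := fun w => T.indAct N _ w = T.indAct N x (T.indAct N y w) -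
      sgn (i * j) • T.indAct N y (T.indAct N x w)) ?_ ?_ w
    · intro a n
      rw [indAct_mk, indAct_mk, indAct_mk, indAct_mk, indAct_mk, ← mul_assoc, L.envι_mul hx hy,
        add_mul, TensorProduct.add_tmul, map_add, smul_mul_assoc, ← TensorProduct.smul_tmul',
        map_zsmul, mul_assoc, add_sub_cancel_left]
    · intro s t hs ht
      rw [map_add, hs, ht]
      simp only [map_add, smul_add]
      abel

end TriangularDecomposition

end

end LieSuperalgebra

/-! Everything reduces to an extension property (`HomsExtend`): for irreducible `W` and `W'`, each
`𝔩`-homomorphism `W^𝔲 → W'^𝔲` is the restriction of a `𝔤`-homomorphism `W → W'`.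

Why it suffices (`EType_invariants`). A homogeneous real endomorphism of `W` commuting with `𝔤^ℝ` is
the sum of a complex linear and an antilinear one, and the antilinear one is a complex linear
homomorphism from `W` to its conjugate `W^τ`, which is again irreducible. Because `τ` preserves `𝔲`,
the conjugate of `W^𝔲` sits in `W^τ` as vectors killed by `𝔲`. The extension property for `W → W`
and `W → W^τ`, with parities shifted in the odd case, therefore extends each homogeneous real
endomorphism of `W^𝔲` to `W`. Conversely real endomorphisms of `W` restrict to `W^𝔲`, and
restriction is injective because `W` is simple. The real module `V` in the definition of the
endotype is a simple real submodule, and real submodules are ranges of even idempotents. A simple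
`S' ⊆ W^𝔲` cut out by `e` corresponds to the range `S` of the extension `E` of `e`, and the
endomorphisms of `S'` and `S` are the corners cut out by `e` and by `E`, which agree.

Why homomorphisms extend. In both cases the extension of `f` is found through its graph, as a
submodule of `W ⊕ W'` meeting `0 ⊕ W'` trivially. Under the first criterion, the inclusion of `W^𝔲`
and `f` induce maps from `Ind W^𝔲` to `W` and `W'`. Their kernels are maximal submodules, hence
equal, and the joint image is the graph. For the special types it is enough that `W^𝔲 ≠ 0` and `ū·W
≠ W` for all irreducible `W`. A nonzero `𝔩`-submodule `S ⊆ W^𝔲` generates `W` under `ū`, so `S + ū·W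
= W`. This forces `W^𝔲 ∩ ū·W = 0` and makes `W^𝔲` irreducible. The submodule generated by the graph
of `f` is then the graph of an extension.

The two inequalities. In hyperbolic type, consider an eigenvalue of `x_∘` on `W` with maximal real
part: `𝔲` kills its eigenvectors, and `ū·W` misses its generalized eigenspace. In graded type, null
vectors of the components of high degree are improved degree by degree, by anticommutation for odd
elements and by Lie's theorem for even ones. An odd `ū` acts by anticommuting operators of square
zero, so that `ū·W ≠ W`. -/

namespace LieSuperalgebra

/-! ### Graded subspaces, and homomorphisms obtained from graphs -/

section

variable {K : Type*} {𝔤 : Type*} [Field K] [AddCommGroup 𝔤] [Module K 𝔤]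

theorem _root_.SuperSpace.IsGradedSubspace.exists_add {V : Type*} [AddCommGroup V] [Module K V]
    {p : ZMod 2 → Submodule K V} {S : Submodule K V} (hS : IsGradedSubspace p S) {x : V}
    (hx : x ∈ S) : ∃ a b, a ∈ S ∧ b ∈ S ∧ a ∈ p 0 ∧ b ∈ p 1 ∧ x = a + b := by
  obtain ⟨a, ha, b, hb, hab⟩ := Submodule.mem_sup.1 (hS hx)
  exact ⟨a, b, ha.1, hb.1, ha.2, hb.2, hab.symm⟩

/-- A graded subspace is contained in a subspace if its homogeneous elements are. -/
theorem _root_.SuperSpace.IsGradedSubspace.le_of_hom {V : Type*} [AddCommGroup V] [Module K V]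
    {p : ZMod 2 → Submodule K V} {S M : Submodule K V} (hS : IsGradedSubspace p S)
    (h : ∀ i, ∀ x ∈ S, x ∈ p i → x ∈ M) : S ≤ M := by
  intro x hx
  obtain ⟨a, b, ha, hb, ha0, hb1, rfl⟩ := hS.exists_add hx
  exact add_mem (h 0 a ha ha0) (h 1 b hb hb1)

theorem _root_.SuperSpace.isGradedSubspace_top {V : Type*} [AddCommGroup V] [Module K V]
    {p : ZMod 2 → Submodule K V} (h : IsCompl (p 0) (p 1)) : IsGradedSubspace p ⊤ := by
  intro x _
  have hx' : x ∈ p 0 ⊔ p 1 := by rw [h.sup_eq_top]; trivial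
  simpa using hx'

theorem _root_.SuperSpace.IsGradedSubspace.sup {V : Type*} [AddCommGroup V] [Module K V]
    {p : ZMod 2 → Submodule K V} {S M : Submodule K V} (hS : IsGradedSubspace p S)
    (hM : IsGradedSubspace p M) : IsGradedSubspace p (S ⊔ M) :=
  sup_le (hS.trans (sup_le_sup (inf_le_inf_right _ le_sup_left) (inf_le_inf_right _ le_sup_left)))
    (hM.trans (sup_le_sup (inf_le_inf_right _ le_sup_right) (inf_le_inf_right _ le_sup_right)))

namespace SuperRep

variable {L : LieSuperalgebra K 𝔤}

theorem act_act (V : SuperRep.{v} L) {i j : ZMod 2} {x y : 𝔤} (hx : x ∈ L.part i)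
    (hy : y ∈ L.part j) (w : V.carrier) :
    V.act x (V.act y w) = V.act (L.bracket x y) w + sgn (i * j) • V.act y (V.act x w) := by
  rw [V.act_bracket i j x y w hx hy, sub_add_cancel]

theorem IsHom.symm {V : SuperRep.{v} L} {V' : SuperRep.{w} L} {e : V.carrier ≃ₗ[K] V'.carrier}
    (he : V.IsHom V' e.toLinearMap) : V'.IsHom V e.symm.toLinearMap := by
  refine ⟨fun i x hx => he.mem_of_map_mem e.injective (by simpa using hx), fun a x => ?_⟩
  apply e.injective
  have := he.map_act a (e.symm x)
  simp at this
  simp [this]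

theorem prod_isHom_fst (V : SuperRep.{v} L) (V' : SuperRep.{w} L) :
    (V.prod V').IsHom V (LinearMap.fst K _ _) := ⟨fun _ _ hx => hx.1, fun _ _ => rfl⟩

theorem prod_isHom_snd (V : SuperRep.{v} L) (V' : SuperRep.{w} L) :
    (V.prod V').IsHom V' (LinearMap.snd K _ _) := ⟨fun _ _ hx => hx.2, fun _ _ => rfl⟩

theorem IsSubrep.comap {V : SuperRep.{v} L} {V' : SuperRep.{w} L}
    {f : V.carrier →ₗ[K] V'.carrier} (hf : V.IsHom V' f) {S : Submodule K V'.carrier}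
    (hS : V'.IsSubrep S) : V.IsSubrep (S.comap f) where
  graded x hx := by
    obtain ⟨a, b, -, -, ha, hb, rfl⟩ := (isGradedSubspace_top V.isCompl).exists_add
      (Submodule.mem_top (x := x))
    have h : f a + f b ∈ S := by rw [← map_add]; exact hx
    have h' := hS.mem_of_add_mem (hf.map_part 0 a ha) (hf.map_part 1 b hb) h
    exact Submodule.add_mem_sup ⟨h'.1, ha⟩ ⟨h'.2, hb⟩
  act_mem a x hx := by
    rw [Submodule.mem_comap, hf.map_act]
    exact hS.act_mem a _ hx

/-- A submodule of `V ⊕ V'` that meets `0 ⊕ V'` trivially is the graph of a homomorphism, if `V`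
is simple and its projection to `V` does not vanish. -/
theorem exists_isHom_of_graph {V : SuperRep.{v} L} {V' : SuperRep.{w} L} (hV : V.IsSimple)
    (T : Submodule K (V.carrier × V'.carrier)) (hT : (V.prod V').IsSubrep T)
    (hne : ∃ p ∈ T, p.1 ≠ 0) (h0 : ∀ y, ((0 : V.carrier), y) ∈ T → y = 0) :
    ∃ F : V.carrier →ₗ[K] V'.carrier, V.IsHom V' F ∧ ∀ p ∈ T, F p.1 = p.2 := by
  have hsub := ofSubrep_isHom hT
  have hf := (prod_isHom_fst V V').comp hsub
  -- The projection of `T` to `V` is injective by `h0`, and surjective since its image is a nonzero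
  -- submodule of a simple module. `F` is the second projection composed with its inverse.
  have hbij : Function.Bijective (LinearMap.fst K V.carrier V'.carrier ∘ₗ T.subtype) := by
    constructor
    · rw [← LinearMap.ker_eq_bot, LinearMap.ker_eq_bot']
      rintro ⟨⟨x, y⟩, hxy⟩ hx
      have hx' : x = 0 := hx
      subst hx'
      have := h0 y hxy
      subst this
      rfl
    · rw [← LinearMap.range_eq_top]
      refine (hV.eq_bot_or_eq_top _ hf.isSubrep_range).resolve_left fun hb => ?_
      obtain ⟨p, hp, hp1⟩ := hne
      refine hp1 ?_
      have : p.1 ∈ LinearMap.range (LinearMap.fst K V.carrier V'.carrier ∘ₗ T.subtype) :=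
        ⟨⟨p, hp⟩, rfl⟩
      rw [hb] at this
      exact this
  let e := LinearEquiv.ofBijective _ hbij
  have he : ((V.prod V').ofSubrep T hT).IsHom V e.toLinearMap := hf
  refine ⟨(LinearMap.snd K V.carrier V'.carrier ∘ₗ T.subtype) ∘ₗ e.symm.toLinearMap,
    ((prod_isHom_snd V V').comp hsub).comp he.symm, fun p hp => ?_⟩
  have : e.symm p.1 = ⟨p, hp⟩ := by
    rw [LinearEquiv.symm_apply_eq]; rfl
  change (e.symm p.1 : T).1.2 = p.2
  rw [this]

end SuperRep

end

/-! ### Submodules generated by `𝔩`-submodules of `W^𝔲` -/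

namespace TriangularDecomposition

variable {𝔤 : Type u} [AddCommGroup 𝔤] [Module ℂ 𝔤] {L : LieSuperalgebra ℂ 𝔤}

theorem exists_add (T : L.TriangularDecomposition) (x : 𝔤) :
    ∃ a b c, a ∈ T.ubar.carrier ∧ b ∈ T.l.carrier ∧ c ∈ T.u.carrier ∧ x = a + b + c := by
  have h : T.ubar.carrier ⊔ T.l.carrier ⊔ T.u.carrier = ⊤ := by
    rw [← T.isInternal.submodule_iSup_eq_top]
    apply le_antisymm
    · exact sup_le (sup_le (le_iSup ![T.ubar.carrier, T.l.carrier, T.u.carrier] 0)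
        (le_iSup ![T.ubar.carrier, T.l.carrier, T.u.carrier] 1))
        (le_iSup ![T.ubar.carrier, T.l.carrier, T.u.carrier] 2)
    · refine iSup_le fun i => ?_
      fin_cases i
      · exact le_sup_left.trans le_sup_left
      · exact le_sup_right.trans le_sup_left
      · exact le_sup_right
  have hx : x ∈ T.ubar.carrier ⊔ T.l.carrier ⊔ T.u.carrier := by rw [h]; trivial
  obtain ⟨y, hy, c, hc, rfl⟩ := Submodule.mem_sup.1 hx
  obtain ⟨a, ha, b, hb, rfl⟩ := Submodule.mem_sup.1 hy
  exact ⟨a, b, c, ha, hb, hc, rfl⟩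

/-- An `𝔩`-submodule of `W^𝔲`, as a subspace of `W`. -/
structure IsHighestSubspace (T : L.TriangularDecomposition) (W : SuperRep.{v} L)
    (S : Submodule ℂ W.carrier) : Prop where
  graded : IsGradedSubspace W.part S
  le_invariants : S ≤ T.invariantsSubmodule W
  act_mem : ∀ x ∈ T.l.carrier, ∀ w ∈ S, W.act x w ∈ S

/-- The `ū`-stable subspace generated by `S`. -/
def lowerClosure (T : L.TriangularDecomposition) (W : SuperRep.{v} L)
    (S : Submodule ℂ W.carrier) : Submodule ℂ W.carrier :=
  sInf {M | S ≤ M ∧ ∀ x ∈ T.ubar.carrier, ∀ w ∈ M, W.act x w ∈ M}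

theorem le_lowerClosure (T : L.TriangularDecomposition) (W : SuperRep.{v} L)
    (S : Submodule ℂ W.carrier) : S ≤ T.lowerClosure W S :=
  le_sInf fun _ hM => hM.1

theorem lowerClosure_act (T : L.TriangularDecomposition) (W : SuperRep.{v} L)
    (S : Submodule ℂ W.carrier) {x : 𝔤} (hx : x ∈ T.ubar.carrier) {w : W.carrier}
    (hw : w ∈ T.lowerClosure W S) : W.act x w ∈ T.lowerClosure W S := by
  rw [lowerClosure, Submodule.mem_sInf] at hw ⊢
  exact fun M hM => hM.2 x hx w (hw M hM)

/-- Serves as the induction principle for generated subspaces. Because `ū` is graded, stability need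
only be tested on homogeneous elements, where the sign rules apply. -/
theorem lowerClosure_le (T : L.TriangularDecomposition) (W : SuperRep.{v} L)
    {S M : Submodule ℂ W.carrier} (h : S ≤ M)
    (hM : ∀ i, ∀ x ∈ T.ubar.carrier, x ∈ L.part i → ∀ w ∈ M, W.act x w ∈ M) :
    T.lowerClosure W S ≤ M := by
  refine sInf_le ⟨h, fun x hx w hw => ?_⟩
  obtain ⟨a, b, ha, hb, ha0, hb1, rfl⟩ := T.ubar.graded.exists_add hx
  rw [map_add, LinearMap.add_apply]
  exact add_mem (hM 0 a ha ha0 w hw) (hM 1 b hb hb1 w hw)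

/-- The `ū`-stable subspace generated by an `𝔩`-submodule of `W^𝔲` is a `𝔤`-submodule. -/
theorem isSubrep_lowerClosure (T : L.TriangularDecomposition) (W : SuperRep.{v} L)
    {S : Submodule ℂ W.carrier} (hS : T.IsHighestSubspace W S) :
    W.IsSubrep (T.lowerClosure W S) where
  graded := by
    -- The span of the homogeneous vectors of the closure contains `S` and is stable under
    -- homogeneous elements of `ū`, so it is the whole closure.
    refine T.lowerClosure_le W ?_ ?_
    · exact hS.graded.trans (sup_le_sup (inf_le_inf_right _ (T.le_lowerClosure W S))
        (inf_le_inf_right _ (T.le_lowerClosure W S)))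
    · intro i x hx hxi w hw
      obtain ⟨a, ha, b, hb, rfl⟩ := Submodule.mem_sup.1 hw
      have ha' := W.act_mem i 0 x a hxi ha.2
      have hb' := W.act_mem i 1 x b hxi hb.2
      have ha'' := T.lowerClosure_act W S hx ha.1
      have hb'' := T.lowerClosure_act W S hx hb.1
      rw [map_add]
      rcases zmod_two_cases i with rfl | rfl
      · exact Submodule.add_mem_sup ⟨ha'', ha'⟩ ⟨hb'', hb'⟩
      · rw [add_comm]
        exact Submodule.add_mem_sup ⟨hb'', hb'⟩ ⟨ha'', ha'⟩
  act_mem := by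
    -- `M` consists of the vectors of the closure that all of `𝔤` keeps in the closure. It contains
    -- `S` because `𝔤 = ū + 𝔩 + 𝔲` and `𝔲` kills `S`. It is `ū`-stable because `x y w = [x,y] w ± y
    -- x w`.
    let M : Submodule ℂ W.carrier :=
      { carrier := {w | w ∈ T.lowerClosure W S ∧ ∀ x, W.act x w ∈ T.lowerClosure W S}
        zero_mem' := ⟨zero_mem _, fun x => by rw [map_zero]; exact zero_mem _⟩
        add_mem' := fun hv hw => ⟨add_mem hv.1 hw.1, fun x => by
          rw [map_add]; exact add_mem (hv.2 x) (hw.2 x)⟩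
        smul_mem' := fun c w hw => ⟨Submodule.smul_mem _ c hw.1, fun x => by
          rw [map_smul]; exact Submodule.smul_mem _ c (hw.2 x)⟩ }
    have hM : T.lowerClosure W S ≤ M := by
      refine T.lowerClosure_le W ?_ ?_
      · intro w hw
        refine ⟨T.le_lowerClosure W S hw, fun x => ?_⟩
        obtain ⟨a, b, c, ha, hb, hc, rfl⟩ := T.exists_add x
        rw [map_add, map_add, LinearMap.add_apply, LinearMap.add_apply, hS.le_invariants hw c hc,
          add_zero]
        exact add_mem (T.lowerClosure_act W S ha (T.le_lowerClosure W S hw))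
          (T.le_lowerClosure W S (hS.act_mem b hb w hw))
      · intro j y hy hyj w hw
        refine ⟨T.lowerClosure_act W S hy hw.1, fun x => ?_⟩
        refine hom_induction L.isCompl (P := fun x => W.act x (W.act y w) ∈ T.lowerClosure W S)
          ?_ ?_ x
        · intro i x hx
          rw [W.act_act hx hyj]
          exact add_mem (hw.2 _) (zsmul_mem (T.lowerClosure_act W S hy (hw.2 x)) _)
        · intro x x' hx hx'
          rw [map_add, LinearMap.add_apply]
          exact add_mem hx hx'
    exact fun x w hw => (hM hw).2 x

/-- The right-hand side contains `S`. It is also contained in the closure, so `ū` maps it into its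
own second summand. -/
theorem lowerClosure_le_sup (T : L.TriangularDecomposition) (W : SuperRep.{v} L)
    (S : Submodule ℂ W.carrier) :
    T.lowerClosure W S ≤ S ⊔ Submodule.map₂ W.act T.ubar.carrier (T.lowerClosure W S) := by
  refine T.lowerClosure_le W le_sup_left fun i x hx _ w hw => ?_
  refine Submodule.mem_sup_right (Submodule.apply_mem_map₂ _ hx ?_)
  refine (sup_le (T.le_lowerClosure W S) ?_ :
    S ⊔ Submodule.map₂ W.act T.ubar.carrier (T.lowerClosure W S) ≤ T.lowerClosure W S) hw
  rw [Submodule.map₂_le]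
  exact fun y hy z hz => T.lowerClosure_act W S hy hz

/-- The extension property: homomorphisms `W^𝔲 → W'^𝔲` extend to `W → W'`. -/
def HomsExtend (T : L.TriangularDecomposition) (W : SuperRep.{v} L) (W' : SuperRep.{w} L) : Prop :=
  ∀ f : (T.invariants W).carrier →ₗ[ℂ] (T.invariants W').carrier,
    (T.invariants W).IsHom (T.invariants W') f →
    ∃ F : W.carrier →ₗ[ℂ] W'.carrier, W.IsHom W' F ∧ ∀ n : T.invariantsSubmodule W, F n = f n

/-- The subspace `ū·W`. -/
def lowered (T : L.TriangularDecomposition) (W : SuperRep.{v} L) : Submodule ℂ W.carrier :=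
  Submodule.map₂ W.act T.ubar.carrier ⊤

/-! ### Irreducibility of `W^𝔲` and extension of homomorphisms when `ū·W ≠ W` -/

section Simple

variable {T : L.TriangularDecomposition} {W : SuperRep.{v} L}

theorem isHighestSubspace_map {S : Submodule ℂ (T.invariants W).carrier}
    (hS : (T.invariants W).IsSubrep S) :
    T.IsHighestSubspace W (S.map (T.invariantsSubmodule W).subtype) where
  graded := by
    rintro _ ⟨x, hx, rfl⟩
    obtain ⟨a, b, ha, hb, ha0, hb1, rfl⟩ := hS.graded.exists_add hx
    rw [map_add]
    exact Submodule.add_mem_sup ⟨⟨a, ha, rfl⟩, ha0⟩ ⟨⟨b, hb, rfl⟩, hb1⟩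
  le_invariants := Submodule.map_subtype_le _ _
  act_mem := by
    rintro x hx _ ⟨w, hw, rfl⟩
    exact ⟨_, hS.act_mem ⟨x, hx⟩ w hw, rfl⟩

/-- The submodule generated by `S` is nonzero, hence all of `W`, and by `lowerClosure_le_sup` it
consists of vectors of `S` modulo `ū·W`. -/
theorem IsHighestSubspace.sup_lowered (hW : W.IsSimple) {S : Submodule ℂ W.carrier}
    (hS : T.IsHighestSubspace W S) (h0 : S ≠ ⊥) : S ⊔ T.lowered W = ⊤ := by
  have h := (hW.eq_bot_or_eq_top _ (T.isSubrep_lowerClosure W hS)).resolve_left fun h =>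
    h0 (le_bot_iff.1 (h ▸ T.le_lowerClosure W S))
  have := T.lowerClosure_le_sup W S
  rw [h] at this
  exact top_le_iff.1 this

theorem act_lowered_mem {x : 𝔤} (hx : x ∈ T.l.carrier) {w : W.carrier} (hw : w ∈ T.lowered W) :
    W.act x w ∈ T.lowered W := by
  refine (show T.lowered W ≤ (T.lowered W).comap (W.act x) from ?_) hw
  rw [lowered, Submodule.map₂_le]
  intro y hy w _
  rw [Submodule.mem_comap]
  obtain ⟨x0, x1, hx0, hx1, hx0', hx1', rfl⟩ := T.l.graded.exists_add hx
  obtain ⟨y0, y1, hy0, hy1, hy0', hy1', rfl⟩ := T.ubar.graded.exists_add hy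
  have key : ∀ i j, ∀ x ∈ T.l.carrier, ∀ y ∈ T.ubar.carrier, x ∈ L.part i → y ∈ L.part j →
      W.act x (W.act y w) ∈ Submodule.map₂ W.act T.ubar.carrier ⊤ := by
    intro i j x hx y hy hxi hyj
    rw [W.act_act hxi hyj]
    exact add_mem (Submodule.apply_mem_map₂ _ (T.bracket_l_ubar x y hx hy) trivial)
      (zsmul_mem (Submodule.apply_mem_map₂ _ hy (Submodule.mem_top (x := W.act x w))) _)
  simp only [map_add, LinearMap.add_apply]
  exact add_mem
    (add_mem (key 0 0 _ hx0 _ hy0 hx0' hy0') (key 1 0 _ hx1 _ hy0 hx1' hy0'))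
    (add_mem (key 0 1 _ hx0 _ hy1 hx0' hy1') (key 1 1 _ hx1 _ hy1 hx1' hy1'))

theorem lowered_graded : IsGradedSubspace W.part (T.lowered W) := by
  have key : ∀ i j, ∀ y ∈ T.ubar.carrier, y ∈ L.part i → ∀ w ∈ W.part j,
      W.act y w ∈ (T.lowered W ⊓ W.part 0) ⊔ (T.lowered W ⊓ W.part 1) := by
    intro i j y hy hyi w hw
    have h1 : W.act y w ∈ T.lowered W := Submodule.apply_mem_map₂ _ hy Submodule.mem_top
    have h2 := W.act_mem i j y w hyi hw
    rcases zmod_two_cases (i + j) with h | h <;> rw [h] at h2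
    · exact Submodule.mem_sup_left ⟨h1, h2⟩
    · exact Submodule.mem_sup_right ⟨h1, h2⟩
  unfold IsGradedSubspace
  conv_lhs => rw [lowered]
  rw [Submodule.map₂_le]
  intro y hy w _
  obtain ⟨y0, y1, hy0, hy1, hy0', hy1', rfl⟩ := T.ubar.graded.exists_add hy
  refine hom_induction W.isCompl (P := fun w => W.act (y0 + y1) w ∈ _) ?_ ?_ w
  · intro j w hw
    rw [map_add, LinearMap.add_apply]
    exact add_mem (key 0 j y0 hy0 hy0' w hw) (key 1 j y1 hy1 hy1' w hw)
  · intro w w' hw hw'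
    rw [map_add]
    exact add_mem hw hw'

theorem isHighestSubspace_inf_lowered :
    T.IsHighestSubspace W (T.invariantsSubmodule W ⊓ T.lowered W) where
  graded := by
    rintro w ⟨h1, h2⟩
    obtain ⟨a, b, ha, hb, ha0, hb1, rfl⟩ := (T.invariantsSubmodule_graded W).exists_add h1
    obtain ⟨a', b', ha', hb', ha0', hb1', h⟩ := (lowered_graded (T := T)).exists_add h2
    have h3 : a - a' = b' - b := by rw [sub_eq_sub_iff_add_eq_add, h, add_comm]
    have h4 : a - a' = 0 := Submodule.disjoint_def.1 W.isCompl.disjoint _ (sub_mem ha0 ha0')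
      (h3 ▸ sub_mem hb1' hb1)
    have h5 : b' - b = 0 := h3 ▸ h4
    rw [sub_eq_zero] at h4 h5
    subst h4 h5
    exact Submodule.add_mem_sup ⟨⟨ha, ha'⟩, ha0⟩ ⟨⟨hb, hb'⟩, hb1⟩
  le_invariants := inf_le_left
  act_mem x hx w hw := ⟨T.invariantsSubmodule_act W x hx w hw.1, act_lowered_mem hx hw.2⟩

/-- The intersection is itself an `𝔩`-submodule of `W^𝔲`. If it were nonzero, `sup_lowered` would
give `W = (W^𝔲 ∩ ū·W) + ū·W = ū·W`. -/
theorem disjoint_lowered (hW : W.IsSimple) (h : T.lowered W ≠ ⊤) :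
    Disjoint (T.invariantsSubmodule W) (T.lowered W) := by
  rw [disjoint_iff]
  by_contra h0
  have := isHighestSubspace_inf_lowered.sup_lowered hW h0
  rw [sup_eq_right.2 inf_le_right] at this
  exact h this

/-- A nonzero `𝔩`-submodule `S` of `W^𝔲` satisfies `S + ū·W = W`, while `W^𝔲` meets `ū·W` only in
zero. Hence `S` is already all of `W^𝔲`. -/
theorem isIrr_invariants (hW : W.IsIrr) (h0 : T.invariantsSubmodule W ≠ ⊥)
    (h : T.lowered W ≠ ⊤) : (T.invariants W).IsIrr where
  finite := by
    have := hW.finite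
    exact FiniteDimensional.finiteDimensional_submodule _
  simple := by
    refine ⟨Submodule.nontrivial_iff_ne_bot.2 h0, fun S hS => ?_⟩
    by_cases hS0 : S = ⊥
    · exact Or.inl hS0
    right
    have hne : S.map (T.invariantsSubmodule W).subtype ≠ ⊥ := fun hb => hS0 <|
      Submodule.map_injective_of_injective (Submodule.injective_subtype _)
        (by rw [hb, Submodule.map_bot])
    have hsup := (isHighestSubspace_map hS).sup_lowered hW.simple hne
    rw [eq_top_iff]
    rintro w -
    have hw : (w : W.carrier) ∈ S.map (T.invariantsSubmodule W).subtype ⊔ T.lowered W := by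
      rw [hsup]; trivial
    obtain ⟨_, ⟨s, hs, rfl⟩, z, hz, hsz⟩ := Submodule.mem_sup.1 hw
    have hz' : z = ((w - s : T.invariantsSubmodule W) : W.carrier) := by
      rw [Submodule.coe_sub, ← hsz]; simp
    have hz0 : z = 0 := Submodule.disjoint_def.1 (disjoint_lowered hW.simple h) z
      (by rw [hz']; exact Subtype.property _) hz
    rw [hz0, add_zero] at hsz
    exact (Subtype.ext hsz : s = w) ▸ hs

/-- The graph of `f` is an `𝔩`-submodule of `(W ⊕ W')^𝔲`, and the `𝔤`-submodule it generates is the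
graph of the extension. The only obstruction would be that this submodule contains `0 ⊕ W'`, since
`W'` is simple. -/
theorem homsExtend_of_lowered_ne_top {W' : SuperRep.{w} L} (hW : W.IsSimple) (hW' : W'.IsSimple)
    (h0 : T.invariantsSubmodule W ≠ ⊥) (h0' : T.invariantsSubmodule W' ≠ ⊥)
    (h : T.lowered W ≠ ⊤) (h' : T.lowered W' ≠ ⊤) : T.HomsExtend W W' := by
  intro f hf
  let g : (T.invariants W).carrier →ₗ[ℂ] W.carrier × W'.carrier :=
    (T.invariantsSubmodule W).subtype.prod ((T.invariantsSubmodule W').subtype ∘ₗ f)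
  have hS : T.IsHighestSubspace (W.prod W') (LinearMap.range g) := by
    refine ⟨?_, ?_, ?_⟩
    · rintro _ ⟨n, rfl⟩
      obtain ⟨a, b, -, -, ha, hb, rfl⟩ := (isGradedSubspace_top (T.invariants W).isCompl).exists_add
        (Submodule.mem_top (x := n))
      rw [map_add]
      exact Submodule.add_mem_sup ⟨⟨a, rfl⟩, ha, hf.map_part 0 a ha⟩
        ⟨⟨b, rfl⟩, hb, hf.map_part 1 b hb⟩
    · rintro _ ⟨n, rfl⟩ x hx
      exact Prod.ext (n.2 x hx) ((f n).2 x hx)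
    · rintro x hx _ ⟨n, rfl⟩
      exact ⟨(T.invariants W).act ⟨x, hx⟩ n,
        Prod.ext rfl (congrArg Subtype.val (hf.map_act ⟨x, hx⟩ n))⟩
  have hT := T.isSubrep_lowerClosure (W.prod W') hS
  have hle := T.le_lowerClosure (W.prod W') (LinearMap.range g)
  obtain ⟨n, hn, hn0⟩ := (Submodule.ne_bot_iff _).1 h0
  obtain ⟨n', hn', hn0'⟩ := (Submodule.ne_bot_iff _).1 h0'
  have hinr : W'.IsHom (W.prod W') (LinearMap.inr ℂ W.carrier W'.carrier) :=
    ⟨fun i x hx => ⟨zero_mem _, hx⟩, fun a x => Prod.ext (map_zero _).symm rfl⟩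
  obtain ⟨F, hF, hFT⟩ := SuperRep.exists_isHom_of_graph hW _ hT ⟨_, hle ⟨⟨n, hn⟩, rfl⟩, hn0⟩ (by
    rcases hW'.eq_bot_or_eq_top _ (hT.comap hinr) with hb | ht
    · intro y hy
      have : y ∈ (T.lowerClosure (W.prod W') (LinearMap.range g)).comap
        (LinearMap.inr ℂ W.carrier W'.carrier) := hy
      rw [hb] at this
      exact this
    · exfalso
      have hmem : ((0 : W.carrier), n') ∈ T.lowerClosure (W.prod W') (LinearMap.range g) := by
        have : n' ∈ (T.lowerClosure (W.prod W') (LinearMap.range g)).comap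
          (LinearMap.inr ℂ W.carrier W'.carrier) := by rw [ht]; trivial
        exact this
      -- Write `(0, n') = (m, f m) + z` with `z` in `ū·W ⊕ ū·W'`. The first coordinate puts `m` in
      -- `W^𝔲 ∩ ū·W = 0`. Then `n'` lies in `W'^𝔲 ∩ ū·W' = 0`, a contradiction.
      obtain ⟨_, ⟨m, rfl⟩, z, hz, hmz⟩ := Submodule.mem_sup.1
        (T.lowerClosure_le_sup (W.prod W') _ hmem)
      have hz' : z ∈ (T.lowered W).prod (T.lowered W') := by
        refine (?_ : Submodule.map₂ (W.prod W').act T.ubar.carrier _ ≤ _) hz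
        rw [Submodule.map₂_le]
        exact fun x hx w _ => ⟨Submodule.apply_mem_map₂ _ hx trivial,
          Submodule.apply_mem_map₂ _ hx trivial⟩
      have h1 : (m : W.carrier) + z.1 = 0 := congrArg Prod.fst hmz
      have h2 : (f m : W'.carrier) + z.2 = n' := congrArg Prod.snd hmz
      have hm : (m : W.carrier) = 0 := by
        refine Submodule.disjoint_def.1 (disjoint_lowered hW h) _ m.2 ?_
        rw [eq_neg_of_add_eq_zero_left h1]
        exact neg_mem hz'.1
      have hm' : m = 0 := Subtype.ext hm
      rw [hm', map_zero, Submodule.coe_zero, zero_add] at h2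
      exact hn0' (Submodule.disjoint_def.1 (disjoint_lowered hW' h') _ hn' (h2 ▸ hz'.2)))
  exact ⟨F, hF, fun n => hFT _ (hle ⟨n, rfl⟩)⟩

end Simple

end TriangularDecomposition

end LieSuperalgebra
-- The universal property of the induced module, and extension under the first criterion
open scoped TensorProduct

namespace LieSuperalgebra

namespace SuperRep

section

variable {K : Type*} {𝔤 : Type*} [Field K] [AddCommGroup 𝔤] [Module K 𝔤] {L : LieSuperalgebra K 𝔤}

/-- The action of the universal enveloping algebra. -/
noncomputable def envAct (V : SuperRep.{v} L) : L.Env →ₐ[K] Module.End K V.carrier :=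
  L.envLift V.act fun i j x y hx hy => by
    apply LinearMap.ext
    intro w
    have h := V.act_act hx hy w
    rw [add_comm] at h
    simpa using h

theorem envAct_ι (V : SuperRep.{v} L) (x : 𝔤) : V.envAct (L.envι x) = V.act x :=
  L.envLift_ι _ _ x

theorem parity_act (V : SuperRep.{v} L) (x : 𝔤) (w : V.carrier) :
    parity V.part V.isCompl (V.act x w) =
      V.act (parity L.part L.isCompl x) (parity V.part V.isCompl w) := by
  refine hom_induction L.isCompl (P := fun x => parity V.part V.isCompl (V.act x w) =
      V.act (parity L.part L.isCompl x) (parity V.part V.isCompl w)) ?_ ?_ x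
  · intro i x hx
    refine hom_induction V.isCompl (P := fun w => parity V.part V.isCompl (V.act x w) =
      V.act (parity L.part L.isCompl x) (parity V.part V.isCompl w)) ?_ ?_ w
    · intro j w hw
      rw [parity_of_mem V.isCompl hw, parity_of_mem V.isCompl (V.act_mem i j x w hx hw),
        parity_of_mem L.isCompl hx, map_zsmul, map_zsmul, LinearMap.smul_apply, smul_smul,
        sgn_add, mul_comm]
    · intro w w' hw hw'
      simp only [map_add, hw, hw']
  · intro x x' hx hx'
    simp only [map_add, LinearMap.add_apply, hx, hx']

theorem parity_envAct (V : SuperRep.{v} L) (a : L.Env) (w : V.carrier) :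
    parity V.part V.isCompl (V.envAct a w) =
      V.envAct (L.envParity a) (parity V.part V.isCompl w) := by
  let P := parity V.part V.isCompl
  -- The action conjugated by the parity involution `P` is again an algebra homomorphism. It is
  -- therefore compared with `V.envAct ∘ L.envParity` on the generators `L.envι x` only.
  let f : L.Env →ₐ[K] Module.End K V.carrier :=
    AlgHom.ofLinearMap
      ((LinearMap.mulLeft K (P : Module.End K V.carrier)) ∘ₗ
        (LinearMap.mulRight K (P : Module.End K V.carrier)) ∘ₗ V.envAct.toLinearMap)
      (by ext w; simp [P, parity_parity])
      (by intro a b; ext w; simp [P, parity_parity])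
  have h : f = V.envAct.comp L.envParity := by
    refine env_hom_ext fun x => LinearMap.ext fun w => ?_
    change P (V.envAct (L.envι x) (P w)) = V.envAct (L.envParity (L.envι x)) w
    rw [envAct_ι, parity_act, parity_parity, envParity_ι, envAct_ι]
  have h2 := LinearMap.congr_fun (AlgHom.congr_fun h a) (P w)
  change P (V.envAct a (P (P w))) = _ at h2
  rw [show P (P w) = w from parity_parity _ _] at h2
  exact h2

end

end SuperRep

namespace TriangularDecomposition

variable {𝔤 : Type u} [AddCommGroup 𝔤] [Module ℂ 𝔤] {L : LieSuperalgebra ℂ 𝔤}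
  {T : L.TriangularDecomposition} {N : SuperRep.{v} T.l.toLie} {W : SuperRep.{w} L}

/-- The homomorphism `Ind N → W` that extends a homomorphism `N → W^𝔲`. -/
noncomputable def indLift (f : N.carrier →ₗ[ℂ] (T.invariants W).carrier)
    (hf : N.IsHom (T.invariants W) f) : (T.ind N).carrier →ₗ[ℂ] W.carrier :=
  (T.indKer N).liftQ
    (TensorProduct.lift
      (LinearMap.lcomp ℂ W.carrier ((T.invariantsSubmodule W).subtype ∘ₗ f) ∘ₗ
        W.envAct.toLinearMap)) (by
    rw [indKer, Submodule.span_le]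
    rintro _ (⟨a, y, n, rfl⟩ | ⟨a, y, n, hy, rfl⟩)
    · have h : (f (N.act y n) : W.carrier) = W.act y (f n) := congrArg Subtype.val (hf.map_act y n)
      simp [SuperRep.envAct_ι, h]
    · have h : W.act y (f n) = 0 := (f n).2 y hy
      simp [SuperRep.envAct_ι, h])

theorem indLift_mk (f : N.carrier →ₗ[ℂ] (T.invariants W).carrier)
    (hf : N.IsHom (T.invariants W) f) (a : L.Env) (n : N.carrier) :
    indLift f hf ((T.indKer N).mkQ (a ⊗ₜ n)) = W.envAct a (f n) := rfl

theorem isHom_indLift (f : N.carrier →ₗ[ℂ] (T.invariants W).carrier)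
    (hf : N.IsHom (T.invariants W) f) : (T.ind N).IsHom W (indLift f hf) where
  map_part i x hx := by
    have hx' : T.indParity N x = sgn i • x := hx
    -- The grading of `T.ind N` is defined by the eigenspaces of `indParity`, so preserving parity
    -- means intertwining the two parity involutions.
    refine mem_of_parity W.isCompl ?_
    have hfp : ∀ n, parity W.part W.isCompl (f n) = f (parity N.part N.isCompl n) := by
      refine hom_induction N.isCompl ?_ ?_
      · intro j n hn
        have h1 : (f n : W.carrier) ∈ W.part j := hf.map_part j n hn
        rw [parity_of_mem N.isCompl hn, parity_of_mem W.isCompl h1, map_zsmul]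
        rfl
      · intro n n' hn hn'
        simp only [map_add, Submodule.coe_add, hn, hn']
    have key : ∀ x, parity W.part W.isCompl (indLift f hf x) =
        indLift f hf (T.indParity N x) := by
      refine T.ind_induction N ?_ ?_
      · intro a n
        rw [indParity_mk, indLift_mk, indLift_mk, SuperRep.parity_envAct, hfp]
      · intro x y hx hy
        have h1 := congrArg (parity W.part W.isCompl) (map_add (indLift f hf) x y)
        have h2 := congrArg (indLift f hf) (map_add (T.indParity N) x y)
        refine h1.trans ((map_add _ _ _).trans ((congrArg₂ (· + ·) hx hy).trans ?_))
        exact (h2.trans (map_add (indLift f hf) _ _)).symm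
    rw [key, hx']
    exact map_zsmul (indLift f hf) _ _
  map_act x w := by
    refine T.ind_induction N (P := fun w => indLift f hf ((T.ind N).act x w) =
      W.act x (indLift f hf w)) ?_ ?_ w
    · intro a n
      change indLift f hf ((T.indKer N).mkQ ((L.envι x * a) ⊗ₜ n)) = _
      rw [indLift_mk, indLift_mk, map_mul, SuperRep.envAct_ι]
      rfl
    · intro v w hv hw
      have h1 := congrArg (indLift f hf) (map_add ((T.ind N).act x) v w)
      have h2 := congrArg (W.act x) (map_add (indLift f hf) v w)
      refine h1.trans ((map_add _ _ _).trans ((congrArg₂ (· + ·) hv hw).trans ?_))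
      exact (h2.trans (map_add (W.act x) _ _)).symm

/-- The image in the simple module `V'` of a submodule containing the kernel is `0` or `V'`. Such a
submodule is therefore the kernel or everything. -/
theorem _root_.LieSuperalgebra.SuperRep.IsHom.maximal_ker {K : Type*} {𝔤 : Type*} [Field K]
    [AddCommGroup 𝔤] [Module K 𝔤] {L : LieSuperalgebra K 𝔤} {V : SuperRep.{v} L}
    {V' : SuperRep.{w} L} {f : V.carrier →ₗ[K] V'.carrier} (hf : V.IsHom V' f)
    (hV' : V'.IsSimple) (h : f ≠ 0) :
    Maximal (fun S => V.IsSubrep S ∧ S ≠ ⊤) (LinearMap.ker f) := by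
  refine ⟨⟨hf.isSubrep_ker, fun ht => h (LinearMap.ker_eq_top.1 ht)⟩, ?_⟩
  rintro S ⟨hS, hS1⟩ hle
  have hmap : V'.IsSubrep (S.map f) := by
    constructor
    · rintro _ ⟨x, hx, rfl⟩
      obtain ⟨a, b, ha, hb, ha0, hb1, rfl⟩ := hS.graded.exists_add hx
      rw [map_add]
      exact Submodule.add_mem_sup ⟨⟨a, ha, rfl⟩, hf.map_part 0 a ha0⟩
        ⟨⟨b, hb, rfl⟩, hf.map_part 1 b hb1⟩
    · rintro x _ ⟨w, hw, rfl⟩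
      exact ⟨_, hS.act_mem x w hw, hf.map_act x w⟩
  rcases hV'.eq_bot_or_eq_top _ hmap with hb | ht
  · intro x hx
    have : f x ∈ S.map f := ⟨x, hx, rfl⟩
    rw [hb] at this
    exact this
  · refine absurd ?_ hS1
    rw [eq_top_iff]
    intro x _
    have : f x ∈ S.map f := by rw [ht]; trivial
    obtain ⟨y, hy, hxy⟩ := this
    have h2 : x - y ∈ S := hle (by rw [LinearMap.mem_ker, map_sub, hxy, sub_self])
    exact (sub_add_cancel x y) ▸ add_mem h2 hy

/-- The inclusion of `W^𝔲` and the map `f` induce nonzero homomorphisms `p` and `q` from `Ind W^𝔲`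
to the simple modules `W` and `W'`. Their kernels are maximal, hence equal. So `p t = 0` forces `q t
= 0`, and the image of `(p, q)` is the graph of the extension. -/
theorem homsExtend_of_hasUniqueMaximalSubrep {W W' : SuperRep.{v} L} (hW : W.IsSimple)
    (hW' : W'.IsSimple) (h0 : Nontrivial (T.invariants W).carrier)
    (h : (T.ind (T.invariants W)).HasUniqueMaximalSubrep) : T.HomsExtend W W' := by
  intro f hf
  -- If `f = 0` then `q = 0`, whose kernel is not proper, so this case is separate.
  by_cases hf0 : f = 0
  · refine ⟨0, ⟨fun i x _ => zero_mem _, fun a x => (map_zero _).symm⟩, fun n => ?_⟩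
    rw [hf0]; rfl
  have hid : (T.invariants W).IsHom (T.invariants W) LinearMap.id := ⟨fun _ _ h => h, fun _ _ => rfl⟩
  have hp := isHom_indLift LinearMap.id hid
  have hq := isHom_indLift f hf
  have hp1 : ∀ n : (T.invariants W).carrier,
      indLift LinearMap.id hid ((T.indKer (T.invariants W)).mkQ (1 ⊗ₜ n)) = n := fun n => by
    rw [indLift_mk, map_one]; rfl
  have hq1 : ∀ n : (T.invariants W).carrier,
      indLift f hf ((T.indKer (T.invariants W)).mkQ (1 ⊗ₜ n)) = f n := fun n => by
    rw [indLift_mk, map_one]; rfl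
  obtain ⟨n, hn⟩ := exists_ne (0 : (T.invariants W).carrier)
  have hn' : (n : W.carrier) ≠ 0 := fun h => hn (Subtype.ext h)
  have hp0 : indLift LinearMap.id hid ≠ 0 := fun h0 => hn' (by
    rw [← hp1, h0]; rfl)
  have hq0 : indLift f hf ≠ 0 := fun h0 => hf0 (LinearMap.ext fun n => Subtype.ext (by
    rw [← hq1, h0]; rfl))
  have hker := h.unique (hp.maximal_ker hW hp0) (hq.maximal_ker hW' hq0)
  have hr : (T.ind (T.invariants W)).IsHom (W.prod W')
      ((indLift LinearMap.id hid).prod (indLift f hf)) :=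
    ⟨fun i x hx => ⟨hp.map_part i x hx, hq.map_part i x hx⟩,
      fun a x => Prod.ext (hp.map_act a x) (hq.map_act a x)⟩
  obtain ⟨F, hF, hFT⟩ := SuperRep.exists_isHom_of_graph hW _ hr.isSubrep_range
    ⟨_, ⟨(T.indKer (T.invariants W)).mkQ (1 ⊗ₜ n), rfl⟩, by
      change indLift LinearMap.id hid _ ≠ 0
      rw [hp1]; exact hn'⟩ (by
    rintro y ⟨t, ht⟩
    have h1 : indLift LinearMap.id hid t = 0 := congrArg Prod.fst ht
    have h2 : indLift f hf t = y := congrArg Prod.snd ht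
    have h3 : t ∈ LinearMap.ker (indLift f hf) := by rw [← hker]; exact h1
    rw [← h2]; exact h3)
  refine ⟨F, hF, fun n => ?_⟩
  have := hFT _ ⟨(T.indKer (T.invariants W)).mkQ (1 ⊗ₜ n), rfl⟩
  change F (indLift LinearMap.id hid _) = indLift f hf _ at this
  rw [hp1, hq1] at this
  exact this

end TriangularDecomposition

end LieSuperalgebra

/-! ### Parity shifts, and comparison of endotypes along an injection -/

namespace LieSuperalgebra

namespace SuperRep

section

variable {K : Type*} {𝔤 : Type*} [Field K] [AddCommGroup 𝔤] [Module K 𝔤] {L : LieSuperalgebra K 𝔤}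

/-- The module `V` with parities shifted by `i`, so that `homPart i` consists of the
homomorphisms `V → V.shift i`. -/
abbrev shift (V : SuperRep.{v} L) (i : ZMod 2) : SuperRep.{v} L where
  carrier := V.carrier
  part j := V.part (j + i)
  isCompl := by
    rcases zmod_two_cases i with rfl | rfl
    · exact V.isCompl
    · exact V.isCompl.symm
  act := V.act
  act_mem j k a x ha hx := by
    have := V.act_mem j (k + i) a x ha hx
    rwa [← add_assoc] at this
  act_bracket := V.act_bracket

theorem isSimple_shift {V : SuperRep.{v} L} (h : V.IsSimple) (i : ZMod 2) :
    (V.shift i).IsSimple where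
  nontrivial := h.nontrivial
  eq_bot_or_eq_top S hS := h.eq_bot_or_eq_top S ⟨by
    intro x hx
    have h1 := hS.graded hx
    rcases zmod_two_cases i with rfl | rfl
    · exact h1
    · rw [sup_comm]; exact h1, hS.act_mem⟩

theorem mem_homPart_iff {V : SuperRep.{v} L} {i : ZMod 2} {T : Module.End K V.carrier} :
    T ∈ V.homPart i ↔ V.IsHom (V.shift i) T :=
  ⟨fun h => ⟨h.1, h.2⟩, fun h => ⟨h.1, h.2⟩⟩

theorem IsHom.shift {V : SuperRep.{v} L} {V' : SuperRep.{w} L} {f : V.carrier →ₗ[K] V'.carrier}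
    (hf : V.IsHom V' f) (i : ZMod 2) : (V.shift i).IsHom (V'.shift i) f :=
  ⟨fun j => hf.map_part (j + i), hf.map_act⟩

/-- A homomorphism from a simple module that vanishes somewhere vanishes. -/
theorem IsHom.eq_zero {V : SuperRep.{v} L} {V' : SuperRep.{w} L} {f : V.carrier →ₗ[K] V'.carrier}
    (hf : V.IsHom V' f) (hV : V.IsSimple) {x : V.carrier} (hx : x ≠ 0) (h : f x = 0) : f = 0 := by
  rcases hV.eq_bot_or_eq_top _ hf.isSubrep_ker with hb | ht
  · exact absurd (by rw [← Submodule.mem_bot K, ← hb]; exact h) hx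
  · exact LinearMap.ker_eq_top.1 ht

/-- Both summands are graded, so splitting along `S ⊕ S'` is compatible with splitting into even and
odd parts. -/
theorem projection_mem_homPart {V : SuperRep.{v} L} {S S' : Submodule K V.carrier}
    (hS : V.IsSubrep S) (hS' : V.IsSubrep S') (h : IsCompl S S') :
    S.projection S' h ∈ V.homPart 0 := by
  have hp : ∀ s ∈ S, ∀ s' ∈ S', S.projection S' h (s + s') = s := by
    intro s hs s' hs'
    rw [map_add, Submodule.projection_apply_left _ ⟨s, hs⟩]
    simp [Submodule.projection_apply_of_mem_right, hs']
  have hd : ∀ x, ∃ s ∈ S, ∃ s' ∈ S', s + s' = x := fun x =>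
    Submodule.mem_sup.1 (by rw [h.sup_eq_top]; trivial)
  rw [mem_homPart_zero]
  refine ⟨fun i x hx => ?_, fun a x => ?_⟩
  · obtain ⟨s, hs, s', hs', rfl⟩ := hd x
    rw [hp s hs s' hs']
    obtain ⟨a, b, ha, hb, ha0, hb1, rfl⟩ := hS.graded.exists_add hs
    obtain ⟨a', b', ha', hb', ha0', hb1', rfl⟩ := hS'.graded.exists_add hs'
    rw [add_add_add_comm] at hx
    rcases zmod_two_cases i with rfl | rfl
    · have h1 : b + b' ∈ V.part 0 := (Submodule.add_mem_iff_right _ (add_mem ha0 ha0')).1 hx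
      have h2 : b + b' = 0 := Submodule.disjoint_def.1 V.isCompl.disjoint _ h1 (add_mem hb1 hb1')
      have h3 : b = 0 := Submodule.disjoint_def.1 h.disjoint _ hb
        (by rw [eq_neg_of_add_eq_zero_left h2]; exact neg_mem hb')
      rw [h3, add_zero]; exact ha0
    · have h1 : a + a' ∈ V.part 1 := (Submodule.add_mem_iff_left _ (add_mem hb1 hb1')).1 hx
      have h2 : a + a' = 0 := Submodule.disjoint_def.1 V.isCompl.disjoint _ (add_mem ha0 ha0') h1
      have h3 : a = 0 := Submodule.disjoint_def.1 h.disjoint _ ha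
        (by rw [eq_neg_of_add_eq_zero_left h2]; exact neg_mem ha')
      rw [h3, zero_add]; exact hb1
  · obtain ⟨s, hs, s', hs', rfl⟩ := hd x
    rw [hp s hs s' hs', map_add, hp _ (hS.act_mem a s hs) _ (hS'.act_mem a s' hs')]

end

section

variable {𝔤 : Type*} [AddCommGroup 𝔤] [Module ℝ 𝔤] {L : LieSuperalgebra ℝ 𝔤}
  {𝔤' : Type*} [AddCommGroup 𝔤'] [Module ℝ 𝔤'] {L' : LieSuperalgebra ℝ 𝔤'}

/-- Two simple modules have the same endotype if they are related by a linear injection along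
which homogeneous endomorphisms extend uniquely and restrict. -/
theorem realEType_eq_of_extend {V : SuperRep.{v} L} {V' : SuperRep.{v} L'} (hV : V.IsIrr)
    (hV' : V'.IsIrr) (j : V'.carrier →ₗ[ℝ] V.carrier) (hj : Function.Injective j)
    (hpart : ∀ i x, x ∈ V'.part i → j x ∈ V.part i)
    (hext : ∀ i, ∀ f ∈ V'.homPart i, ∃ F ∈ V.homPart i, ∀ x, F (j x) = j (f x))
    (hres : ∀ i, ∀ F ∈ V.homPart i, ∃ f ∈ V'.homPart i, ∀ x, F (j x) = j (f x))
    (huniq : ∀ i, ∀ F ∈ V.homPart i, (∀ x, F (j x) = 0) → F = 0) :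
    V.realEType hV = V'.realEType hV' := by
  have hres' : ∀ F : V.enrichedEnd, ∃ f : V'.enrichedEnd,
      ∀ x, (F : Module.End ℝ V.carrier) (j x) = j ((f : Module.End ℝ V'.carrier) x) := by
    rintro ⟨F, hF⟩
    obtain ⟨a, ha, b, hb, rfl⟩ := Submodule.mem_sup.1 (show F ∈ V.homPart 0 ⊔ V.homPart 1 from hF)
    obtain ⟨f, hf, hfa⟩ := hres 0 a ha
    obtain ⟨g, hg, hgb⟩ := hres 1 b hb
    exact ⟨⟨f + g, Submodule.add_mem_sup hf hg⟩, fun x => by simp [hfa, hgb]⟩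
  -- Uniqueness is assumed for homogeneous endomorphisms only. For `F = a + b` with `a` even and `b`
  -- odd, and `x` homogeneous, `a (j x)` and `b (j x)` have opposite parities, so both vanish when
  -- their sum does.
  have huniq' : ∀ F ∈ V.enrichedEnd, (∀ x, F (j x) = 0) → F = 0 := by
    intro F hF h
    obtain ⟨a, ha, b, hb, rfl⟩ := Submodule.mem_sup.1 (show F ∈ V.homPart 0 ⊔ V.homPart 1 from hF)
    have key : ∀ x, a (j x) = 0 ∧ b (j x) = 0 := by
      refine hom_induction V'.isCompl ?_ ?_
      · intro i x hx
        have h1 : a (j x) ∈ V.part i := by simpa using ha.1 i _ (hpart i x hx)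
        have h2 : b (j x) ∈ V.part (i + 1) := hb.1 i _ (hpart i x hx)
        have h3 : a (j x) + b (j x) = 0 := h x
        have h4 : a (j x) = 0 := eq_zero_of_mem V.isCompl h1 (by
          rw [eq_neg_of_add_eq_zero_left h3]; exact neg_mem h2)
        exact ⟨h4, by rwa [h4, zero_add] at h3⟩
      · intro x y hx hy
        simp [hx.1, hx.2, hy.1, hy.2]
    rw [huniq 0 a ha fun x => (key x).1, huniq 1 b hb fun x => (key x).2, add_zero]
  have hext' : ∀ f : V'.enrichedEnd, ∃ F : V.enrichedEnd,
      ∀ x, (F : Module.End ℝ V.carrier) (j x) = j ((f : Module.End ℝ V'.carrier) x) := by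
    rintro ⟨F, hF⟩
    obtain ⟨a, ha, b, hb, rfl⟩ := Submodule.mem_sup.1
      (show F ∈ V'.homPart 0 ⊔ V'.homPart 1 from hF)
    obtain ⟨f, hf, hfa⟩ := hext 0 a ha
    obtain ⟨g, hg, hgb⟩ := hext 1 b hb
    exact ⟨⟨f + g, Submodule.add_mem_sup hf hg⟩, fun x => by simp [hfa, hgb]⟩
  choose φ hφ using hres'
  -- Restrictions along the injective map `j` are unique, which makes `φ` an algebra homomorphism
  -- formally.
  have hφu : ∀ (F : V.enrichedEnd) (f : V'.enrichedEnd), (∀ x, (F : Module.End ℝ V.carrier) (j x) =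
      j ((f : Module.End ℝ V'.carrier) x)) → φ F = f := fun F f h =>
    Subtype.ext (LinearMap.ext fun x => hj (by rw [← hφ, h]))
  let Φ : V.enrichedEnd →ₐ[ℝ] V'.enrichedEnd :=
    { toFun := φ
      map_one' := hφu _ _ fun x => rfl
      map_mul' := fun F G => hφu _ _ fun x => by
        change (F : Module.End ℝ V.carrier) ((G : Module.End ℝ V.carrier) (j x)) =
          j ((φ F : Module.End ℝ V'.carrier) ((φ G : Module.End ℝ V'.carrier) x))
        rw [hφ, hφ]
      map_zero' := hφu _ _ fun x => (map_zero j).symm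
      map_add' := fun F G => hφu _ _ fun x => by simp [hφ]
      commutes' := fun c => hφu _ _ fun x => by simp [Algebra.algebraMap_eq_smul_one] }
  have hbij : Function.Bijective Φ := by
    constructor
    · intro F G h
      have h' : φ F = φ G := h
      have := huniq' (F - G : V.enrichedEnd) (Subtype.property _) fun x => by
        simp [hφ, h']
      exact sub_eq_zero.1 (Subtype.ext this)
    · intro f
      obtain ⟨F, hF⟩ := hext' f
      exact ⟨F, hφu _ _ hF⟩
  refine Quotient.sound ⟨AlgEquiv.ofBijective Φ hbij, fun i F => ?_⟩
  change (F : Module.End ℝ V.carrier) ∈ V.homPart i ↔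
    (φ F : Module.End ℝ V'.carrier) ∈ V'.homPart i
  constructor
  · intro hF
    obtain ⟨f, hf, h⟩ := hres i _ hF
    have : (φ F : Module.End ℝ V'.carrier) = f := LinearMap.ext fun x => hj (by rw [← hφ, h])
    rw [this]; exact hf
  · intro hF
    obtain ⟨G, hG, h⟩ := hext i _ hF
    have hG' : G ∈ V.enrichedEnd := by
      rcases zmod_two_cases i with rfl | rfl
      · exact Submodule.mem_sup_left hG
      · exact Submodule.mem_sup_right hG
    have := huniq' _ (sub_mem F.2 hG') fun x => by
      rw [LinearMap.sub_apply, hφ, h, sub_self]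
    rw [sub_eq_zero.1 this]; exact hG

end

end SuperRep

/-! ### Conjugate modules -/

/-- The complex conjugate of a complex vector space. -/
def ConjModule (V : Type*) := V

namespace ConjModule

variable (V : Type*) [AddCommGroup V] [Module ℂ V]

instance : AddCommGroup (ConjModule V) := inferInstanceAs (AddCommGroup V)

noncomputable instance : Module ℂ (ConjModule V) := Module.compHom V (starRingEnd ℂ)

/-- The antilinear identity from a vector space to its conjugate. -/
noncomputable def of : V ≃ₛₗ[starRingEnd ℂ] ConjModule V where
  toFun x := x
  invFun x := x
  map_add' _ _ := rfl
  map_smul' c x := by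
    change c • x = (starRingEnd ℂ) ((starRingEnd ℂ) c) • x
    rw [Complex.conj_conj]
  left_inv _ := rfl
  right_inv _ := rfl

variable {V}

theorem of_conj_smul (c : ℂ) (x : V) : of V ((starRingEnd ℂ) c • x) = c • of V x := rfl

theorem symm_smul (c : ℂ) (x : ConjModule V) :
    (of V).symm (c • x) = (starRingEnd ℂ) c • (of V).symm x := rfl

/-- A subspace, as a subspace of the conjugate space. -/
def ofSubmodule (S : Submodule ℂ V) : Submodule ℂ (ConjModule V) where
  carrier := (of V).symm ⁻¹' S
  zero_mem' := S.zero_mem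
  add_mem' := S.add_mem
  smul_mem' c _ hx := S.smul_mem (starRingEnd ℂ c) hx

/-- A subspace of the conjugate space, as a subspace. -/
def toSubmodule (S : Submodule ℂ (ConjModule V)) : Submodule ℂ V where
  carrier := of V ⁻¹' S
  zero_mem' := S.zero_mem
  add_mem' := S.add_mem
  smul_mem' c x hx := by
    rw [Set.mem_preimage, map_smulₛₗ]
    exact S.smul_mem (starRingEnd ℂ c) hx

end ConjModule

section

variable {𝔤 : Type*} [AddCommGroup 𝔤] [Module ℂ 𝔤] {L : LieSuperalgebra ℂ 𝔤}

namespace AntilinearInvolution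

/-- The conjugate `W^τ` of a module: the conjugate vector space with the action twisted by `τ`. -/
noncomputable abbrev twist (τ : L.AntilinearInvolution) (W : SuperRep.{v} L) : SuperRep.{v} L where
  carrier := ConjModule W.carrier
  part i := ConjModule.ofSubmodule (W.part i)
  isCompl := by
    constructor
    · rw [Submodule.disjoint_def]
      exact fun x h0 h1 => Submodule.disjoint_def.1 W.isCompl.disjoint ((ConjModule.of W.carrier).symm x) h0 h1
    · rw [codisjoint_iff_le_sup]
      intro x _
      have hx' : (ConjModule.of W.carrier).symm x ∈ W.part 0 ⊔ W.part 1 := by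
        rw [W.isCompl.sup_eq_top]; trivial
      obtain ⟨a, ha, b, hb, hab⟩ := Submodule.mem_sup.1 hx'
      exact Submodule.mem_sup.2 ⟨ConjModule.of W.carrier a, ha, ConjModule.of W.carrier b, hb, hab⟩
  act := LinearMap.mk₂ ℂ
    (fun a x => ConjModule.of W.carrier (W.act (τ.toMap a) ((ConjModule.of W.carrier).symm x)))
    (fun a b x => by simp)
    (fun c a x => by rw [map_smulₛₗ, map_smul, LinearMap.smul_apply, ConjModule.of_conj_smul])
    (fun a x y => by simp)
    (fun c a x => by rw [ConjModule.symm_smul, map_smul, ConjModule.of_conj_smul])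
  act_mem i j x w hx hw := W.act_mem i j (τ.toMap x) w (τ.map_part i x hx) hw
  act_bracket i j x y w hx hy := by
    have h := W.act_bracket i j (τ.toMap x) (τ.toMap y) ((ConjModule.of W.carrier).symm w)
      (τ.map_part i x hx) (τ.map_part j y hy)
    simp [τ.map_bracket, h]

/-- A submodule of `W^τ` is, as a set, a submodule of `W`: each `a` in `𝔤` equals `τ (τ a)`, so
twisting does not change which subspaces are stable. -/
theorem isSimple_twist (τ : L.AntilinearInvolution) {W : SuperRep.{v} L} (hW : W.IsSimple) :
    (τ.twist W).IsSimple where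
  nontrivial := hW.nontrivial
  eq_bot_or_eq_top S hS := by
    have h : W.IsSubrep (ConjModule.toSubmodule (V := W.carrier) S) := by
      constructor
      · intro x hx
        obtain ⟨a, b, ha, hb, ha0, hb1, hab⟩ := hS.graded.exists_add
          (show ConjModule.of W.carrier x ∈ S from hx)
        exact Submodule.mem_sup.2 ⟨(ConjModule.of W.carrier).symm a, ⟨ha, ha0⟩,
          (ConjModule.of W.carrier).symm b, ⟨hb, hb1⟩, hab.symm⟩
      · intro a x hx
        have h : W.act (τ.toMap (τ.toMap a)) x ∈ ConjModule.toSubmodule (V := W.carrier) S :=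
          hS.act_mem (τ.toMap a) (ConjModule.of W.carrier x) hx
        rwa [τ.involutive] at h
    rcases hW.eq_bot_or_eq_top _ h with h | h
    · left
      rw [eq_bot_iff]
      intro x hx
      have : (ConjModule.of W.carrier).symm x ∈ ConjModule.toSubmodule (V := W.carrier) S := hx
      rw [h] at this
      exact this
    · right
      rw [eq_top_iff]
      intro x _
      have : (ConjModule.of W.carrier).symm x ∈ ConjModule.toSubmodule (V := W.carrier) S := by rw [h]; trivial
      exact this

theorem finiteDimensional_twist (τ : L.AntilinearInvolution) {W : SuperRep.{v} L}
    (hW : FiniteDimensional ℂ W.carrier) : FiniteDimensional ℂ (τ.twist W).carrier := by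
  obtain ⟨s, hs⟩ := hW.1
  refine ⟨⟨s.map (ConjModule.of W.carrier).toEquiv.toEmbedding, ?_⟩⟩
  rw [eq_top_iff]
  intro x _
  have hx : (ConjModule.of W.carrier).symm x ∈ Submodule.span ℂ (s : Set W.carrier) := by rw [hs]; trivial
  have hle : Submodule.span ℂ (s : Set W.carrier) ≤ ConjModule.toSubmodule (V := W.carrier)
      (Submodule.span ℂ (s.map (ConjModule.of W.carrier).toEquiv.toEmbedding :
        Set (ConjModule W.carrier))) := by
    rw [Submodule.span_le]
    intro y hy
    have hy' : ConjModule.of W.carrier y ∈ s.map (ConjModule.of W.carrier).toEquiv.toEmbedding :=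
      Finset.mem_map_of_mem _ hy
    exact Submodule.subset_span (R := ℂ) (M := ConjModule W.carrier) (Finset.mem_coe.2 hy')
  exact hle hx

/-! ### Linear and antilinear parts -/

section parts

variable {V : Type*} [AddCommGroup V] [Module ℂ V]

theorem smul_eq_re_im (c : ℂ) (x : V) : c • x = c.re • x + c.im • Complex.I • x := by
  rw [← Complex.coe_smul, ← Complex.coe_smul, smul_smul, ← add_smul, Complex.re_add_im]

theorem I_smul_I_smul (x : V) : Complex.I • Complex.I • x = -x := by
  rw [smul_smul, Complex.I_mul_I, neg_one_smul]

/-- The complex linear part of a real linear map, doubled. -/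
noncomputable def linPart (f : V →ₗ[ℝ] V) : V →ₗ[ℂ] V where
  toFun x := f x - Complex.I • f (Complex.I • x)
  map_add' x y := by simp only [smul_add, map_add]; abel
  map_smul' c x := by
    rw [RingHom.id_apply, smul_eq_re_im c, smul_eq_re_im c (f x - _)]
    simp only [smul_add, map_add, smul_comm Complex.I (_ : ℝ), map_smul, I_smul_I_smul, map_neg,
      smul_sub, smul_neg]
    abel

/-- The antilinear part of a real linear map, doubled. -/
noncomputable def antiPart (f : V →ₗ[ℝ] V) : V →ₗ[ℂ] ConjModule V where
  toFun x := ConjModule.of V (f x + Complex.I • f (Complex.I • x))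
  map_add' x y := by
    rw [← map_add]
    congr 1
    simp only [smul_add, map_add]; abel
  map_smul' c x := by
    rw [RingHom.id_apply, ← ConjModule.of_conj_smul, smul_eq_re_im c,
      smul_eq_re_im ((starRingEnd ℂ) c), Complex.conj_re, Complex.conj_im]
    congr 1
    simp only [smul_add, map_add, smul_comm Complex.I (_ : ℝ), map_smul, I_smul_I_smul, map_neg,
      smul_neg, neg_smul]
    abel

end parts

end AntilinearInvolution

end

end LieSuperalgebra

/-! ### Real endomorphisms and real submodules of a complex module -/

namespace LieSuperalgebra

section

variable {𝔤 : Type u} [AddCommGroup 𝔤] [Module ℂ 𝔤] {L : LieSuperalgebra ℂ 𝔤}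

namespace AntilinearInvolution

/-- Elements of a `τ`-stable subalgebra have their real and imaginary parts in it. -/
theorem exists_re_im_mem (τ : L.AntilinearInvolution) {S : L.Subsuperalgebra}
    (hS : τ.Stabilizes S) {y : 𝔤} (hy : y ∈ S.carrier) :
    ∃ a b : τ.fixed, (a : 𝔤) ∈ S.carrier ∧ (b : 𝔤) ∈ S.carrier ∧
      y = (a : 𝔤) + Complex.I • (b : 𝔤) := by
  obtain ⟨a, b, rfl⟩ := τ.exists_re_im y
  -- Stability puts the conjugate `a - I • b` in `S` as well. Adding it to `y` gives `2 • a`, and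
  -- then `b` follows.
  have h := (hS _).2 hy
  rw [map_add, map_smulₛₗ, show τ.toMap a = a from a.2, show τ.toMap b = b from b.2,
    Complex.conj_I] at h
  have ha : (2 : ℂ) • (a : 𝔤) ∈ S.carrier := by
    have := add_mem hy h
    rw [neg_smul, add_add_add_comm, add_neg_cancel, add_zero, ← two_smul ℂ] at this
    exact this
  have ha' := S.carrier.smul_mem (2 : ℂ)⁻¹ ha
  rw [smul_smul, inv_mul_cancel₀ two_ne_zero, one_smul] at ha'
  have hb := S.carrier.smul_mem (-Complex.I) ((Submodule.add_mem_iff_right _ ha').1 hy)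
  rw [smul_smul, neg_mul, Complex.I_mul_I, neg_neg, one_smul] at hb
  exact ⟨a, b, ha', hb, rfl⟩

section hom

variable (τ : L.AntilinearInvolution) {W : SuperRep.{v} L} {i : ZMod 2}
  {f : Module.End ℝ W.carrier}

/-- Commutation with `𝔤^ℝ` becomes commutation with `𝔤 = 𝔤^ℝ + i 𝔤^ℝ`, because the linear part also
commutes with `i`. -/
theorem isHom_linPart (hf : f ∈ (τ.realify W).homPart i) : W.IsHom (W.shift i) (linPart f) where
  map_part j x hx := by
    change f x - Complex.I • f (Complex.I • x) ∈ W.part (j + i)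
    exact sub_mem (hf.1 j x hx)
      ((W.part _).smul_mem _ (hf.1 j _ ((W.part j).smul_mem Complex.I hx)))
  map_act y x := by
    obtain ⟨a, b, rfl⟩ := τ.exists_re_im y
    have h : ∀ (c : τ.fixed) x, f (W.act c x) = W.act c (f x) := hf.2
    change f (W.act _ x) - Complex.I • f (Complex.I • W.act _ x) =
      W.act _ (f x - Complex.I • f (Complex.I • x))
    have h1 : W.act (a + Complex.I • (b : 𝔤)) x = W.act a x + W.act b (Complex.I • x) := by
      simp
    have h2 : Complex.I • W.act (a + Complex.I • (b : 𝔤)) x =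
        W.act a (Complex.I • x) - W.act b x := by
      simp [I_smul_I_smul, sub_eq_add_neg]
    rw [h1] at h2 ⊢
    rw [h2, map_add f, map_sub f, h, h, h, h]
    simp only [map_add, map_smul, LinearMap.add_apply, LinearMap.smul_apply, map_sub,
      I_smul_I_smul, smul_sub, smul_add]
    abel

/-- An antilinear map `B` commuting with `𝔤^ℝ` satisfies `B (y w) = τ(y) B w` for all `y` in `𝔤`.
This is exactly equivariance into the twisted conjugate module. -/
theorem isHom_antiPart (hf : f ∈ (τ.realify W).homPart i) :
    W.IsHom ((τ.twist W).shift i) (antiPart f) where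
  map_part j x hx := by
    change f x + Complex.I • f (Complex.I • x) ∈ W.part (j + i)
    exact add_mem (hf.1 j x hx)
      ((W.part _).smul_mem _ (hf.1 j _ ((W.part j).smul_mem Complex.I hx)))
  map_act y x := by
    obtain ⟨a, b, rfl⟩ := τ.exists_re_im y
    have h : ∀ (c : τ.fixed) x, f (W.act c x) = W.act c (f x) := hf.2
    have hτ : τ.toMap (a + Complex.I • b) = a - Complex.I • (b : 𝔤) := by
      rw [map_add, map_smulₛₗ, show τ.toMap a = a from a.2, show τ.toMap b = b from b.2,
        Complex.conj_I, neg_smul, sub_eq_add_neg]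
    change f (W.act _ x) + Complex.I • f (Complex.I • W.act _ x) =
      W.act (τ.toMap _) (f x + Complex.I • f (Complex.I • x))
    have h1 : W.act (a + Complex.I • (b : 𝔤)) x = W.act a x + W.act b (Complex.I • x) := by
      simp
    have h2 : Complex.I • W.act (a + Complex.I • (b : 𝔤)) x =
        W.act a (Complex.I • x) - W.act b x := by
      simp [I_smul_I_smul, sub_eq_add_neg]
    rw [h1] at h2 ⊢
    rw [hτ, h2, map_add f, map_sub f, h, h, h, h]
    simp only [map_add, map_sub, map_smul, LinearMap.sub_apply, LinearMap.smul_apply,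
      I_smul_I_smul, smul_sub]
    abel

theorem linPart_add_antiPart (x : W.carrier) :
    linPart f x + (ConjModule.of W.carrier).symm (antiPart f x) = (2 : ℝ) • f x := by
  change (f x - Complex.I • f (Complex.I • x)) + (f x + Complex.I • f (Complex.I • x)) = _
  rw [two_smul]; abel

end hom

variable {τ : L.AntilinearInvolution}

/-- A homogeneous real endomorphism of a simple complex module that vanishes on a nonzero complex
subspace vanishes. -/
theorem homPart_eq_zero {W : SuperRep.{v} L} (hW : W.IsSimple) {i : ZMod 2}
    {f : Module.End ℝ W.carrier} (hf : f ∈ (τ.realify W).homPart i) {S : Submodule ℂ W.carrier}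
    (hS : S ≠ ⊥) (h : ∀ x ∈ S, f x = 0) : f = 0 := by
  obtain ⟨x, hx, hx0⟩ := (Submodule.ne_bot_iff _).1 hS
  -- `S` is a complex subspace, so `f` vanishes at `x` and at `I • x`. Both parts thus kill a
  -- nonzero vector of a simple module and are zero.
  have h1 : linPart f x = 0 := by
    change f x - Complex.I • f (Complex.I • x) = 0
    rw [h x hx, h _ (S.smul_mem _ hx), smul_zero, sub_zero]
  have h2 : antiPart f x = 0 := by
    change f x + Complex.I • f (Complex.I • x) = 0
    rw [h x hx, h _ (S.smul_mem _ hx), smul_zero, add_zero]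
  have h3 := (τ.isHom_linPart hf).eq_zero hW hx0 h1
  have h4 := (τ.isHom_antiPart hf).eq_zero hW hx0 h2
  ext y
  have h5 := linPart_add_antiPart (f := f) y
  rw [h3, h4] at h5
  have h6 : (2 : ℝ) • f y = 0 := by
    rw [← h5]; exact add_zero _
  exact (smul_eq_zero.1 h6).resolve_left two_ne_zero

/-- Submodules of the restriction of scalars of a simple complex module are ranges of
idempotent endomorphisms. -/
theorem exists_idempotent {W : SuperRep.{v} L} (hW : W.IsSimple) {S : Submodule ℝ W.carrier}
    (hS : (τ.realify W).IsSubrep S) :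
    ∃ p ∈ (τ.realify W).homPart 0, (∀ x, p x ∈ S) ∧ ∀ x ∈ S, p x = x := by
  have hactS : ∀ (a : τ.fixed) (x : W.carrier), x ∈ S → W.act a x ∈ S := hS.act_mem
  have hgr : ∀ x ∈ S, ∃ a b : W.carrier, a ∈ S ∧ b ∈ S ∧ a ∈ W.part 0 ∧ b ∈ W.part 1 ∧ x = a + b :=
    fun x hx => hS.graded.exists_add hx
  -- With `S' = i S`, the spaces `S ∩ i S` and `S + i S` are complex submodules, so each is `0` or
  -- `W`. If the intersection is `W`, then `S = W` and `p = 1`. If the sum is `0`, then `p = 0`.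
  -- Otherwise `W = S ⊕ i S`, and `p` is the projection.
  let J : W.carrier ≃ₗ[ℝ] W.carrier :=
    (LinearEquiv.smulOfNeZero ℂ W.carrier Complex.I Complex.I_ne_zero).restrictScalars ℝ
  let S' : Submodule ℝ W.carrier := S.map J.toLinearMap
  have hS' : (τ.realify W).IsSubrep S' := by
    constructor
    · rintro _ ⟨x, hx, rfl⟩
      obtain ⟨a, b, haS, hbS, ha, hb, rfl⟩ := hgr x hx
      rw [map_add]
      exact Submodule.add_mem_sup ⟨⟨a, haS, rfl⟩, (W.part 0).smul_mem _ ha⟩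
        ⟨⟨b, hbS, rfl⟩, (W.part 1).smul_mem _ hb⟩
    · rintro a _ ⟨x, hx, rfl⟩
      exact ⟨W.act a x, hactS a x hx, ((W.act a).map_smul Complex.I x).symm⟩
  have hIS' : ∀ x ∈ S, Complex.I • x ∈ S' := fun x hx => ⟨x, hx, rfl⟩
  have hIS : ∀ x ∈ S', Complex.I • x ∈ S := by
    rintro _ ⟨x, hx, rfl⟩
    change Complex.I • Complex.I • x ∈ S
    rw [I_smul_I_smul]; exact S.neg_mem hx
  -- real subspaces stable under `I` are complex
  let cx : ∀ M : Submodule ℝ W.carrier, (∀ x ∈ M, Complex.I • x ∈ M) → Submodule ℂ W.carrier :=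
    fun M hM =>
      { carrier := M
        zero_mem' := M.zero_mem
        add_mem' := M.add_mem
        smul_mem' := fun c x hx => by
          rw [smul_eq_re_im]
          exact M.add_mem (M.smul_mem _ hx) (M.smul_mem _ (hM x hx)) }
  have hcx : ∀ M hM, (τ.realify W).IsSubrep M → W.IsSubrep (cx M hM) := by
    intro M hM h
    have hactM : ∀ (a : τ.fixed) (x : W.carrier), x ∈ M → W.act a x ∈ M := h.act_mem
    refine ⟨fun x hx => ?_, fun y x hx => ?_⟩
    · obtain ⟨a, b, ha, hb, ha0, hb1, hab⟩ := h.graded.exists_add (show x ∈ M from hx)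
      exact Submodule.mem_sup.2 ⟨a, ⟨ha, ha0⟩, b, ⟨hb, hb1⟩, hab.symm⟩
    · obtain ⟨a, b, rfl⟩ := τ.exists_re_im y
      rw [map_add, map_smul, LinearMap.add_apply, LinearMap.smul_apply]
      exact M.add_mem (hactM a x hx) (hM _ (hactM b x hx))
  have hinf : ∀ x ∈ S ⊓ S', Complex.I • x ∈ S ⊓ S' := fun x hx => ⟨hIS x hx.2, hIS' x hx.1⟩
  have hsup : ∀ x ∈ S ⊔ S', Complex.I • x ∈ S ⊔ S' := by
    intro x hx
    obtain ⟨a, ha, b, hb, rfl⟩ := Submodule.mem_sup.1 hx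
    rw [smul_add, add_comm]
    exact Submodule.add_mem_sup (hIS b hb) (hIS' a ha)
  have hinf' : (τ.realify W).IsSubrep (S ⊓ S') := by
    refine ⟨?_, fun a x hx => ⟨hS.act_mem a x hx.1, hS'.act_mem a x hx.2⟩⟩
    rintro x ⟨hx, hx'⟩
    obtain ⟨a, b, haS, hbS, ha, hb, rfl⟩ := hgr x hx
    have := hS'.mem_of_add_mem ha hb hx'
    exact Submodule.add_mem_sup ⟨⟨haS, this.1⟩, ha⟩ ⟨⟨hbS, this.2⟩, hb⟩
  have hsup' : (τ.realify W).IsSubrep (S ⊔ S') := by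
    refine ⟨hS.graded.sup hS'.graded, fun a x hx => ?_⟩
    obtain ⟨y, hy, z, hz, rfl⟩ := Submodule.mem_sup.1 hx
    rw [map_add]
    exact Submodule.add_mem_sup (hS.act_mem a y hy) (hS'.act_mem a z hz)
  have mem_of_eq : ∀ M hM, cx M hM = ⊤ → ∀ x, x ∈ M := fun M hM h x => by
    have : x ∈ cx M hM := by rw [h]; trivial
    exact this
  have eq_of_eq : ∀ M hM, cx M hM = ⊥ → ∀ x ∈ M, x = 0 := fun M hM h x hx => by
    have : x ∈ cx M hM := hx
    rw [h] at this
    exact this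
  rcases hW.eq_bot_or_eq_top _ (hcx _ hinf hinf') with h | h
  · rcases hW.eq_bot_or_eq_top _ (hcx _ hsup hsup') with h' | h'
    · refine ⟨0, zero_mem _, fun x => S.zero_mem, fun x hx => ?_⟩
      exact (eq_of_eq _ hsup h' x (Submodule.mem_sup_left hx)).symm
    · have hc : IsCompl S S' := ⟨disjoint_iff_inf_le.2 fun x hx => eq_of_eq _ hinf h x hx,
        codisjoint_iff_le_sup.2 fun x _ => mem_of_eq _ hsup h' x⟩
      exact ⟨_, SuperRep.projection_mem_homPart hS hS' hc,
        fun x => Submodule.projection_apply_mem hc x,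
        fun x hx => Submodule.projection_apply_left hc ⟨x, hx⟩⟩
  · exact ⟨1, SuperRep.one_mem_homPart _, fun x => (mem_of_eq _ hinf h x).1, fun x _ => rfl⟩

/-- Every simple submodule of the restriction of scalars of `W` is the module `Φ(W)`. -/
theorem isPhi_ofSubrep {W : SuperRep.{v} L} (hW : W.IsIrr) {S : Submodule ℝ W.carrier}
    (hS : (τ.realify W).IsSubrep S) (hirr : ((τ.realify W).ofSubrep S hS).IsIrr) :
    τ.IsPhi W ((τ.realify W).ofSubrep S hS) := by
  obtain ⟨V, hV, h⟩ := τ.exists_isPhi W hW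
  have hι := SuperRep.ofSubrep_isHom hS
  have hnt := hirr.simple.nontrivial
  obtain ⟨x, hx⟩ := exists_ne (0 : S)
  have hx' : S.subtype x ≠ 0 := fun h0 => hx (Subtype.ext h0)
  -- Embedding `S` in `V` or `V ⊕ V`, some coordinate is nonzero and hence, by Schur's lemma, an
  -- isomorphism of `S` with `V`.
  have key : ∃ g : S →ₗ[ℝ] V.carrier, ((τ.realify W).ofSubrep S hS).IsHom V g ∧ g ≠ 0 := by
    rcases h with ⟨e, he⟩ | ⟨e, he⟩
    · refine ⟨_, he.comp hι, fun h0 => hx' ?_⟩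
      exact e.injective (by rw [map_zero]; exact LinearMap.congr_fun h0 x)
    · by_cases h1 : LinearMap.fst ℝ V.carrier V.carrier ∘ₗ (e.toLinearMap ∘ₗ S.subtype) = 0
      · refine ⟨_, (SuperRep.prod_isHom_snd V V).comp (he.comp hι), fun h0 => hx' ?_⟩
        exact e.injective (by
          rw [map_zero]
          exact Prod.ext (LinearMap.congr_fun h1 x) (LinearMap.congr_fun h0 x))
      · exact ⟨_, (SuperRep.prod_isHom_fst V V).comp (he.comp hι), h1⟩
  obtain ⟨g, hg, hg0⟩ := key
  let e := LinearEquiv.ofBijective g (hg.bijective hirr.simple hV.simple hg0)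
  have he : ((τ.realify W).ofSubrep S hS).IsHom V e.toLinearMap := hg
  have he' := he.symm
  refine ⟨hirr, h.imp (fun h => h.trans ⟨e.symm, he'⟩) fun h => h.trans ?_⟩
  exact ⟨LinearEquiv.prodCongr e.symm e.symm,
    ⟨fun i x hx => ⟨he'.map_part i _ hx.1, he'.map_part i _ hx.2⟩,
      fun a x => Prod.ext (he'.map_act a _) (he'.map_act a _)⟩⟩

end AntilinearInvolution

end

end LieSuperalgebra

/-! ### The extension property implies equality of endotypes -/

namespace LieSuperalgebra

variable {𝔤 : Type u} [AddCommGroup 𝔤] [Module ℂ 𝔤] {L : LieSuperalgebra ℂ 𝔤}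

namespace TriangularDecomposition

variable {T : L.TriangularDecomposition} {τ : L.AntilinearInvolution} {W : SuperRep.{v} L}

open AntilinearInvolution

/-- The average of a linear and an antilinear homomorphism is a real endomorphism. -/
theorem exists_homPart_of_parts {i : ZMod 2} {A : W.carrier →ₗ[ℂ] W.carrier}
    (hA : W.IsHom (W.shift i) A) {B : W.carrier →ₗ[ℂ] ConjModule W.carrier}
    (hB : W.IsHom ((τ.twist W).shift i) B) :
    ∃ F ∈ (τ.realify W).homPart i,
      ∀ x, (2 : ℝ) • F x = A x + (ConjModule.of W.carrier).symm (B x) := by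
  let F : W.carrier →ₗ[ℝ] W.carrier :=
    { toFun := fun x => (2 : ℝ)⁻¹ • (A x + (ConjModule.of W.carrier).symm (B x))
      map_add' := fun x y => by simp only [map_add, smul_add]; abel
      map_smul' := fun c x => by
        have h1 : A (c • x) = c • A x := A.map_smul (c : ℂ) x
        have h2 : (ConjModule.of W.carrier).symm (B (c • x)) =
            c • (ConjModule.of W.carrier).symm (B x) := by
          have : B ((c : ℂ) • x) = (c : ℂ) • B x := B.map_smul _ _
          rw [Complex.coe_smul] at this
          rw [this, ConjModule.symm_smul, Complex.conj_ofReal, Complex.coe_smul]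
        rw [h1, h2, RingHom.id_apply, ← smul_add, smul_comm] }
  refine ⟨F, ⟨fun j x hx => ?_, fun a x => ?_⟩, fun x => ?_⟩
  · exact Submodule.smul_mem ((W.part (j + i)).restrictScalars ℝ) _
      (add_mem (hA.map_part j x hx) (hB.map_part j x hx) : _ ∈ W.part (j + i))
  · change (2 : ℝ)⁻¹ • (A (W.act a x) + (ConjModule.of W.carrier).symm (B (W.act a x))) =
      W.act a ((2 : ℝ)⁻¹ • (A x + (ConjModule.of W.carrier).symm (B x)))
    have h1 : A (W.act a x) = W.act a (A x) := hA.map_act a x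
    have h2 : (ConjModule.of W.carrier).symm (B (W.act a x)) =
        W.act (τ.toMap a) ((ConjModule.of W.carrier).symm (B x)) := hB.map_act a x
    rw [show τ.toMap a = a from a.2] at h2
    rw [h1, h2, ← map_add, ← Complex.coe_smul, ← Complex.coe_smul, map_smul]
  · exact smul_inv_smul₀ (two_ne_zero (α := ℝ)) _

/-- Real endomorphisms of `W` preserve `W^𝔲`. -/
theorem exists_homPart_restrict (hT : T.IsStable τ) {i : ZMod 2} {F : Module.End ℝ W.carrier}
    (hF : F ∈ (τ.realify W).homPart i) :
    ∃ f ∈ ((τ.restrict T.l hT.l).realify (T.invariants W)).homPart i,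
      ∀ n : T.invariantsSubmodule W, F n = f n := by
  have hact : ∀ (c : τ.fixed) x, F (W.act c x) = W.act c (F x) := hF.2
  -- As `𝔲` is `τ`-stable, it is spanned over `ℂ` by real elements, and `F` commutes with these.
  have hmem : ∀ n ∈ T.invariantsSubmodule W, F n ∈ T.invariantsSubmodule W := by
    intro n hn y hy
    obtain ⟨a, b, ha, hb, rfl⟩ := τ.exists_re_im_mem hT.u hy
    rw [map_add, map_smul, LinearMap.add_apply, LinearMap.smul_apply, ← hact, ← hact, hn _ ha,
      hn _ hb, map_zero, smul_zero, add_zero]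
  refine ⟨
    { toFun := fun n => ⟨F n, hmem n n.2⟩
      map_add' := fun m n => Subtype.ext (F.map_add m n)
      map_smul' := fun c n => Subtype.ext (F.map_smul c n) }, ⟨fun j n hn => ?_, fun a n => ?_⟩,
    fun n => rfl⟩
  · exact hF.1 j n hn
  · exact Subtype.ext (hact ⟨a.1, congrArg Subtype.val a.2⟩ n)

/-- Real endomorphisms of `W^𝔲` extend to `W`. -/
theorem exists_homPart_extend (hT : T.IsStable τ) (hW : W.IsIrr)
    (H : ∀ W' : SuperRep.{v} L, W'.IsIrr → T.HomsExtend W W') {i : ZMod 2}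
    {f : Module.End ℝ (T.invariants W).carrier}
    (hf : f ∈ ((τ.restrict T.l hT.l).realify (T.invariants W)).homPart i) :
    ∃ F ∈ (τ.realify W).homPart i, ∀ n : T.invariantsSubmodule W, F n = f n := by
  have hA := (τ.restrict T.l hT.l).isHom_linPart hf
  have hB := (τ.restrict T.l hT.l).isHom_antiPart hf
  have hirr : (W.shift i).IsIrr := ⟨hW.finite, SuperRep.isSimple_shift hW.simple i⟩
  have hirr' : ((τ.twist W).shift i).IsIrr :=
    ⟨τ.finiteDimensional_twist hW.finite, SuperRep.isSimple_shift (τ.isSimple_twist hW.simple) i⟩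
  obtain ⟨A, hA', hAf⟩ := H _ hirr (linPart f) ⟨hA.map_part, hA.map_act⟩
  -- The antilinear part of `f` takes values in the conjugate of `W^𝔲`. These vectors are
  -- `𝔲`-invariant in `W^τ` because `x` acts there as `τ x`, which again lies in `𝔲`.
  let g : (T.invariants W).carrier →ₗ[ℂ] (T.invariants ((τ.twist W).shift i)).carrier :=
    { toFun := fun n => ⟨ConjModule.of W.carrier
          ((ConjModule.of (T.invariants W).carrier).symm (antiPart f n)), fun x hx =>
          ((ConjModule.of (T.invariants W).carrier).symm (antiPart f n)).2 (τ.toMap x)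
            ((hT.u x).2 hx)⟩
      map_add' := fun m n => Subtype.ext (by rw [map_add]; rfl)
      map_smul' := fun c n => Subtype.ext (by rw [map_smul]; rfl) }
  obtain ⟨B, hB', hBg⟩ := H _ hirr' g ⟨hB.map_part, fun a n =>
    Subtype.ext (congrArg (fun z => ConjModule.of W.carrier
      ((ConjModule.of (T.invariants W).carrier).symm z).1) (hB.map_act a n))⟩
  obtain ⟨F, hF, hFAB⟩ := exists_homPart_of_parts hA' hB'
  refine ⟨F, hF, fun n => ?_⟩
  have h1 := hFAB n
  rw [hAf, hBg] at h1
  have h2 : (linPart f n : W.carrier) +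
      ((ConjModule.of (T.invariants W).carrier).symm (antiPart f n) : W.carrier) =
      (2 : ℝ) • (f n : W.carrier) := congrArg Subtype.val (linPart_add_antiPart (f := f) n)
  exact smul_right_injective W.carrier (two_ne_zero (α := ℝ)) (h1.trans h2)

/-- If homomorphisms extend from `W^𝔲`, then `W` and `W^𝔲` have the same endotype. -/
theorem EType_invariants (hT : T.IsStable τ) (hW : W.IsIrr) (hN : (T.invariants W).IsIrr)
    (H : ∀ W' : SuperRep.{v} L, W'.IsIrr → T.HomsExtend W W') :
    τ.EType W hW = (τ.restrict T.l hT.l).EType (T.invariants W) hN := by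
  have hNfin : FiniteDimensional ℝ (T.invariants W).carrier := by
    have := hN.finite
    exact FiniteDimensional.complexToReal _
  have hWfin : FiniteDimensional ℝ W.carrier := by
    have := hW.finite
    exact FiniteDimensional.complexToReal _
  have hNnt : Nontrivial (T.invariants W).carrier := hN.simple.nontrivial
  have hNbot : T.invariantsSubmodule W ≠ ⊥ := Submodule.nontrivial_iff_ne_bot.1 hNnt
  -- Restriction to `W^𝔲` is injective on homogeneous real endomorphisms. All identities on `W`
  -- below are checked on `W^𝔲` by means of it.
  have huniq : ∀ i, ∀ F ∈ (τ.realify W).homPart i, ∀ G ∈ (τ.realify W).homPart i,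
      (∀ n : T.invariantsSubmodule W, F n = G n) → F = G := by
    intro i F hF G hG h
    exact sub_eq_zero.1 (homPart_eq_zero hW.simple (sub_mem hF hG) hNbot fun x hx => by
      rw [LinearMap.sub_apply, h ⟨x, hx⟩, sub_self])
  obtain ⟨S', hS', hS'0, hS'irr⟩ : ∃ (S' : Submodule ℝ (T.invariants W).carrier)
      (hS' : ((τ.restrict T.l hT.l).realify (T.invariants W)).IsSubrep S'),
      S' ≠ ⊥ ∧ (((τ.restrict T.l hT.l).realify (T.invariants W)).ofSubrep S' hS').IsIrr :=
    ((τ.restrict T.l hT.l).realify (T.invariants W)).exists_simple_subrep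
  obtain ⟨e, he, heS, hefix⟩ := exists_idempotent hN.simple hS'
  obtain ⟨E, hE, hEe⟩ := exists_homPart_extend hT hW H he
  have hEE : ∀ x, E (E x) = E x := by
    have h2 := SuperRep.mul_mem_homPart hE hE
    rw [add_zero] at h2
    have := huniq 0 _ h2 _ hE fun n => by
      rw [Module.End.mul_apply, hEe, hEe, hefix _ (heS n)]
    exact LinearMap.congr_fun this
  have hEhom := SuperRep.mem_homPart_zero.1 hE
  -- The candidate for `Φ(W)`: the range of the idempotent `E` extending `e`. It meets `W^𝔲` exactly
  -- in `S'`.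
  let S : Submodule ℝ W.carrier := LinearMap.range E
  have hS : (τ.realify W).IsSubrep S := hEhom.isSubrep_range
  have hEfix : ∀ x ∈ S, E x = x := by
    rintro _ ⟨y, rfl⟩; exact hEE y
  have hSS' : ∀ n : T.invariantsSubmodule W, (n : W.carrier) ∈ S → n ∈ S' := by
    intro n hn
    have h1 := hEfix _ hn
    rw [hEe] at h1
    exact (Subtype.ext h1 : e n = n) ▸ heS n
  have hS'S : ∀ n : T.invariantsSubmodule W, n ∈ S' → (n : W.carrier) ∈ S := fun n hn =>
    ⟨n, by rw [hEe, hefix n hn]⟩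
  have hSirr : ((τ.realify W).ofSubrep S hS).IsIrr := by
    refine ⟨FiniteDimensional.finiteDimensional_submodule S, ⟨?_, ?_⟩⟩
    · rw [Submodule.nontrivial_iff_ne_bot]
      intro h
      refine hS'0 ((Submodule.eq_bot_iff _).2 fun n hn => ?_)
      have := hS'S n hn
      rw [h] at this
      exact Subtype.ext this
    · intro S0 hS0
      have hS0' : (τ.realify W).IsSubrep (S0.map S.subtype) := by
        constructor
        · rintro _ ⟨x, hx, rfl⟩
          obtain ⟨a, b, ha, hb, ha0, hb1, rfl⟩ := hS0.graded.exists_add hx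
          rw [map_add]
          exact Submodule.add_mem_sup ⟨⟨a, ha, rfl⟩, ha0⟩ ⟨⟨b, hb, rfl⟩, hb1⟩
        · rintro a _ ⟨x, hx, rfl⟩
          exact ⟨_, hS0.act_mem a x hx, rfl⟩
      have hS0S : ∀ x ∈ S0.map S.subtype, x ∈ S := fun x hx => Submodule.map_subtype_le _ _ hx
      -- Simplicity of `S` is pulled back from `S'`. If `p` is an idempotent onto `S0`, then `p * E`
      -- restricts to an idempotent `q` of `W^𝔲` with image in `S'`. That image is `0` or `S'`,
      -- which gives `p * E = 0` or `p * E = E`, that is, `S0 = 0` or `S0 = S`.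
      obtain ⟨p, hp, hpS, hpfix⟩ := exists_idempotent hW.simple hS0'
      have hpE := SuperRep.mul_mem_homPart hp hE
      rw [add_zero] at hpE
      obtain ⟨q, hq, hpq⟩ := exists_homPart_restrict hT hpE
      have hqS' : ∀ n, q n ∈ S' := fun n => hSS' _ (by
        rw [← hpq]; exact hS0S _ (hpS _))
      have hqe : ∀ n, q (e n) = q n := fun n => Subtype.ext (by
        rw [← hpq, ← hpq, Module.End.mul_apply, Module.End.mul_apply, ← hEe, hEE])
      have hqq : ∀ n, q (q n) = q n := fun n => Subtype.ext (by
        have h1 : (q n : W.carrier) = p (E n) := (hpq n).symm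
        rw [← hpq, Module.End.mul_apply, h1, hEfix _ (hS0S _ (hpS _)), hpfix _ (hpS _)])
      have hqhom := SuperRep.mem_homPart_zero.1 hq
      rcases hS'irr.simple.eq_bot_or_eq_top _
        ((hqhom.isSubrep_range).comap (SuperRep.ofSubrep_isHom hS')) with h | h
      · left
        have h0 : p * E = 0 := by
          refine huniq 0 _ hpE _ (zero_mem _) fun n => ?_
          have h1 : (⟨q n, hqS' n⟩ : S') ∈ (LinearMap.range q).comap S'.subtype := ⟨n, rfl⟩
          rw [h] at h1
          rw [hpq, show q n = 0 from congrArg Subtype.val ((Submodule.mem_bot ℝ).1 h1)]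
          rfl
        rw [Submodule.eq_bot_iff]
        intro x hx
        have hx' : (x : W.carrier) ∈ S0.map S.subtype := ⟨x, hx, rfl⟩
        have h1 := LinearMap.congr_fun h0 (x : W.carrier)
        rw [Module.End.mul_apply, hEfix _ x.2, hpfix _ hx'] at h1
        exact Subtype.ext h1
      · right
        have h0 : p * E = E := by
          refine huniq 0 _ hpE _ hE fun n => ?_
          have h1 : (⟨e n, heS n⟩ : S') ∈ (LinearMap.range q).comap S'.subtype := by
            rw [h]; trivial
          -- Being idempotent with image `S'`, `q` fixes `e n`. Together with `q ∘ e = q` this gives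
          -- `q = e`.
          obtain ⟨m, hm⟩ := h1
          have hm' : q m = e n := hm
          rw [hpq, hEe, ← hqe, ← hm', hqq]
        rw [eq_top_iff]
        intro x _
        have h1 := LinearMap.congr_fun h0 (x : W.carrier)
        rw [Module.End.mul_apply, hEfix _ x.2] at h1
        obtain ⟨y, hy, hyx⟩ := hpS x
        rw [h1] at hyx
        exact (Subtype.ext hyx : y = x) ▸ hy
  rw [EType_eq τ W hW (isPhi_ofSubrep hW hS hSirr),
    EType_eq _ _ hN (isPhi_ofSubrep hN hS' hS'irr)]
  have hπ : (τ.realify W).IsHom ((τ.realify W).ofSubrep S hS)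
      (LinearMap.codRestrict S E fun x => ⟨x, rfl⟩) :=
    ⟨hEhom.map_part, fun a x => Subtype.ext (hEhom.map_act a x)⟩
  have hehom := SuperRep.mem_homPart_zero.1 he
  have hπ' : ((τ.restrict T.l hT.l).realify (T.invariants W)).IsHom
      (((τ.restrict T.l hT.l).realify (T.invariants W)).ofSubrep S' hS')
      (LinearMap.codRestrict S' e heS) :=
    ⟨hehom.map_part, fun a x => Subtype.ext (hehom.map_act a x)⟩
  have hι := SuperRep.ofSubrep_isHom hS
  have hι' := SuperRep.ofSubrep_isHom hS'
  let j : S' →ₗ[ℝ] S :=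
    { toFun := fun x => ⟨(x : T.invariantsSubmodule W), hS'S x x.2⟩
      map_add' := fun x y => rfl
      map_smul' := fun c x => rfl }
  -- The two corner algebras are compared. An endomorphism of `S'` is composed with `e` to act on
  -- `W^𝔲`, extended to `W`, and cut down by `E` to `S`. In the other direction, one of `S` is
  -- composed with `E`, restricted to `W^𝔲`, and cut down by `e`.
  refine SuperRep.realEType_eq_of_extend hSirr hS'irr j
    (fun x y h => Subtype.ext (Subtype.ext (congrArg (fun z : S => (z : W.carrier)) h))) (fun i x hx => hx) ?_ ?_ ?_
  · intro i f hf
    obtain ⟨F, hF, hFf⟩ := exists_homPart_extend hT hW H (SuperRep.mem_homPart_iff.2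
      ((hι'.shift i).comp ((SuperRep.mem_homPart_iff.1 hf).comp hπ')))
    refine ⟨_, SuperRep.mem_homPart_iff.2
      ((hπ.shift i).comp ((SuperRep.mem_homPart_iff.1 hF).comp hι)), fun x => Subtype.ext ?_⟩
    change E (F ((x : T.invariantsSubmodule W) : W.carrier)) =
      ((f x : T.invariantsSubmodule W) : W.carrier)
    have h1 : (⟨e x, heS x⟩ : S') = x := Subtype.ext (hefix _ x.2)
    have h2 : F ((x : T.invariantsSubmodule W) : W.carrier) =
      ((f ⟨e x, heS x⟩ : T.invariantsSubmodule W) : W.carrier) := hFf x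
    rw [h2, h1, hEe, hefix _ (f x).2]
  · intro i F hF
    obtain ⟨g, hg, hFg⟩ := exists_homPart_restrict hT (SuperRep.mem_homPart_iff.2
      ((hι.shift i).comp ((SuperRep.mem_homPart_iff.1 hF).comp hπ)))
    refine ⟨_, SuperRep.mem_homPart_iff.2
      ((hπ'.shift i).comp ((SuperRep.mem_homPart_iff.1 hg).comp hι')), fun x => Subtype.ext ?_⟩
    change ((F (j x) : S) : W.carrier) = (e (g x) : T.invariantsSubmodule W)
    have h2 : ((F ⟨E (x : T.invariantsSubmodule W), ⟨_, rfl⟩⟩ : S) : W.carrier) = (g x : _) :=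
      hFg x
    have h1 : (⟨E ((x : T.invariantsSubmodule W) : W.carrier), ⟨_, rfl⟩⟩ : S) = j x :=
      Subtype.ext (hEfix _ (j x).2)
    rw [h1] at h2
    rw [← hEe, ← h2, hEfix _ (F (j x)).2]
  · intro i F hF h
    -- `F` composed with `E` vanishes on `W^𝔲`, because `E n = e n` lies in `S'`. So it vanishes on
    -- `W`, and `F` vanishes on the range of `E`.
    have h0 := huniq i _ (SuperRep.mem_homPart_iff.2
      ((hι.shift i).comp ((SuperRep.mem_homPart_iff.1 hF).comp hπ))) 0 (zero_mem _) (by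
        intro n
        change ((F ⟨E n, ⟨_, rfl⟩⟩ : S) : W.carrier) = 0
        have h1 : (⟨E (n : W.carrier), ⟨_, rfl⟩⟩ : S) = j ⟨e n, heS n⟩ := Subtype.ext (hEe n)
        rw [h1, h]
        rfl)
    ext x
    have h1 : ((F ⟨E x, ⟨_, rfl⟩⟩ : S) : W.carrier) = 0 := LinearMap.congr_fun h0 (x : W.carrier)
    have h2 : (⟨E (x : W.carrier), ⟨_, rfl⟩⟩ : S) = x := Subtype.ext (hEfix _ x.2)
    rw [h2] at h1
    exact h1

end TriangularDecomposition

end LieSuperalgebra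

/-! ### Hyperbolic type: eigenvalues of maximal real part -/

namespace LieSuperalgebra

/-- No sign occurs for even `x`, so `y` may be inhomogeneous, as eigenvectors of `ad x` can be. -/
theorem SuperRep.act_act_of_even {K : Type*} {𝔤 : Type*} [Field K] [AddCommGroup 𝔤] [Module K 𝔤]
    {L : LieSuperalgebra K 𝔤} (V : SuperRep.{v} L) {x : 𝔤} (hx : x ∈ L.part 0) (y : 𝔤)
    (w : V.carrier) : V.act x (V.act y w) = V.act (L.bracket x y) w + V.act y (V.act x w) := by
  refine hom_induction L.isCompl (P := fun y => V.act x (V.act y w) =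
    V.act (L.bracket x y) w + V.act y (V.act x w)) ?_ ?_ y
  · intro i y hy
    rw [V.act_act hx hy, zero_mul, sgn_zero, one_smul]
  · intro y z hy hz
    simp only [map_add, LinearMap.add_apply, hy, hz]
    abel

variable {𝔤 : Type u} [AddCommGroup 𝔤] [Module ℂ 𝔤] {L : LieSuperalgebra ℂ 𝔤}

/-- On `W` one has `(x - μ - c) y = y (x - μ)`, and this can be iterated. Generalized eigenspaces
are used because `x` need not act diagonalizably on `W`. -/
theorem SuperRep.act_mem_maxGenEigenspace (W : SuperRep.{v} L) {x y : 𝔤} (hx : x ∈ L.part 0)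
    {c μ : ℂ} (hxy : L.bracket x y = c • y) {w : W.carrier}
    (hw : w ∈ Module.End.maxGenEigenspace (W.act x) μ) :
    W.act y w ∈ Module.End.maxGenEigenspace (W.act x) (μ + c) := by
  rw [Module.End.mem_maxGenEigenspace] at hw ⊢
  obtain ⟨k, hk⟩ := hw
  refine ⟨k, ?_⟩
  have h : ∀ (k : ℕ) (w : W.carrier), ((W.act x - (μ + c) • (1 : Module.End ℂ W.carrier)) ^ k) (W.act y w) =
      W.act y (((W.act x - μ • (1 : Module.End ℂ W.carrier)) ^ k) w) := by
    intro k
    induction k with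
    | zero => intro w; rfl
    | succ k ih =>
      intro w
      have h1 : (W.act x - (μ + c) • (1 : Module.End ℂ W.carrier)) (W.act y w) =
          W.act y ((W.act x - μ • (1 : Module.End ℂ W.carrier)) w) := by
        simp only [LinearMap.sub_apply, LinearMap.smul_apply, Module.End.one_apply, map_sub,
          map_smul, W.act_act_of_even hx, hxy, add_smul, LinearMap.add_apply]
        abel
      rw [pow_succ, pow_succ, Module.End.mul_apply, Module.End.mul_apply, h1, ih]
  rw [h, hk, map_zero]

/-- Elements of sums of eigenspaces of `ad x` shift the generalized eigenspaces of `x`. -/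
theorem AntilinearInvolution.act_mem_of_complexify (τ : L.AntilinearInvolution) (W : SuperRep.{v} L)
    {x : τ.fixed} (hx : x ∈ τ.realForm.part 0) {P : ℝ → Prop} {μ : ℂ} {w : W.carrier}
    (hw : w ∈ Module.End.maxGenEigenspace (W.act x) μ) {M : Submodule ℂ W.carrier}
    (hM : ∀ c, P c → Module.End.maxGenEigenspace (W.act x) (μ + (c : ℂ)) ≤ M) {y : 𝔤}
    (hy : y ∈ τ.complexify (⨆ c : ℝ, ⨆ _ : P c, Module.End.eigenspace (τ.realForm.bracket x) c)) :
    W.act y w ∈ M := by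
  refine (Submodule.span_le.2 ?_ : τ.complexify _ ≤ M.comap (W.act.flip w)) hy
  rintro _ ⟨z, hz, rfl⟩
  have hle : (⨆ c : ℝ, ⨆ _ : P c, Module.End.eigenspace (τ.realForm.bracket x) c) ≤
      ((M.comap (W.act.flip w)).restrictScalars ℝ).comap τ.fixed.subtype := by
    refine iSup₂_le fun c hc z hz => hM c hc (W.act_mem_maxGenEigenspace hx ?_ hw)
    have h := congrArg Subtype.val (Module.End.mem_eigenspace_iff.1 hz)
    change L.bracket x z = c • (z : 𝔤) at h
    exact h.trans (Complex.coe_smul c (z : 𝔤)).symm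
  exact hle hz

namespace TriangularDecomposition

variable {T : L.TriangularDecomposition} {τ : L.AntilinearInvolution} {W : SuperRep.{v} L}

/-- Choose an eigenvalue `μ` of `x` on `W` with largest real part. Elements of `𝔲` raise real parts,
so they kill the eigenvectors for `μ`. Elements of `ū` strictly lower real parts, so `ū·W` never
reaches the generalized eigenspace of `μ`. -/
theorem IsHyperbolic.ne (h : T.IsHyperbolic τ) (hW : W.IsIrr) :
    T.invariantsSubmodule W ≠ ⊥ ∧ T.lowered W ≠ ⊤ := by
  obtain ⟨x, hx, -, hubar, -, hu⟩ := h
  have hfin := hW.finite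
  have hnt := hW.simple.nontrivial
  obtain ⟨μ, hμ, hmax⟩ := Set.exists_max_image {μ | Module.End.HasEigenvalue (W.act x) μ}
    Complex.re (Module.End.finite_hasEigenvalue _) (Module.End.exists_eigenvalue _)
  -- A nonzero generalized eigenspace contains an eigenvector, so the maximality of `μ` applies to
  -- `ν`.
  have hbot : ∀ ν, Module.End.maxGenEigenspace (W.act x) ν ≠ ⊥ → ν.re ≤ μ.re := by
    intro ν hν
    exact hmax ν ((show Module.End.HasUnifEigenvalue (W.act x) ν ⊤ from hν).lt zero_lt_one)
  constructor
  · obtain ⟨w, hw⟩ := hμ.exists_hasEigenvector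
    refine (Submodule.ne_bot_iff _).2 ⟨w, fun y hy => ?_, hw.2⟩
    rw [hu] at hy
    have hw' : w ∈ Module.End.maxGenEigenspace (W.act x) μ :=
      Module.End.mem_maxGenEigenspace _ _ _ |>.2 ⟨1, by
        simpa [sub_eq_zero] using hw.apply_eq_smul⟩
    -- For `c > 0` the number `μ + c` has larger real part than `μ`, so its generalized eigenspace
    -- is zero.
    have := τ.act_mem_of_complexify W hx hw' (M := ⊥) (fun c hc => ?_) hy
    · exact this
    · by_contra hne
      have := hbot (μ + c) fun h => hne h.le
      simp at this
      linarith
  · intro htop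
    have hle : T.lowered W ≤ ⨆ ν, ⨆ _ : ν ≠ μ, Module.End.maxGenEigenspace (W.act x) ν := by
      rw [lowered, Submodule.map₂_le]
      intro y hy w _
      have hw : w ∈ ⨆ ν, Module.End.maxGenEigenspace (W.act x) ν := by
        rw [Module.End.iSup_maxGenEigenspace_eq_top]; trivial
      refine (iSup_le fun ν w hw => ?_ : (⨆ ν, Module.End.maxGenEigenspace (W.act x) ν) ≤
        Submodule.comap (W.act y)
          (⨆ ν, ⨆ _ : ν ≠ μ, Module.End.maxGenEigenspace (W.act x) ν)) hw
      rw [Submodule.mem_comap]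
      by_cases hν : Module.End.maxGenEigenspace (W.act x) ν = ⊥
      · rw [hν, Submodule.mem_bot] at hw
        rw [hw, map_zero]; exact zero_mem _
      rw [hubar] at hy
      refine τ.act_mem_of_complexify W hx hw (fun c hc => ?_) hy
      refine le_iSup₂_of_le (ν + c) (fun h => ?_) le_rfl
      have h1 := hbot ν hν
      rw [← h] at h1
      simp at h1
      linarith
    -- By independence the sum over `ν ≠ μ` is a proper subspace.
    have hdis := (Module.End.independent_maxGenEigenspace (W.act x)) μ
    rw [htop, top_le_iff] at hle
    rw [hle, disjoint_top] at hdis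
    obtain ⟨w, hw⟩ := hμ.exists_hasEigenvector
    have := Module.End.eigenspace_le_maxGenEigenspace hw.1
    rw [hdis] at this
    exact hw.2 this

end TriangularDecomposition

end LieSuperalgebra

/-! ### Common null vectors: anticommuting operators and Lie's theorem -/

namespace LieSuperalgebra

variable {𝔤 : Type u} [AddCommGroup 𝔤] [Module ℂ 𝔤] {L : LieSuperalgebra ℂ 𝔤}

namespace SuperRep

/-- The subspace of vectors annihilated by `A`. -/
def annihilated (W : SuperRep.{v} L) (A : Submodule ℂ 𝔤) : Submodule ℂ W.carrier where
  carrier := {w | ∀ x ∈ A, W.act x w = 0}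
  zero_mem' := fun _ _ => map_zero _
  add_mem' := fun hv hw x hx => by rw [map_add, hv x hx, hw x hx, add_zero]
  smul_mem' := fun c w hw x hx => by rw [map_smul, hw x hx, smul_zero]

variable {W : SuperRep.{v} L}

/-- In `x y w = [x,y] w ± y x w` both terms vanish, the first because `y` normalizes `A`. -/
theorem act_mem_annihilated {A : Submodule ℂ 𝔤} (hA : IsGradedSubspace L.part A) {j : ZMod 2}
    {y : 𝔤} (hy : y ∈ L.part j) (h : ∀ x ∈ A, L.bracket x y ∈ A) {w : W.carrier}
    (hw : w ∈ W.annihilated A) : W.act y w ∈ W.annihilated A := by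
  intro x hx
  have key : ∀ i, ∀ x ∈ A, x ∈ L.part i → W.act x (W.act y w) = 0 := by
    intro i x hx hxi
    rw [W.act_act hxi hy, hw x hx, hw _ (h x hx), map_zero, smul_zero, add_zero]
  obtain ⟨a, b, ha, hb, ha0, hb1, rfl⟩ := hA.exists_add hx
  rw [map_add, LinearMap.add_apply, key 0 a ha ha0, key 1 b hb hb1, add_zero]

theorem act_act_of_odd {x y : 𝔤} (hx : x ∈ L.part 1) (hy : y ∈ L.part 1) {w : W.carrier}
    (h : W.act (L.bracket x y) w = 0) : W.act x (W.act y w) = -W.act y (W.act x w) := by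
  rw [W.act_act hx hy, h, zero_add, mul_one, sgn_one, neg_one_smul]

/-- Anticommuting operators with square zero have a common null vector. -/
theorem inf_annihilated_ne_bot {Y : Submodule ℂ 𝔤} [FiniteDimensional ℂ 𝔤]
    {V : Submodule ℂ W.carrier} (hV : V ≠ ⊥) (hstab : ∀ y ∈ Y, ∀ w ∈ V, W.act y w ∈ V)
    (hanti : ∀ x ∈ Y, ∀ y ∈ Y, ∀ w ∈ V, W.act x (W.act y w) = -W.act y (W.act x w)) :
    V ⊓ W.annihilated Y ≠ ⊥ := by
  -- Induction on generators of `Y`. `V` stays arbitrary, since the second summand `B₂` is applied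
  -- to the null space of `B₁` in `V`, which is stable under `Y` by anticommutation.
  have key : ∀ (B : Submodule ℂ 𝔤), B.FG → B ≤ Y → ∀ V : Submodule ℂ W.carrier, V ≠ ⊥ →
      (∀ y ∈ Y, ∀ w ∈ V, W.act y w ∈ V) →
      (∀ x ∈ Y, ∀ y ∈ Y, ∀ w ∈ V, W.act x (W.act y w) = -W.act y (W.act x w)) →
      V ⊓ W.annihilated B ≠ ⊥ := by
    intro B hB
    induction B, hB using Submodule.fg_induction with
    | singleton y =>
      intro hY V hV hstab hanti
      have hy : y ∈ Y := hY (Submodule.mem_span_singleton_self y)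
      have hker : ∀ w, W.act y w = 0 → w ∈ W.annihilated (Submodule.span ℂ {y}) := by
        intro w hw x hx
        obtain ⟨c, rfl⟩ := Submodule.mem_span_singleton.1 hx
        rw [map_smul, LinearMap.smul_apply, hw, smul_zero]
      obtain ⟨w, hw, hw0⟩ := (Submodule.ne_bot_iff _).1 hV
      rw [Submodule.ne_bot_iff]
      -- Anticommutation of `y` with itself gives `y² = 0` on `V`, so `w` or `y w` is a nonzero null
      -- vector.
      by_cases h : W.act y w = 0
      · exact ⟨w, ⟨hw, hker w h⟩, hw0⟩
      · refine ⟨_, ⟨hstab y hy w hw, hker _ ?_⟩, h⟩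
        have h1 := hanti y hy y hy w hw
        rw [eq_neg_iff_add_eq_zero, ← two_smul ℂ] at h1
        exact (smul_eq_zero.1 h1).resolve_left two_ne_zero
    | sup B₁ B₂ _ _ ih₁ ih₂ =>
      intro hY V hV hstab hanti
      have h := ih₂ (le_sup_right.trans hY) _ (ih₁ (le_sup_left.trans hY) V hV hstab hanti)
        (fun y hy w hw => ⟨hstab y hy w hw.1, fun x hx => by
          rw [hanti x (hY (Submodule.mem_sup_left hx)) y hy w hw.1, hw.2 x hx, map_zero, neg_zero]⟩)
        (fun x hx y hy w hw => hanti x hx y hy w hw.1)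
      obtain ⟨w, ⟨⟨hw, hw1⟩, hw2⟩, hw0⟩ := (Submodule.ne_bot_iff _).1 h
      refine (Submodule.ne_bot_iff _).2 ⟨w, ⟨hw, fun x hx => ?_⟩, hw0⟩
      obtain ⟨a, ha, b, hb, rfl⟩ := Submodule.mem_sup.1 hx
      rw [map_add, LinearMap.add_apply, hw1 a ha, hw2 b hb, add_zero]
  exact key Y (IsNoetherian.noetherian Y) le_rfl V hV hstab hanti

/-- Lie's theorem for a solvable subalgebra of the even part. -/
theorem exists_annihilated_of_isSolvable (b : LieSubalgebra ℂ (L.part 0))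
    [LieAlgebra.IsSolvable b] [FiniteDimensional ℂ 𝔤] [FiniteDimensional ℂ W.carrier]
    {V : Submodule ℂ W.carrier} (hV : V ≠ ⊥) (hstab : ∀ y ∈ b, ∀ w ∈ V, W.act y w ∈ V) :
    ∃ w ∈ V, w ≠ 0 ∧ ∀ x ∈ b, ∀ y ∈ b, W.act (L.bracket x y) w = 0 := by
  let _ : LieRingModule b V :=
    { bracket := fun x w => ⟨W.act (x : L.part 0) w, hstab x x.2 w w.2⟩
      add_lie := fun x y w => Subtype.ext (by simp)
      lie_add := fun x v w => Subtype.ext (by simp)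
      leibniz_lie := fun x y w => Subtype.ext (by
        exact W.act_act_of_even (x : L.part 0).2 _ _) }
  have hbr : ∀ (x : b) (w : V), ((⁅x, w⁆ : V) : W.carrier) = W.act (x : L.part 0) w :=
    fun _ _ => rfl
  let _ : LieModule ℂ b V :=
    { smul_lie := fun c x w => Subtype.ext (by simp [hbr])
      lie_smul := fun c x w => Subtype.ext (by simp [hbr]) }
  have : Nontrivial V := Submodule.nontrivial_iff_ne_bot.2 hV
  -- Lie's theorem provides a simultaneous eigenvector. Commutators kill it because the eigenvalues
  -- commute.
  obtain ⟨χ, hχ⟩ := LieModule.exists_nontrivial_weightSpace_of_isSolvable ℂ b V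
  obtain ⟨⟨w, hw⟩, hw0⟩ := exists_ne (0 : LieModule.weightSpace V χ)
  rw [LieModule.mem_weightSpace] at hw
  have hw' : ∀ x (hx : x ∈ b), W.act x w = χ ⟨x, hx⟩ • (w : W.carrier) := fun x hx =>
    congrArg Subtype.val (hw ⟨x, hx⟩)
  refine ⟨w, w.2, fun h => hw0 (Subtype.ext (Subtype.ext h)), fun x hx y hy => ?_⟩
  have h := W.act_bracket 0 0 x y w x.2 y.2
  rw [mul_zero, sgn_zero, one_smul, hw' x hx, hw' y hy, map_smul, map_smul, hw' x hx, hw' y hy,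
    smul_comm, sub_self] at h
  exact h

end SuperRep

/-! ### Lowered vectors for odd `ū` -/

namespace TriangularDecomposition

variable {T : L.TriangularDecomposition} {W : SuperRep.{v} L}

/-- Since `[ū, ū]` is even and lies in the odd space `ū`, it vanishes, and `ū` acts by anticommuting
operators of square zero. A Nakayama argument follows: a `ū`-stable `M` with `M + ū·W = W` is all of
`W`. Taking `M = 0` rules out `ū·W = W`. -/
theorem lowered_ne_top_of_odd [FiniteDimensional ℂ 𝔤] [Nontrivial W.carrier]
    (h : T.ubar.carrier ≤ L.part 1) : T.lowered W ≠ ⊤ := by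
  have hbr : ∀ x ∈ T.ubar.carrier, ∀ y ∈ T.ubar.carrier, L.bracket x y = 0 := fun x hx y hy =>
    Submodule.disjoint_def.1 L.isCompl.disjoint _ (L.bracket_mem 1 1 x y (h hx) (h hy))
      (h (T.ubar.bracket_mem x y hx hy))
  have hanti : ∀ x ∈ T.ubar.carrier, ∀ y ∈ T.ubar.carrier, ∀ w,
      W.act x (W.act y w) = -W.act y (W.act x w) := fun x hx y hy w =>
    SuperRep.act_act_of_odd (h hx) (h hy) (by rw [hbr x hx y hy, map_zero, LinearMap.zero_apply])
  have key : ∀ (B : Submodule ℂ 𝔤), B.FG → B ≤ T.ubar.carrier → ∀ M : Submodule ℂ W.carrier,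
      (∀ y ∈ T.ubar.carrier, ∀ w ∈ M, W.act y w ∈ M) → M ⊔ Submodule.map₂ W.act B ⊤ = ⊤ →
      M = ⊤ := by
    intro B hB
    induction B, hB using Submodule.fg_induction with
    | singleton y =>
      intro hY M hM htop
      have hy : y ∈ T.ubar.carrier := hY (Submodule.mem_span_singleton_self y)
      have hyy : ∀ w, W.act y (W.act y w) = 0 := fun w => by
        have h1 := hanti y hy y hy w
        rw [eq_neg_iff_add_eq_zero, ← two_smul ℂ] at h1
        exact (smul_eq_zero.1 h1).resolve_left two_ne_zero
      -- Apply `y` to `W = M + y·W`: stability of `M` and `y² = 0` give `y·W ⊆ M`.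
      have hyM : ∀ w, W.act y w ∈ M := by
        intro w
        have hw : w ∈ M ⊔ Submodule.map₂ W.act (Submodule.span ℂ {y}) ⊤ := by rw [htop]; trivial
        refine (sup_le (fun w hw => hM y hy w hw) ?_ : _ ≤ M.comap (W.act y)) hw
        rw [Submodule.map₂_le]
        intro x hx w _
        obtain ⟨c, rfl⟩ := Submodule.mem_span_singleton.1 hx
        rw [Submodule.mem_comap, map_smul, LinearMap.smul_apply, map_smul, hyy, smul_zero]
        exact zero_mem _
      rw [← htop, left_eq_sup, Submodule.map₂_le]
      intro x hx w _
      obtain ⟨c, rfl⟩ := Submodule.mem_span_singleton.1 hx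
      rw [map_smul, LinearMap.smul_apply]
      exact M.smul_mem c (hyM w)
    | sup B₁ B₂ _ _ ih₁ ih₂ =>
      intro hY M hM htop
      -- First `B₂` is removed, with `M + B₁·W` in place of `M`. This space is `ū`-stable by
      -- anticommutation. Then `B₁` is removed.
      refine ih₁ (le_sup_left.trans hY) M hM (ih₂ (le_sup_right.trans hY) _ ?_ ?_)
      · intro y hy w hw
        refine (sup_le (fun w hw => Submodule.mem_sup_left (hM y hy w hw)) ?_ :
          _ ≤ (M ⊔ Submodule.map₂ W.act B₁ ⊤).comap (W.act y)) hw
        rw [Submodule.map₂_le]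
        intro x hx w _
        rw [Submodule.mem_comap, hanti y hy x (hY (Submodule.mem_sup_left hx))]
        exact neg_mem (Submodule.mem_sup_right
          (Submodule.apply_mem_map₂ _ hx (Submodule.mem_top (x := W.act y w))))
      · rwa [sup_assoc, ← Submodule.map₂_sup_left]
  intro htop
  have := key T.ubar.carrier (IsNoetherian.noetherian _) le_rfl ⊥ (fun y _ w hw => by
    rw [(Submodule.mem_bot ℂ).1 hw, map_zero]; exact zero_mem _) (by rw [bot_sup_eq]; exact htop)
  exact bot_ne_top this

end TriangularDecomposition

end LieSuperalgebra

/-! ### Gradings and solvability -/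

namespace LieSuperalgebra

variable {𝔤 : Type u} [AddCommGroup 𝔤] [Module ℂ 𝔤] {L : LieSuperalgebra ℂ 𝔤}

theorem _root_.SuperSpace.IsGradedSubspace.iSup {K V : Type*} [Field K] [AddCommGroup V]
    [Module K V] {p : ZMod 2 → Submodule K V} {ι : Sort*} {S : ι → Submodule K V}
    (hS : ∀ i, IsGradedSubspace p (S i)) : IsGradedSubspace p (⨆ i, S i) :=
  iSup_le fun i => (hS i).trans (sup_le_sup (inf_le_inf_right _ (le_iSup S i))
    (inf_le_inf_right _ (le_iSup S i)))

theorem _root_.SuperSpace.IsGradedSubspace.inf_part {K V : Type*} [Field K] [AddCommGroup V]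
    [Module K V] {p : ZMod 2 → Submodule K V} (S : Submodule K V) (i : ZMod 2) :
    IsGradedSubspace p (S ⊓ p i) := by
  intro x hx
  rcases zmod_two_cases i with rfl | rfl
  · exact Submodule.mem_sup_left ⟨hx, hx.2⟩
  · exact Submodule.mem_sup_right ⟨hx, hx.2⟩

/-- The derived series of `b` is bounded by any descending sequence of subspaces that is
compatible with brackets. -/
theorem mem_of_mem_derivedSeries (b : LieSubalgebra ℂ (L.part 0)) (P : ℕ → Submodule ℂ 𝔤)
    (m : ℕ) (h0 : ∀ x ∈ LieAlgebra.derivedSeries ℂ b m, ((x : L.part 0) : 𝔤) ∈ P 0)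
    (hP : ∀ n, ∀ x ∈ P n, ∀ y ∈ P n, L.bracket x y ∈ P (n + 1)) (n : ℕ) :
    ∀ x ∈ LieAlgebra.derivedSeries ℂ b (m + n), ((x : L.part 0) : 𝔤) ∈ P n := by
  induction n with
  | zero => exact h0
  | succ n ih =>
    intro x hx
    rw [← add_assoc, LieAlgebra.derivedSeries_def, LieAlgebra.derivedSeriesOfIdeal_succ,
      ← LieSubmodule.mem_toSubmodule, LieSubmodule.lieIdeal_oper_eq_linear_span'] at hx
    refine (Submodule.span_le.2 ?_ : _ ≤ ((P (n + 1)).comap (L.part 0).subtype).comap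
      b.toSubmodule.subtype) hx
    rintro _ ⟨y, hy, z, hz, rfl⟩
    exact hP n _ (ih y hy) _ (ih z hz)

section grading

/-- The sum of the components of degree at least `k`. -/
def upper (G : ℤ → Submodule ℂ 𝔤) (k : ℤ) : Submodule ℂ 𝔤 := ⨆ i : ℤ, ⨆ _ : k ≤ i, G i

variable {G : ℤ → Submodule ℂ 𝔤}

theorem le_upper {i k : ℤ} (h : k ≤ i) : G i ≤ upper G k := le_iSup₂_of_le i h le_rfl

theorem upper_antitone {i k : ℤ} (h : k ≤ i) : upper G i ≤ upper G k :=
  iSup₂_le fun _ hj => le_upper (h.trans hj)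

theorem upper_graded (hG : ∀ i, IsGradedSubspace L.part (G i)) (k : ℤ) :
    IsGradedSubspace L.part (upper G k) :=
  IsGradedSubspace.iSup fun i => IsGradedSubspace.iSup fun _ => hG i

theorem bracket_upper (hG : ∀ i j, Submodule.map₂ L.bracket (G i) (G j) ≤ G (i + j)) {i j k : ℤ}
    (hk : k ≤ i + j) {x y : 𝔤} (hx : x ∈ upper G i) (hy : y ∈ upper G j) :
    L.bracket x y ∈ upper G k := by
  have h1 : upper G i ≤ (upper G k).comap (L.bracket.flip y) := by
    refine iSup₂_le fun a ha z hz => ?_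
    have h2 : upper G j ≤ (upper G k).comap (L.bracket z) := by
      refine iSup₂_le fun c hc w hw => ?_
      exact le_upper (by omega) (hG a c (Submodule.apply_mem_map₂ _ hz hw))
    exact h2 hy
  exact h1 hx

/-- Only finitely many independent subspaces of a finite-dimensional space are nonzero, so the
degrees are bounded above. The form `n + 1` lets a descent over natural numbers end in degree one.
-/
theorem exists_upper_eq_bot [FiniteDimensional ℂ 𝔤] (hG : iSupIndep G) :
    ∃ n : ℕ, upper G (n + 1) = ⊥ := by
  obtain ⟨M, hM⟩ := (WellFoundedGT.finite_ne_bot_of_iSupIndep hG).bddAbove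
  refine ⟨M.toNat, ?_⟩
  rw [upper, iSup₂_eq_bot]
  intro i hi
  by_contra h
  have := hM h
  omega

/-- A solvable subalgebra in degree zero and the positive even part form a solvable algebra. -/
theorem isSolvable_of_grading [FiniteDimensional ℂ 𝔤] (hind : iSupIndep G)
    (hG : ∀ i j, Submodule.map₂ L.bracket (G i) (G j) ≤ G (i + j))
    (b0 : LieSubalgebra ℂ (L.part 0)) [LieAlgebra.IsSolvable b0] (hb0 : ∀ x ∈ b0, (x : 𝔤) ∈ G 0)
    (b : LieSubalgebra ℂ (L.part 0))
    (hb : ∀ x ∈ b, (x : 𝔤) ∈ b0.toSubmodule.map (L.part 0).subtype ⊔ upper G 1) :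
    LieAlgebra.IsSolvable b := by
  -- `C m` is the `m`-th derived algebra of `b0` inside `𝔤`. The derived series of `b` is bounded by
  -- `C m + upper G 1` until `C k = 0`. From there it is bounded by `upper G (m + 1)`, which
  -- eventually vanishes.
  let C : ℕ → Submodule ℂ 𝔤 := fun m =>
    ((LieAlgebra.derivedSeries ℂ b0 m).toSubmodule.map b0.toSubmodule.subtype).map
      (L.part 0).subtype
  have hC0 : ∀ m, C m ≤ upper G 0 := by
    rintro m _ ⟨_, ⟨x, _, rfl⟩, rfl⟩
    exact le_upper le_rfl (hb0 _ x.2)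
  have hCC : ∀ m, ∀ x ∈ C m, ∀ y ∈ C m, L.bracket x y ∈ C (m + 1) := by
    rintro m _ ⟨_, ⟨x, hx, rfl⟩, rfl⟩ _ ⟨_, ⟨y, hy, rfl⟩, rfl⟩
    refine ⟨_, ⟨(⁅(show b0 from x), (show b0 from y)⁆ : b0), ?_, rfl⟩, rfl⟩
    rw [LieAlgebra.derivedSeries_def, LieAlgebra.derivedSeriesOfIdeal_succ]
    exact LieSubmodule.lie_mem_lie hx hy
  obtain ⟨k, hk⟩ := LieAlgebra.IsSolvable.solvable ℂ b0
  have h1 := mem_of_mem_derivedSeries b (fun m => C m ⊔ upper G 1) 0 (by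
      intro x _
      have := hb x x.2
      refine (sup_le_sup_right ?_ _ : _ ≤ C 0 ⊔ upper G 1) this
      rintro _ ⟨y, hy, rfl⟩
      exact ⟨y, ⟨⟨y, hy⟩, trivial, rfl⟩, rfl⟩) (by
      intro m x hx y hy
      obtain ⟨c, hc, z, hz, rfl⟩ := Submodule.mem_sup.1 hx
      obtain ⟨c', hc', z', hz', rfl⟩ := Submodule.mem_sup.1 hy
      simp only [map_add, LinearMap.add_apply]
      rw [add_assoc]
      exact Submodule.add_mem_sup (hCC m c hc c' hc') (add_mem
        (bracket_upper hG (by norm_num) hz (hC0 m hc'))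
        (add_mem (bracket_upper hG (by norm_num) (hC0 m hc) hz')
          (bracket_upper hG (by norm_num) hz hz')))) k
  obtain ⟨n, hn⟩ := exists_upper_eq_bot hind
  have h2 := mem_of_mem_derivedSeries b (fun m => upper G (m + 1)) (0 + k) (by
      intro x hx
      have h := h1 x hx
      have hCk : C k = ⊥ := by simp only [C, hk]; simp
      rw [hCk, bot_sup_eq] at h
      simpa using h) (by
      intro m x hx y hy
      exact bracket_upper hG (by push_cast; omega) hx hy) n
  refine LieAlgebra.IsSolvable.mk (R := ℂ) (k := 0 + k + n) ((LieSubmodule.eq_bot_iff _).2 fun x hx => ?_)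
  have h := h2 x hx
  rw [hn] at h
  exact Subtype.ext (Subtype.ext h)

end grading

/-! ### Graded type: existence of vectors killed by `𝔲` -/

namespace TriangularDecomposition

variable {T : L.TriangularDecomposition} {W : SuperRep.{v} L}

/-- The null space of the components of degree at least `k` is shown to be nonzero by descending
induction on `k`. Odd elements of degree at least `k` anticommute on the previous null space and so
have a common null vector. Even ones lie in `[𝔟_0, 𝔟_0]`, which kills the eigenvector provided by
Lie's theorem for the solvable algebra `𝔟_0`. -/
theorem IsGradedType.invariants_ne_bot [FiniteDimensional ℂ 𝔤] (h : T.IsGradedType)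
    (hW : W.IsIrr) : T.invariantsSubmodule W ≠ ⊥ := by
  obtain ⟨G, hint, hgr, hbr, hl, hu, -, ⟨b0, b0', b, hbor, hb0', hb, hodd, hone⟩, hgen, -⟩ := h
  have hu' : T.u.carrier = upper G 1 := hu
  have hfin := hW.finite
  have hnt := hW.simple.nontrivial
  have hsolv := hbor.prop.2
  have hb0G : ∀ x ∈ b0, (x : 𝔤) ∈ G 0 := hbor.prop.1
  have hb0'0 : b0' ≤ upper G 0 := by
    rw [hb0']
    rintro _ ⟨x, hx, rfl⟩
    exact le_upper le_rfl (hb0G x hx)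
  have hb0'p : b0' ≤ L.part 0 := by
    rw [hb0']
    rintro _ ⟨x, hx, rfl⟩
    exact x.2
  rw [hu'] at hb
  have hub : upper G 1 ≤ b := hb ▸ le_sup_right
  have hb0'b : b0' ≤ b := hb ▸ le_sup_left
  have hbU : b ≤ upper G 0 := hb ▸ sup_le hb0'0 (upper_antitone (by norm_num))
  have hbb : ∀ x ∈ b, ∀ y ∈ b, L.bracket x y ∈ b := by
    intro x hx y hy
    rw [hb] at hx hy
    obtain ⟨c, hc, z, hz, rfl⟩ := Submodule.mem_sup.1 hx
    obtain ⟨c', hc', z', hz', rfl⟩ := Submodule.mem_sup.1 hy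
    simp only [map_add, LinearMap.add_apply]
    have hcc : L.bracket c c' ∈ b := by
      refine hb0'b ?_
      rw [hb0'] at hc hc' ⊢
      obtain ⟨p, hp, rfl⟩ := hc
      obtain ⟨q, hq, rfl⟩ := hc'
      exact ⟨⁅p, q⁆, b0.lie_mem hp hq, rfl⟩
    exact add_mem (add_mem hcc (hub (bracket_upper hbr (by norm_num) hz (hb0'0 hc'))))
      (add_mem (hub (bracket_upper hbr (by norm_num) (hb0'0 hc) hz'))
        (hub (bracket_upper hbr (by norm_num) hz hz')))
  -- The even part of `𝔟`, to which Lie's theorem is applied. It is solvable because `b0` is and all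
  -- the rest has positive degree.
  let bb : LieSubalgebra ℂ (L.part 0) :=
    { b.comap (L.part 0).subtype with
      lie_mem' := fun {x y} hx hy => hbb x hx y hy }
  have hbbs : LieAlgebra.IsSolvable bb :=
    isSolvable_of_grading hint.submodule_iSupIndep hbr b0 hb0G bb (fun x hx => by
      have : (x : 𝔤) ∈ b := hx
      rwa [hb, hb0'] at this)
  let D := Submodule.map₂ L.bracket (b ⊓ L.part 0) (b ⊓ L.part 0)
  have hD0 : D ≤ L.part 0 := Submodule.map₂_le.2 fun x hx y hy => by
    simpa using L.bracket_mem 0 0 x y hx.2 hy.2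
  -- the positive even part consists of brackets of even elements of `b`
  have heven : upper G 1 ⊓ L.part 0 ≤ D := by
    -- `S` is `([𝔟_0, 𝔟_0] ∩ 𝔲) + 𝔲_1`. It is closed under brackets because `hodd` returns brackets
    -- of odd elements to `[𝔟_0, 𝔟_0]`. It contains `𝔤^(1)` by `hone`, and therefore contains `𝔲`,
    -- which `𝔤^(1)` generates.
    let S : L.Subsuperalgebra :=
      { carrier := (D ⊓ upper G 1) ⊔ (upper G 1 ⊓ L.part 1)
        graded := IsGradedSubspace.sup
          (fun x hx => Submodule.mem_sup_left ⟨hx, hD0 hx.1⟩) (IsGradedSubspace.inf_part _ _)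
        bracket_mem := by
          intro x y hx hy
          obtain ⟨d, hd, o, ho, rfl⟩ := Submodule.mem_sup.1 hx
          obtain ⟨d', hd', o', ho', rfl⟩ := Submodule.mem_sup.1 hy
          have hU : ∀ x ∈ upper G 1, ∀ y ∈ upper G 1, L.bracket x y ∈ upper G 1 :=
            fun x hx y hy => bracket_upper hbr (by norm_num) hx hy
          simp only [map_add, LinearMap.add_apply]
          have h1 : L.bracket d d' ∈ D := Submodule.apply_mem_map₂ _
            ⟨hub hd.2, hD0 hd.1⟩ ⟨hub hd'.2, hD0 hd'.1⟩
          have h2 : L.bracket o o' ∈ D := hodd (Submodule.apply_mem_map₂ _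
            ⟨hub ho.1, ho.2⟩ ⟨hub ho'.1, ho'.2⟩)
          have h3 := L.bracket_mem 1 0 o d' ho.2 (hD0 hd'.1)
          have h4 := L.bracket_mem 0 1 d o' (hD0 hd.1) ho'.2
          exact add_mem
            (add_mem (Submodule.mem_sup_left ⟨h1, hU _ hd.2 _ hd'.2⟩)
              (Submodule.mem_sup_right ⟨hU _ ho.1 _ hd'.2, by simpa using h3⟩))
            (add_mem (Submodule.mem_sup_right ⟨hU _ hd.2 _ ho'.1, by simpa using h4⟩)
              (Submodule.mem_sup_left ⟨h2, hU _ ho.1 _ ho'.1⟩)) }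
    have hS : upper G 1 ≤ S.carrier := by
      rw [← hu']
      refine hgen S ((hgr 1).le_of_hom fun i x hx hxi => ?_)
      have hx1 : x ∈ upper G 1 := le_upper le_rfl hx
      rcases zmod_two_cases i with rfl | rfl
      · refine Submodule.mem_sup_left ⟨?_, hx1⟩
        have h1 : x ∈ G 1 ⊓ L.part 0 := ⟨hx, hxi⟩
        rw [← hone] at h1
        refine (Submodule.map₂_le.2 fun y hy z hz => ?_ : _ ≤ D) h1
        exact Submodule.apply_mem_map₂ _ ⟨hb0'b hy, hb0'p hy⟩
          ⟨hub (le_upper le_rfl hz.1), hz.2⟩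
      · exact Submodule.mem_sup_right ⟨hx1, hxi⟩
    rintro x ⟨hx, hx0⟩
    obtain ⟨d, hd, o, ho, rfl⟩ := Submodule.mem_sup.1 (hS hx)
    have ho0 : o = 0 := Submodule.disjoint_def.1 L.isCompl.disjoint _
      ((Submodule.add_mem_iff_right _ (hD0 hd.1)).1 hx0) ho.2
    rw [ho0, add_zero]
    exact hd.1
  -- descending induction on the degree
  have step : ∀ k : ℤ, 1 ≤ k → W.annihilated (upper G (k + 1)) ≠ ⊥ →
      W.annihilated (upper G k) ≠ ⊥ := by
    intro k hk h0
    have hVb : ∀ i, ∀ y ∈ b, y ∈ L.part i → ∀ w ∈ W.annihilated (upper G (k + 1)),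
        W.act y w ∈ W.annihilated (upper G (k + 1)) := fun i y hy hyi w hw =>
      SuperRep.act_mem_annihilated (upper_graded hgr _) hyi
        (fun x hx => bracket_upper hbr (by omega) hx (hbU hy)) hw
    -- Brackets of elements of degree at least `k` have degree at least `2k ≥ k + 1`, as `k ≥ 1`.
    -- They kill the present null space, so odd elements anticommute on it.
    have h1 := SuperRep.inf_annihilated_ne_bot (Y := upper G k ⊓ L.part 1) h0
      (fun y hy w hw => hVb 1 y (hub (upper_antitone hk hy.1)) hy.2 w hw)
      (fun x hx y hy w hw => SuperRep.act_act_of_odd hx.2 hy.2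
        (hw _ (bracket_upper hbr (by omega) hx.1 hy.1)))
    -- The common null space of the odd elements is still stable under `𝔟_0`, since bracketing with
    -- `𝔟_0` preserves parity and does not lower the degree. Lie's theorem thus applies inside it.
    obtain ⟨w, hw, hw0, hwD⟩ := SuperRep.exists_annihilated_of_isSolvable bb h1
      (fun y hy w hw => ⟨hVb 0 y hy y.2 w hw.1, SuperRep.act_mem_annihilated
        (IsGradedSubspace.inf_part _ _) y.2 (fun x hx => ⟨
          bracket_upper hbr (by omega) hx.1 (hbU hy), by
            simpa using L.bracket_mem 1 0 x y hx.2 y.2⟩) hw.2⟩)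
    refine (Submodule.ne_bot_iff _).2 ⟨w, fun x hx => ?_, hw0⟩
    obtain ⟨x0, x1, hx0, hx1, hx0', hx1', rfl⟩ := (upper_graded hgr k).exists_add hx
    have h2 : W.act x0 w = 0 := by
      refine (Submodule.map₂_le.2 fun y hy z hz => ?_ : D ≤ LinearMap.ker (W.act.flip w))
        (heven ⟨upper_antitone hk hx0, hx0'⟩)
      exact hwD ⟨y, hy.2⟩ hy.1 ⟨z, hz.2⟩ hz.1
    rw [map_add, LinearMap.add_apply, h2, hw.2 x1 ⟨hx1, hx1'⟩, add_zero]
  obtain ⟨n, hn⟩ := exists_upper_eq_bot hint.submodule_iSupIndep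
  have hdesc : ∀ m : ℕ, W.annihilated (upper G (m + 1)) ≠ ⊥ →
      W.annihilated (upper G 1) ≠ ⊥ := by
    intro m
    induction m with
    | zero => intro h; simpa using h
    | succ m ih =>
      intro h
      exact ih (step _ (by omega) (by push_cast at h; exact h))
  -- The descent starts where `upper G (n + 1)` is zero and annihilates every vector of `W`.
  have htop := hdesc n (by
    rw [hn]
    obtain ⟨w, hw⟩ := exists_ne (0 : W.carrier)
    refine (Submodule.ne_bot_iff _).2 ⟨w, fun x hx => ?_, hw⟩
    rw [(Submodule.mem_bot ℂ).1 hx, map_zero, LinearMap.zero_apply])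
  rw [← hu'] at htop
  exact htop

end TriangularDecomposition

end LieSuperalgebra

/-! ### The criterion and the two special types -/

theorem corollary4p9 {𝔤 : Type u} [AddCommGroup 𝔤] [Module ℂ 𝔤] [FiniteDimensional ℂ 𝔤]
    (L : LieSuperalgebra ℂ 𝔤) (τ : L.AntilinearInvolution) (T : L.TriangularDecomposition)
    (hT : T.IsStable τ) :
    -- the general criterion
    ((∀ W : LieSuperalgebra.SuperRep.{v} L, W.IsIrr →
        (T.invariants W).IsIrr ∧ (T.ind (T.invariants W)).HasUniqueMaximalSubrep) →
      ∀ (W : LieSuperalgebra.SuperRep.{v} L) (hW : W.IsIrr),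
        ∃ hWu : (T.invariants W).IsIrr,
          τ.EType W hW = (τ.restrict T.l hT.l).EType (T.invariants W) hWu) ∧
    -- the hyperbolic and graded types
    ((T.IsHyperbolic τ ∨ (T.IsGradedType ∧ T.ubar.carrier ≤ L.part 1)) →
      ∀ (W : LieSuperalgebra.SuperRep.{v} L) (hW : W.IsIrr),
        ∃ hWu : (T.invariants W).IsIrr,
          τ.EType W hW = (τ.restrict T.l hT.l).EType (T.invariants W) hWu) := by
  constructor
  · intro H W hW
    obtain ⟨hN, hmax⟩ := H W hW
    exact ⟨hN, T.EType_invariants hT hW hN fun W' hW' =>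
      T.homsExtend_of_hasUniqueMaximalSubrep hW.simple hW'.simple hN.simple.nontrivial hmax⟩
  · intro H W hW
    -- These inequalities are established for all irreducible modules, because the target of the
    -- extension property is an arbitrary irreducible module, such as the conjugate of `W`.
    have key : ∀ W : LieSuperalgebra.SuperRep.{v} L, W.IsIrr →
        T.invariantsSubmodule W ≠ ⊥ ∧ T.lowered W ≠ ⊤ := by
      intro W hW
      rcases H with h | ⟨h, hodd⟩
      · exact h.ne hW
      · have := hW.simple.nontrivial
        exact ⟨h.invariants_ne_bot hW, T.lowered_ne_top_of_odd hodd⟩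
    obtain ⟨h0, h1⟩ := key W hW
    have hN := T.isIrr_invariants hW h0 h1
    exact ⟨hN, T.EType_invariants hT hW hN fun W' hW' =>
      T.homsExtend_of_lowered_ne_top hW.simple hW'.simple h0 (key W' hW').1 h1 (key W' hW').2⟩
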